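/- Let $\mathbb S^1\subset\mathbb C$ be the unit circle with arc length. For $s>0$ and $1\le p<\infty$ write $s=m+\sigma$ with $m\in\mathbb N$, $0\le\sigma<1$, and, for integrable $u:\mathbb S^1\to\mathbb C$ and its weak derivatives $D^ju$ along the circle, let $$[u]_{s,p}=\begin{cases}\|D^mu\|_{L^p(\mathbb S^1)}&\text{if }\sigma=0,\\[1mm]\left(\displaystyle\int_{\mathbb S^1}\int_{\mathbb S^1}\frac{|D^mu(x)-D^mu(y)|^p}{|x-y|^{1+\sigma p}}\,dx\,dy\right)^{1/p}&\text{if }\sigma>0,\end{cases}\qquad \|u\|_{W^{s,p}}=\sum_{0\le j<s}\|D^ju\|_{L^p(\mathbb S^1)}+[u]_{s,p}.$$ Let $W^{s,p}(\mathbb S^1;\mathbb S^1)$ be the set of maps $f:\mathbb S^1\to\mathbb S^1$ with $\|f\|_{W^{s,p}}<\infty$. When $sp\ge1$, such maps have a degree $\deg f\in\mathbb Z$ (Brezis–Nirenberg): for all small $\varepsilon>0$ the means $\bar f_\varepsilon(e^{i\theta})=\frac1{2\varepsilon}\int_{\theta-\varepsilon}^{\theta+\varepsilon}f(e^{it})\,dt$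 do not vanish, and $\deg f$ is the degree of the continuous map $\bar f_\varepsilon/|\bar f_\varepsilon|$ of $\mathbb S^1$ into itself. For $d\in\mathbb Z$ let $\mathcal E_d=\{f\in W^{s,p}(\mathbb S^1;\mathbb S^1):\deg f=d\}$, and let $$\operatorname{dist}_{W^{s,p}}(\mathcal E_{d_1},\mathcal E_{d_2})=\inf_{f\in\mathcal E_{d_1}}\ \inf_{g\in\mathcal E_{d_2}}\ d_{W^{s,p}}(f,g),$$ where $d_{W^{s,p}}(f,g)$ is either $\|h-\frac1{2\pi}\int_{\mathbb S^1}h\|_{W^{s,p}}$ or $[h]_{s,p}$, with $h=f-g$. **Theorem.** For each of these two choices of the distance: 1. If $1<p<\infty$, then $\operatorname{dist}_{W^{1/p,p}}(\mathcal E_{d_1},\mathcal E_{d_2})=0$ for all $d_1,d_2\in\mathbb Z$. 2. If $s>0$ and $1\le p<\infty$ are such that $sp>1$, then there are constants $C_{s,p},C'_{s,p}>0$, depending only on $s$ and $p$, such that $$C'_{s,p}\,|d_1-d_2|^s\le\operatorname{dist}_{W^{s,p}}(\mathcal E_{d_1},\mathcal E_{d_2})\le C_{s,p}\,|d_1-d_2|^s\qquad\text{for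 all }d_1,d_2\in\mathbb Z.$$ -/

import Mathlib

open MeasureTheory Filter Topology
open scoped ENNReal ContDiff

noncomputable section

instance instMeasurableSpaceCircle : MeasurableSpace Circle := borel Circle

instance instBorelSpaceCircle : BorelSpace Circle := ⟨rfl⟩

/-- Arc length on the unit circle `S¹ ⊂ ℂ`, of total mass `2π`. -/
def arcLength : Measure Circle :=
  Measure.map Circle.exp (volume.restrict (Set.Ioc (-Real.pi) Real.pi))

/-- `v` is the `k`-th weak derivative of `u` on the circle with respect to the angle (arc length):
both are integrable and `∫ φ⁽ᵏ⁾ u = (-1)ᵏ ∫ φ v` for all smooth test functions `φ` on the circle,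
written as smooth `2π`-periodic functions of the angle. -/
def HasWeakDeriv (k : ℕ) (u v : Circle → ℂ) : Prop :=
  Integrable u arcLength ∧ Integrable v arcLength ∧
    ∀ φ : ℝ → ℝ, ContDiff ℝ ∞ φ → Function.Periodic φ (2 * Real.pi) →
      ∫ θ in (-Real.pi)..Real.pi, iteratedDeriv k φ θ • u (Circle.exp θ) =
        (-1) ^ k * ∫ θ in (-Real.pi)..Real.pi, φ θ • v (Circle.exp θ)

/-- The `Lᵖ` norm of the `k`-th weak derivative of `u`. The weak derivative is unique up to null
sets, so the infimum is its norm; it is `∞` if there is no weak derivative. -/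
def weakDerivLpNorm (k : ℕ) (p : ℝ) (u : Circle → ℂ) : ℝ≥0∞ :=
  ⨅ (v : Circle → ℂ) (_ : HasWeakDeriv k u v), eLpNorm v (ENNReal.ofReal p) arcLength

/-- The Gagliardo semi-norm
`(∫∫ |v(x) - v(y)|ᵖ / |x - y|^(1 + σp) dx dy)^(1/p)` on the circle, for `0 < σ < 1`. -/
def gagliardo (σ p : ℝ) (v : Circle → ℂ) : ℝ≥0∞ :=
  (∫⁻ x, ∫⁻ y, ‖v x - v y‖ₑ ^ p / ‖(x : ℂ) - (y : ℂ)‖ₑ ^ (1 + σ * p) ∂arcLength ∂arcLength) ^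
    (1 / p)

/-- The leading semi-norm of `W^{s,p}(S¹; ℂ)`. With `s = m + σ`, `m` an integer, `0 ≤ σ < 1`, it is
`‖D^m u‖_{Lᵖ}` if `σ = 0` and the Gagliardo semi-norm of order `σ` of `D^m u` if `σ > 0`;
it is `∞` if `D^m u` does not exist. -/
def sobolevSeminorm (s p : ℝ) (u : Circle → ℂ) : ℝ≥0∞ :=
  if Int.fract s = 0 then weakDerivLpNorm ⌊s⌋₊ p u
  else ⨅ (v : Circle → ℂ) (_ : HasWeakDeriv ⌊s⌋₊ u v), gagliardo (Int.fract s) p v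

/-- The full norm of `W^{s,p}(S¹; ℂ)`: the `Lᵖ` norms of all the derivatives of integer order
`j < s`, plus the leading semi-norm. It is finite exactly on `W^{s,p}`. -/
def sobolevNorm (s p : ℝ) (u : Circle → ℂ) : ℝ≥0∞ :=
  ∑ j ∈ Finset.range ⌈s⌉₊, weakDerivLpNorm j p u + sobolevSeminorm s p u

/-- The distance `‖h - ⨍ h‖_{W^{s,p}}`, where `h = f - g`. -/
def sobolevDist (s p : ℝ) (f g : Circle → Circle) : ℝ≥0∞ :=
  sobolevNorm s p fun z =>
    ((f z : ℂ) - (g z : ℂ)) - ⨍ w, ((f w : ℂ) - (g w : ℂ)) ∂arcLength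

/-- The distance given by the leading semi-norm of `f - g`: the Gagliardo distance if `0 < s < 1`,
and `‖f' - g'‖_{Lᵖ}` if `s = 1`. -/
def sobolevSemidist (s p : ℝ) (f g : Circle → Circle) : ℝ≥0∞ :=
  sobolevSeminorm s p fun z => (f z : ℂ) - (g z : ℂ)

/-- The mean value of `f` over the arc of radius `ε` centred at `e^{iθ}`. -/
def arcMean (f : Circle → Circle) (ε θ : ℝ) : ℂ :=
  (2 * ε)⁻¹ • ∫ t in (θ - ε)..(θ + ε), (f (Circle.exp t) : ℂ)

/-- The closed curve `F`, a function of the angle, avoids `0` and `F / |F|` has degree `d`: there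
is a continuous choice `φ` of the argument of `F`, and it increases by `2πd` over a period. -/
def HasWinding (F : ℝ → ℂ) (d : ℤ) : Prop :=
  (∀ θ, F θ ≠ 0) ∧ ∃ φ : ℝ → ℝ, Continuous φ ∧
    (∀ θ, F θ = (‖F θ‖ : ℂ) * (Circle.exp (φ θ) : ℂ)) ∧
    ∀ θ, φ (θ + 2 * Real.pi) = φ θ + 2 * Real.pi * d

/-- `deg f = d` in the sense of the degree of Brezis and Nirenberg for VMO maps: for all small
`ε > 0`, the mean values of `f` over the arcs of radius `ε` do not vanish, and they define, after
normalization, a continuous map of the circle into itself of degree `d`. -/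
def HasDegree (f : Circle → Circle) (d : ℤ) : Prop :=
  ∀ᶠ ε in 𝓝[>] (0 : ℝ), HasWinding (arcMean f ε) d

/-- The class `E_d` of the maps in `W^{s,p}(S¹; S¹)` of degree `d`. -/
def degreeClass (s p : ℝ) (d : ℤ) : Set (Circle → Circle) :=
  {f | sobolevNorm s p (fun z => (f z : ℂ)) < ⊤ ∧ HasDegree f d}

/-- The distance `inf_{f ∈ E_{d₁}} inf_{g ∈ E_{d₂}} δ(f, g)` between two classes. -/
def classDist (δ : (Circle → Circle) → (Circle → Circle) → ℝ≥0∞) (s p : ℝ) (d₁ d₂ : ℤ) : ℝ≥0∞ :=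
  ⨅ f ∈ degreeClass s p d₁, ⨅ g ∈ degreeClass s p d₂, δ f g

end

/-! ### Arc length, its invariance, and functions of the angle. -/

section CircleMeasure

/-! Supercritical lower bound. If `sp > 1`, maps in the two classes have continuous representatives
`F = exp(iφ₁)`, `G = exp(iφ₂)`, and the phase difference `ψ` gains `2πd`, `d = |d₁ - d₂|`, over a
turn. At points with `ψ ∈ 2πℤ` the difference `H = F - G` vanishes; at points with `ψ ∈ π + 2πℤ` it
has modulus 2. These points alternate at least `d` times per turn. On an interval `J` that contains
enough zeros, with a point of modulus 2 in the middle, one has `2 ≤ C |J|^(s - 1/p) ·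
energy(J)^(1/p)`. For `⌊s⌋ = 0` this is Morrey's inequality from one zero
(`norm_sub_le_of_localEnergy_le`). For `⌊s⌋ = k + 1`, group `2k + 2` consecutive zeros and project
`H` on the direction of its value at the middle point: Rolle's theorem gives zeros of the
derivatives up to order `k`, a Poincaré inequality bounds the `k`-th derivative by the energy of the
next one, and the mean value theorem brings the bound back to `H` (`abs_le_pow_mul_of_zeros`,
`norm_le_of_zeros`). Over `2k + 1` turns there are `d` disjoint such intervals of bounded total
length, so at least half of them have length of order at most `1/d`, and the energies add up to at
least a multiple of `d^(sp)` (`rpow_le_of_sum_le`, `rpow_winding_le_energy`).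

Upper bound. Take smooth phases `η`, `ζ` of degree one that vary on opposite half circles. The maps
`exp(i(d₂ζ + (d₁ - d₂)η))` and `exp(i d₂ζ)` differ by `exp(i(d₁ - d₂)η) - 1`: the common factor
disappears because it is 1 wherever the difference is not 0. The `j`-th derivative is `O(|d₁ -
d₂|^j)`, and interpolation gives `|d₁ - d₂|^s` (`exists_sobolevNorm_le`, `exists_sobolevDist_le`).

Critical case `s = 1/p`, `p > 1`. There are Lipschitz maps of degrees 1 and 0 whose difference is
`2i cos(min(π/2, c log(1 + |x|/δ)))`, where `c log(1 + 1/δ) = π/2` (`exists_bubble`). Such a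
logarithmic profile has energy at most a multiple of `c^p log(1 + π/δ)`, which is of order `c^(p-1)`
and tends to 0 with `c` (`exists_gagliardo_rpow_le_of_log`). Composition with `z ↦ z^(d₁ - d₂)` and
multiplication by `z^d₂` turn the degrees into `d₁` and `d₂` at the price of a constant independent
of `c`.

Constants do not affect the leading semi-norm, so the semi-norm distance is at most the full one.
Lower bounds are therefore proved for the former, upper bounds for the latter. -/

instance instFactTwoPiPos : Fact (0 < 2 * Real.pi) := ⟨Real.two_pi_pos⟩

/-- Gives access to periodic integration on `AddCircle`, where a period may start at any angle. -/
theorem arcLength_eq_map_addCircle :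
    arcLength = Measure.map AddCircle.homeomorphCircle'
      (volume : Measure (AddCircle (2 * Real.pi))) := by
  rw [← (AddCircle.measurePreserving_mk (2 * Real.pi) (-Real.pi)).map_eq,
    Measure.map_map AddCircle.homeomorphCircle'.continuous.measurable AddCircle.measurable_mk',
    arcLength]
  have : -Real.pi + 2 * Real.pi = Real.pi := by ring
  rw [this]
  rfl

theorem lintegral_arcLength (a : ℝ) (F : Circle → ℝ≥0∞) :
    ∫⁻ z, F z ∂arcLength = ∫⁻ t in Set.Ioc a (a + 2 * Real.pi), F (Circle.exp t) := by
  have h := lintegral_map_equiv (μ := (volume : Measure (AddCircle (2 * Real.pi)))) F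
    AddCircle.homeomorphCircle'.toMeasurableEquiv
  rw [Homeomorph.toMeasurableEquiv_coe, ← arcLength_eq_map_addCircle] at h
  rw [h, ← AddCircle.lintegral_preimage (2 * Real.pi) a]
  rfl

theorem integral_arcLength {E : Type*} [NormedAddCommGroup E] [NormedSpace ℝ E] (a : ℝ)
    (F : Circle → E) :
    ∫ z, F z ∂arcLength = ∫ t in a..(a + 2 * Real.pi), F (Circle.exp t) := by
  have h := integral_map_equiv (μ := (volume : Measure (AddCircle (2 * Real.pi))))
    AddCircle.homeomorphCircle'.toMeasurableEquiv F
  rw [Homeomorph.toMeasurableEquiv_coe, ← arcLength_eq_map_addCircle] at h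
  rw [h, ← AddCircle.intervalIntegral_preimage (2 * Real.pi) a]
  rfl

theorem arcLength_univ : arcLength Set.univ = ENNReal.ofReal (2 * Real.pi) := by
  have := lintegral_arcLength 0 (fun _ => 1)
  simpa using this

instance instIsFiniteMeasureArcLength : IsFiniteMeasure arcLength :=
  ⟨by rw [arcLength_univ]; exact ENNReal.ofReal_lt_top⟩

theorem lintegral_arcLength_mul_left (w : Circle) (F : Circle → ℝ≥0∞) :
    ∫⁻ z, F (w * z) ∂arcLength = ∫⁻ z, F z ∂arcLength := by
  obtain ⟨s, rfl⟩ := Circle.exp_surjective w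
  rw [lintegral_arcLength 0, lintegral_arcLength (s + 0)]
  have h : MeasurePreserving (fun x : ℝ => s + x)
      (volume.restrict (Set.Ioc 0 (0 + 2 * Real.pi)))
      (volume.restrict (Set.Ioc (s + 0) (s + 0 + 2 * Real.pi))) := by
    have := (measurePreserving_add_left volume s).restrict_preimage
      (measurableSet_Ioc (a := s + 0) (b := s + 0 + 2 * Real.pi))
    simpa [Set.preimage_const_add_Ioc] using this
  rw [← h.lintegral_comp_emb (measurableEmbedding_addLeft s)]
  simp [Circle.exp_add]

instance instIsMulLeftInvariantArcLength : arcLength.IsMulLeftInvariant := by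
  constructor
  intro w
  ext A hA
  rw [Measure.map_apply (measurable_const_mul w) hA]
  have := lintegral_arcLength_mul_left w (A.indicator 1)
  rw [lintegral_indicator_one hA] at this
  rw [← this, ← lintegral_indicator_one (measurable_const_mul w hA)]
  rfl

instance instIsHaarMeasureArcLength : arcLength.IsHaarMeasure := by
  refine Measure.isHaarMeasure_of_isCompact_nonempty_interior _ Set.univ isCompact_univ
    (by simp) ?_ ?_
  · rw [arcLength_univ]; simp [Real.pi_pos]
  · exact measure_ne_top _ _

/-- Arc length is a Haar measure, and a continuous surjective endomorphism of a compact group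
preserves Haar measure; surjectivity is division of the angle by `n`. This is what allows the
critical bubble to be composed with a power of `z`. -/
theorem measurePreserving_zpow_arcLength {n : ℤ} (hn : n ≠ 0) :
    MeasurePreserving (fun z : Circle => z ^ n) arcLength arcLength := by
  refine (zpowGroupHom (α := Circle) n).measurePreserving (continuous_zpow n) ?_ rfl
  intro z
  obtain ⟨s, rfl⟩ := Circle.exp_surjective z
  refine ⟨Circle.exp (s / n), ?_⟩
  have : (n : ℝ) ≠ 0 := by exact_mod_cast hn
  rw [zpowGroupHom_apply, ← Circle.exp_zsmul]
  congr 1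
  simp; field_simp

/-- A set of full measure on the circle lifts to a set of full measure of angles. -/
theorem ae_exp_of_ae_arcLength {P : Circle → Prop} (h : ∀ᵐ z ∂arcLength, P z) :
    ∀ᵐ t : ℝ, P (Circle.exp t) := by
  have h1 : ∀ a : ℝ, ∀ᵐ t ∂volume.restrict (Set.Ioc a (a + 2 * Real.pi)), P (Circle.exp t) := by
    intro a
    obtain ⟨S, hS, hSm, hS0⟩ := exists_measurable_superset_of_null (ae_iff.1 h)
    have := lintegral_arcLength a (S.indicator 1)
    rw [lintegral_indicator_one hSm, hS0] at this
    have hm : MeasurableSet (Circle.exp ⁻¹' S) := Circle.exp.continuous.measurable hSm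
    have h3 : volume.restrict (Set.Ioc a (a + 2 * Real.pi)) (Circle.exp ⁻¹' S) = 0 := by
      rw [← lintegral_indicator_one hm, this]; rfl
    refine measure_mono_null ?_ h3
    intro t ht
    exact hS ht
  have h2 : ∀ᵐ t ∂volume.restrict (⋃ k : ℤ, Set.Ioc (k • (2 * Real.pi))
      ((k + 1) • (2 * Real.pi))), P (Circle.exp t) := by
    rw [ae_restrict_iUnion_iff]
    intro k
    have := h1 (k • (2 * Real.pi))
    rwa [add_smul, one_smul]
  rwa [iUnion_Ioc_zsmul Real.two_pi_pos, Measure.restrict_univ] at h2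

theorem intervalIntegrable_exp_of_integrable {E : Type*} [NormedAddCommGroup E]
    {u : Circle → E} (hu : Integrable u arcLength) (a b : ℝ) :
    IntervalIntegrable (fun t => u (Circle.exp t)) volume a b := by
  have hp : Function.Periodic (fun t : ℝ => u (Circle.exp t)) (2 * Real.pi) := fun t => by
    simp only [Circle.exp_add_two_pi]
  refine hp.intervalIntegrable Real.two_pi_pos.ne' (t := -Real.pi) ?_ a b
  have h2 : -Real.pi + 2 * Real.pi = Real.pi := by ring
  rw [h2, intervalIntegrable_iff_integrableOn_Ioc_of_le (by linarith [Real.pi_pos])]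
  exact hu.comp_measurable Circle.exp.continuous.measurable

theorem locallyIntegrable_exp_of_integrable {E : Type*} [NormedAddCommGroup E]
    {u : Circle → E} (hu : Integrable u arcLength) :
    LocallyIntegrable (fun t => u (Circle.exp t)) volume := by
  rw [locallyIntegrable_iff]
  intro K hK
  obtain ⟨a, ha⟩ := hK.bddBelow
  obtain ⟨b, hb⟩ := hK.bddAbove
  exact ((intervalIntegrable_iff_integrableOn_Icc_of_le min_le_max).1
    (intervalIntegrable_exp_of_integrable hu (min a b) (max a b))).mono_set fun x hx =>
      ⟨(min_le_left _ _).trans (ha hx), (hb hx).trans (le_max_right _ _)⟩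

theorem measurePreserving_arg_arcLength :
    MeasurePreserving (fun z : Circle => Complex.arg z) arcLength
      (volume.restrict (Set.Ioc (-Real.pi) Real.pi)) := by
  have hm : Measurable (fun z : Circle => Complex.arg z) :=
    Complex.measurable_arg.comp (show Continuous fun z : Circle => (z : ℂ) by fun_prop).measurable
  refine ⟨hm, ?_⟩
  rw [arcLength, Measure.map_map hm Circle.exp.continuous.measurable]
  conv_rhs => rw [← Measure.map_id (μ := volume.restrict (Set.Ioc (-Real.pi) Real.pi))]
  refine Measure.map_congr ?_
  filter_upwards [ae_restrict_mem measurableSet_Ioc] with t ht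
  exact Circle.arg_exp ht.1 ht.2

theorem Function.Periodic.apply_arg_exp {α : Type*} {P : ℝ → α}
    (hP : Function.Periodic P (2 * Real.pi)) (t : ℝ) :
    P (Complex.arg (Circle.exp t)) = P t := by
  obtain ⟨m, hm⟩ := Circle.exp_eq_exp.1 (Circle.exp_arg (Circle.exp t))
  rw [hm, hP.int_mul m t]

end CircleMeasure

/-! ### Test functions, uniqueness of weak derivatives, integration by parts. -/

open scoped Manifold in
-- Links the test functions of `HasWeakDeriv`, periodic in the angle, to smooth functions on the
-- circle as a manifold, the setting of the fundamental lemma of the calculus of variations.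
theorem contDiff_circle_comp_exp {g : Circle → ℝ} (hg : ContMDiff (𝓡 1) 𝓘(ℝ) ∞ g) :
    ContDiff ℝ ∞ (fun t : ℝ => g (Circle.exp t)) :=
  (hg.comp contMDiff_circleExp).contDiff

/-- A periodic function orthogonal to all smooth periodic functions vanishes almost everywhere. -/
theorem ae_eq_zero_of_forall_integral_smooth_periodic {D : ℝ → ℂ}
    (hD : Function.Periodic D (2 * Real.pi))
    (hi : IntervalIntegrable D volume (-Real.pi) Real.pi)
    (h : ∀ φ : ℝ → ℝ, ContDiff ℝ ∞ φ → Function.Periodic φ (2 * Real.pi) →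
      ∫ θ in (-Real.pi)..Real.pi, φ θ • D θ = 0) :
    ∀ᵐ t : ℝ, D t = 0 := by
  have hle : -Real.pi ≤ Real.pi := by linarith [Real.pi_pos]
  have hint : Integrable (fun z : Circle => D (Complex.arg z)) arcLength :=
    (measurePreserving_arg_arcLength.integrable_comp
      ((intervalIntegrable_iff_integrableOn_Ioc_of_le hle).1 hi).aestronglyMeasurable).2
      ((intervalIntegrable_iff_integrableOn_Ioc_of_le hle).1 hi)
  have key := ae_eq_zero_of_integral_contMDiff_smul_eq_zero (modelWithCornersSelf ℝ (EuclideanSpace ℝ (Fin 1)))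
    hint.locallyIntegrable ?_
  · filter_upwards [ae_exp_of_ae_arcLength key] with t ht
    rwa [hD.apply_arg_exp] at ht
  · intro g hg _
    rw [integral_arcLength (-Real.pi)]
    simp_rw [hD.apply_arg_exp]
    have := h (fun t => g (Circle.exp t)) (contDiff_circle_comp_exp hg) fun t => by
      simp only [Circle.exp_add_two_pi]
    rwa [show -Real.pi + 2 * Real.pi = Real.pi by ring]

/-- For `⌊s⌋ = 0` the semi-norm is still an infimum over weak derivatives of order zero; these are
all copies of the function itself. -/
theorem HasWeakDeriv.ae_eq {u v : Circle → ℂ} (h : HasWeakDeriv 0 u v) : u =ᵐ[arcLength] v := by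
  have key := ae_eq_zero_of_integral_contMDiff_smul_eq_zero
    (modelWithCornersSelf ℝ (EuclideanSpace ℝ (Fin 1)))
    (h.1.sub h.2.1).locallyIntegrable ?_
  · filter_upwards [key] with z hz
    simpa [sub_eq_zero] using hz
  · intro g hg _
    have h3 := h.2.2 (fun t => g (Circle.exp t)) (contDiff_circle_comp_exp hg) fun t => by
      simp only [Circle.exp_add_two_pi]
    have hc : Continuous fun t : ℝ => g (Circle.exp t) := (contDiff_circle_comp_exp hg).continuous
    rw [integral_arcLength (-Real.pi), show -Real.pi + 2 * Real.pi = Real.pi by ring]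
    simp only [Pi.sub_apply, smul_sub]
    rw [intervalIntegral.integral_sub
      ((intervalIntegrable_exp_of_integrable h.1 _ _).continuousOn_smul hc.continuousOn)
      ((intervalIntegrable_exp_of_integrable h.2.1 _ _).continuousOn_smul hc.continuousOn)]
    simpa [sub_eq_zero] using h3

/-- Integration by parts for an absolutely continuous primitive. The boundary terms cancel because
`φ` is periodic and the zero mean of `V` makes the primitive take equal values at both ends. -/
theorem integral_deriv_mul_primitive_periodic {V : ℝ → ℝ}
    (hV : ∀ a b, IntervalIntegrable V volume a b)
    (h0 : ∫ t in (-Real.pi)..Real.pi, V t = 0) (c : ℝ)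
    {φ : ℝ → ℝ} (hφ : ContDiff ℝ ∞ φ) (hper : Function.Periodic φ (2 * Real.pi)) :
    ∫ t in (-Real.pi)..Real.pi, deriv φ t * (c + ∫ x in (0:ℝ)..t, V x) =
      -∫ t in (-Real.pi)..Real.pi, φ t * V t := by
  have hac : AbsolutelyContinuousOnInterval (fun t => c + ∫ x in (0:ℝ)..t, V x)
      (-Real.pi) Real.pi := by
    refine AbsolutelyContinuousOnInterval.add ?_ ?_
    · exact (LipschitzWith.const c).lipschitzOnWith.absolutelyContinuousOnInterval
    · refine (hV (-Real.pi) Real.pi).absolutelyContinuousOnInterval_intervalIntegral ?_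
      rw [Set.uIcc_of_le (by linarith [Real.pi_pos])]
      exact ⟨by linarith [Real.pi_pos], Real.pi_pos.le⟩
  have hφac : AbsolutelyContinuousOnInterval φ (-Real.pi) Real.pi :=
    (hφ.of_le (by norm_cast)).contDiffOn.absolutelyContinuousOnInterval
  have h := hac.integral_mul_deriv_eq_deriv_mul hφac
  have hend : (∫ x in (0:ℝ)..Real.pi, V x) = ∫ x in (0:ℝ)..(-Real.pi), V x := by
    rw [← sub_eq_zero, intervalIntegral.integral_interval_sub_left (hV _ _) (hV _ _), h0]
  have hφe : φ (-Real.pi) = φ Real.pi := by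
    have := hper (-Real.pi)
    rw [show -Real.pi + 2 * Real.pi = Real.pi by ring] at this
    exact this.symm
  have hd : ∫ t in (-Real.pi)..Real.pi, deriv (fun t => c + ∫ x in (0:ℝ)..t, V x) t * φ t =
      ∫ t in (-Real.pi)..Real.pi, φ t * V t := by
    refine intervalIntegral.integral_congr_ae ?_
    filter_upwards [(hV (-Real.pi) Real.pi).ae_hasDerivAt_integral] with t ht ht2
    have := ht (Set.uIoc_subset_uIcc ht2) 0 (by
      rw [Set.uIcc_of_le (by linarith [Real.pi_pos])]
      exact ⟨by linarith [Real.pi_pos], Real.pi_pos.le⟩)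
    rw [(this.const_add c).deriv, mul_comm]
  rw [hd, hend, hφe] at h
  simp_rw [mul_comm (deriv φ _)]
  rw [h]; ring

theorem integral_deriv_smul_primitive_periodic {V : ℝ → ℂ}
    (hV : ∀ a b, IntervalIntegrable V volume a b)
    (h0 : ∫ t in (-Real.pi)..Real.pi, V t = 0) (c : ℂ)
    {φ : ℝ → ℝ} (hφ : ContDiff ℝ ∞ φ) (hper : Function.Periodic φ (2 * Real.pi)) :
    ∫ t in (-Real.pi)..Real.pi, deriv φ t • (c + ∫ x in (0:ℝ)..t, V x) =
      -∫ t in (-Real.pi)..Real.pi, φ t • V t := by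
  have hdc : Continuous (deriv φ) := hφ.continuous_deriv (by norm_cast)
  have hpc : Continuous fun t => c + ∫ x in (0:ℝ)..t, V x :=
    continuous_const.add (intervalIntegral.continuous_primitive hV 0)
  have hi1 : IntervalIntegrable (fun t => deriv φ t • (c + ∫ x in (0:ℝ)..t, V x)) volume
      (-Real.pi) Real.pi := (hdc.smul hpc).intervalIntegrable _ _
  have hi2 : IntervalIntegrable (fun t => φ t • V t) volume (-Real.pi) Real.pi :=
    (hV _ _).continuousOn_smul hφ.continuous.continuousOn
  have aux : ∀ L : ℂ →L[ℝ] ℝ, L (∫ t in (-Real.pi)..Real.pi,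
      deriv φ t • (c + ∫ x in (0:ℝ)..t, V x)) = L (-∫ t in (-Real.pi)..Real.pi, φ t • V t) := by
    intro L
    have hLV : ∀ a b, IntervalIntegrable (fun t => L (V t)) volume a b := fun a b =>
      ⟨L.integrable_comp (hV a b).1, L.integrable_comp (hV a b).2⟩
    rw [map_neg, ← L.intervalIntegral_comp_comm hi1, ← L.intervalIntegral_comp_comm hi2]
    simp only [map_smul, map_add, smul_eq_mul]
    simp_rw [← L.intervalIntegral_comp_comm (hV _ _)]
    refine integral_deriv_mul_primitive_periodic hLV ?_ (L c) hφ hper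
    rw [L.intervalIntegral_comp_comm (hV _ _), h0, map_zero]
  exact Complex.ext (aux Complex.reCLM) (aux Complex.imCLM)

/-! ### Iterated periodic primitives and the regular representative. -/

noncomputable section PeriodicPrimitive

/-- The primitive of a function with zero mean on `[-π, π]`. -/
def zeroMeanPrimitive {E : Type*} [NormedAddCommGroup E] [NormedSpace ℝ E] (V : ℝ → E) (x : ℝ) :
    E :=
  -((2 * Real.pi)⁻¹ • ∫ t in (-Real.pi)..Real.pi, ∫ s in (0:ℝ)..t, V s) + ∫ s in (0:ℝ)..x, V s

variable {E : Type*} [NormedAddCommGroup E] [NormedSpace ℝ E] {V : ℝ → E}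

theorem continuous_zeroMeanPrimitive (hV : ∀ a b, IntervalIntegrable V volume a b) :
    Continuous (zeroMeanPrimitive V) :=
  continuous_const.add (intervalIntegral.continuous_primitive hV 0)

theorem zeroMeanPrimitive_sub (hV : ∀ a b, IntervalIntegrable V volume a b) (x y : ℝ) :
    zeroMeanPrimitive V y - zeroMeanPrimitive V x = ∫ s in x..y, V s := by
  rw [← intervalIntegral.integral_interval_sub_left (hV 0 y) (hV 0 x), zeroMeanPrimitive,
    zeroMeanPrimitive]
  abel

theorem periodic_zeroMeanPrimitive (hV : ∀ a b, IntervalIntegrable V volume a b)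
    (hp : Function.Periodic V (2 * Real.pi)) (h0 : ∫ t in (-Real.pi)..Real.pi, V t = 0) :
    Function.Periodic (zeroMeanPrimitive V) (2 * Real.pi) := by
  intro x
  rw [← sub_eq_zero, zeroMeanPrimitive_sub hV, hp.intervalIntegral_add_eq x (-Real.pi), ← h0]
  congr 1; ring

theorem integral_zeroMeanPrimitive [CompleteSpace E]
    (hV : ∀ a b, IntervalIntegrable V volume a b) :
    ∫ t in (-Real.pi)..Real.pi, zeroMeanPrimitive V t = 0 := by
  unfold zeroMeanPrimitive
  rw [intervalIntegral.integral_add (by simp)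
    ((intervalIntegral.continuous_primitive hV 0).intervalIntegrable _ _),
    intervalIntegral.integral_const, sub_neg_eq_add, ← two_mul, smul_neg, smul_smul,
    mul_inv_cancel₀ Real.two_pi_pos.ne', one_smul, neg_add_cancel]

theorem hasDerivAt_zeroMeanPrimitive [CompleteSpace E] (hV : Continuous V) (x : ℝ) :
    HasDerivAt (zeroMeanPrimitive V) (V x) x :=
  (intervalIntegral.integral_hasDerivAt_right (hV.intervalIntegrable _ _)
    (hV.stronglyMeasurableAtFilter _ _) hV.continuousAt).const_add _

theorem contDiff_zeroMeanPrimitive [CompleteSpace E] (hV : ContDiff ℝ ∞ V) :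
    ContDiff ℝ ∞ (zeroMeanPrimitive V) := by
  have hd : ∀ x, HasDerivAt (zeroMeanPrimitive V) (V x) x :=
    hasDerivAt_zeroMeanPrimitive hV.continuous
  rw [contDiff_infty_iff_deriv]
  refine ⟨fun x => (hd x).differentiableAt, ?_⟩
  rwa [funext fun x => (hd x).deriv]

/-- A smooth periodic function with zero mean is a `k`-th derivative of such a function. -/
theorem exists_iteratedDeriv_eq_of_integral_eq_zero (k : ℕ) {φ : ℝ → ℝ} (hφ : ContDiff ℝ ∞ φ)
    (hp : Function.Periodic φ (2 * Real.pi)) (h0 : ∫ t in (-Real.pi)..Real.pi, φ t = 0) :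
    ∃ Φ : ℝ → ℝ, ContDiff ℝ ∞ Φ ∧ Function.Periodic Φ (2 * Real.pi) ∧
      iteratedDeriv k Φ = φ := by
  induction k generalizing φ with
  | zero => exact ⟨φ, hφ, hp, by simp⟩
  | succ k ih =>
    have hi : ∀ a b, IntervalIntegrable φ volume a b := fun a b =>
      hφ.continuous.intervalIntegrable a b
    obtain ⟨Φ, h1, h2, h3⟩ := ih (contDiff_zeroMeanPrimitive hφ)
      (periodic_zeroMeanPrimitive hi hp h0) (integral_zeroMeanPrimitive hi)
    refine ⟨Φ, h1, h2, ?_⟩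
    rw [iteratedDeriv_succ, h3]
    exact funext fun x => (hasDerivAt_zeroMeanPrimitive hφ.continuous x).deriv

theorem periodic_deriv {φ : ℝ → E} {c : ℝ} (hp : Function.Periodic φ c) :
    Function.Periodic (deriv φ) c := by
  intro x
  rw [← deriv_comp_add_const]
  congr 1
  exact funext hp

theorem periodic_iteratedDeriv {φ : ℝ → E} {c : ℝ} (hp : Function.Periodic φ c) (k : ℕ) :
    Function.Periodic (iteratedDeriv k φ) c := by
  induction k with
  | zero => simpa using hp
  | succ k ih => rw [iteratedDeriv_succ]; exact periodic_deriv ih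

theorem contDiff_iteratedDeriv {φ : ℝ → E} (hφ : ContDiff ℝ ∞ φ) (k : ℕ) :
    ContDiff ℝ ∞ (iteratedDeriv k φ) := by
  induction k with
  | zero => simpa using hφ
  | succ k ih => rw [iteratedDeriv_succ]; exact (contDiff_infty_iff_deriv.1 ih).2

/-- Normalizing each primitive to have zero mean keeps it periodic with zero mean, so the operation
can be iterated; the result is a function whose `j`-th weak derivative is `V`. -/
theorem zeroMeanPrimitive_iterate {V : ℝ → ℂ} (hV : ∀ a b, IntervalIntegrable V volume a b)
    (hp : Function.Periodic V (2 * Real.pi)) (h0 : ∫ t in (-Real.pi)..Real.pi, V t = 0) (j : ℕ) :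
    (∀ a b, IntervalIntegrable (zeroMeanPrimitive^[j] V) volume a b) ∧
      Function.Periodic (zeroMeanPrimitive^[j] V) (2 * Real.pi) ∧
      ∫ t in (-Real.pi)..Real.pi, (zeroMeanPrimitive^[j] V) t = 0 ∧
      ∀ φ : ℝ → ℝ, ContDiff ℝ ∞ φ → Function.Periodic φ (2 * Real.pi) →
        ∫ t in (-Real.pi)..Real.pi, iteratedDeriv j φ t • (zeroMeanPrimitive^[j] V) t =
          (-1) ^ j * ∫ t in (-Real.pi)..Real.pi, φ t • V t := by
  induction j with
  | zero => exact ⟨hV, hp, h0, fun φ _ _ => by simp⟩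
  | succ j ih =>
    obtain ⟨h1, h2, h3, h4⟩ := ih
    simp only [Function.iterate_succ_apply']
    refine ⟨fun a b => (continuous_zeroMeanPrimitive h1).intervalIntegrable a b,
      periodic_zeroMeanPrimitive h1 h2 h3, integral_zeroMeanPrimitive h1, fun φ hφ hφp => ?_⟩
    rw [iteratedDeriv_succ]
    have := integral_deriv_smul_primitive_periodic h1 h3
      (-((2 * Real.pi)⁻¹ • ∫ t in (-Real.pi)..Real.pi, ∫ s in (0:ℝ)..t,
        (zeroMeanPrimitive^[j] V) s))
      (contDiff_iteratedDeriv hφ j) (periodic_iteratedDeriv hφp j)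
    unfold zeroMeanPrimitive at this ⊢
    rw [this]
    have h4' := h4 φ hφ hφp
    unfold zeroMeanPrimitive at h4'
    rw [h4', pow_succ]; ring

/-- A function with an integrable weak derivative of order `k + 1` has a representative with `k`
continuous derivatives, the last one of which is a primitive of the weak derivative. -/
theorem HasWeakDeriv.exists_derivative_chain {k : ℕ} {u v : Circle → ℂ}
    (h : HasWeakDeriv (k + 1) u v) :
    ∃ U : ℕ → ℝ → ℂ, (∀ i < k, ∀ x, HasDerivAt (U i) (U (i + 1) x) x) ∧
      (∀ x y, U k y - U k x = ∫ t in x..y, v (Circle.exp t)) ∧ Continuous (U 0) ∧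
      ∀ᵐ t : ℝ, u (Circle.exp t) = U 0 t := by
  set V : ℝ → ℂ := fun t => v (Circle.exp t) with hVdef
  set W : ℝ → ℂ := fun t => u (Circle.exp t) with hWdef
  have hV : ∀ a b, IntervalIntegrable V volume a b := intervalIntegrable_exp_of_integrable h.2.1
  have hW : ∀ a b, IntervalIntegrable W volume a b := intervalIntegrable_exp_of_integrable h.1
  have hVp : Function.Periodic V (2 * Real.pi) := fun t => by simp [hVdef]
  have hWp : Function.Periodic W (2 * Real.pi) := fun t => by simp [hWdef]
  -- Testing with the constant 1: a weak derivative of positive order has zero mean.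
  have h0 : ∫ t in (-Real.pi)..Real.pi, V t = 0 := by
    have := h.2.2 (fun _ => 1) contDiff_const (fun _ => rfl)
    rw [iteratedDeriv_succ'] at this
    simpa [iteratedDeriv_const, hVdef] using this
  have hc : ∀ j, Continuous (zeroMeanPrimitive^[j + 1] V) := fun j => by
    rw [Function.iterate_succ_apply']
    exact continuous_zeroMeanPrimitive (zeroMeanPrimitive_iterate hV hVp h0 j).1
  set P := zeroMeanPrimitive^[k + 1] V with hP
  obtain ⟨hPi, hPp, hP0, hPφ⟩ := zeroMeanPrimitive_iterate hV hVp h0 (k + 1)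
  rw [← hP] at hPi hPp hP0 hPφ
  set c : ℂ := (2 * Real.pi)⁻¹ • ∫ t in (-Real.pi)..Real.pi, W t with hcdef
  have hae : ∀ᵐ t : ℝ, W t - P t - c = 0 := by
    refine ae_eq_zero_of_forall_integral_smooth_periodic ?_
      (((hW _ _).sub (hPi _ _)).sub (by simp)) ?_
    · intro t; simp only [hWp t, hPp t]
    · intro φ hφ hφp
      set μ : ℝ := (2 * Real.pi)⁻¹ * ∫ t in (-Real.pi)..Real.pi, φ t with hμ
      have hφi : ∀ a b, IntervalIntegrable φ volume a b := fun a b =>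
        hφ.continuous.intervalIntegrable a b
      have hpi : (2 * Real.pi) ≠ 0 := Real.two_pi_pos.ne'
      -- Only zero-mean functions are derivatives of periodic ones, so the mean `μ` of `φ` is
      -- removed first. The removed part is accounted for by the constant `c`, the mean of `W`.
      obtain ⟨Φ, hΦ, hΦp, hΦd⟩ := exists_iteratedDeriv_eq_of_integral_eq_zero (k + 1)
        (φ := fun t => φ t - μ) (hφ.sub contDiff_const) (fun t => by simp only [hφp t])
        (by
          rw [intervalIntegral.integral_sub (hφi _ _) (by simp), intervalIntegral.integral_const,
            hμ, smul_eq_mul]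
          field_simp
          ring)
      have e1 := h.2.2 Φ hΦ hΦp
      have e2 := hPφ Φ hΦ hΦp
      rw [← e2, hΦd] at e1
      simp only [sub_smul] at e1
      have iW := fun ψ : ℝ → ℝ => fun hψ : Continuous ψ =>
        (hW (-Real.pi) Real.pi).continuousOn_smul hψ.continuousOn
      have iP := fun ψ : ℝ → ℝ => fun hψ : Continuous ψ =>
        (hPi (-Real.pi) Real.pi).continuousOn_smul hψ.continuousOn
      rw [intervalIntegral.integral_sub (iW φ hφ.continuous) (iW _ continuous_const),
        intervalIntegral.integral_sub (iP φ hφ.continuous) (iP _ continuous_const),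
        intervalIntegral.integral_smul, intervalIntegral.integral_smul, hP0] at e1
      simp only [smul_sub]
      rw [intervalIntegral.integral_sub ((iW φ hφ.continuous).sub (iP φ hφ.continuous))
        ((show Continuous fun t => φ t • c from hφ.continuous.smul continuous_const).intervalIntegrable _ _), intervalIntegral.integral_sub (iW φ hφ.continuous)
        (iP φ hφ.continuous), intervalIntegral.integral_smul_const]
      have e3 : (∫ t in (-Real.pi)..Real.pi, φ t) • c =
          μ • ∫ t in (-Real.pi)..Real.pi, W t := by
        rw [hcdef, hμ, smul_smul, mul_comm]
      rw [e3]
      simp only [smul_zero, sub_zero] at e1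
      rw [← e1]
      ring
  -- The constant `c` is visible only in the function itself; the derivatives are the lower iterates
  -- of the primitive.
  refine ⟨fun i => if i = 0 then fun t => P t + c else zeroMeanPrimitive^[k + 1 - i] V,
    ?_, ?_, ?_, ?_⟩
  · intro i hi x
    have key : HasDerivAt (zeroMeanPrimitive^[k + 1 - i] V)
        ((zeroMeanPrimitive^[k + 1 - (i + 1)] V) x) x := by
      obtain ⟨j, hj⟩ : ∃ j, k - i = j + 1 := ⟨k - i - 1, by omega⟩
      rw [show k + 1 - i = (j + 1) + 1 by omega, show k + 1 - (i + 1) = j + 1 by omega,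
        Function.iterate_succ_apply']
      exact hasDerivAt_zeroMeanPrimitive (hc j) x
    by_cases h : i = 0
    · subst h; simpa [hP] using key
    · simpa [h] using key
  · intro x y
    have key := zeroMeanPrimitive_sub hV x y
    by_cases h : k = 0
    · subst h; simpa [hP] using key
    · simpa [h] using key
  · exact (hc k).add continuous_const
  · filter_upwards [hae] with t ht
    simp only [if_true]
    linear_combination ht

end PeriodicPrimitive

/-! ### The VMO degree of a map with a continuous representative. -/

section Degree

/-- Rouché's principle for closed curves. -/
theorem HasWinding.of_norm_sub_lt {F G : ℝ → ℂ} {d : ℤ} (hF : HasWinding F d)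
    (hFc : Continuous F) (hFp : Function.Periodic F (2 * Real.pi))
    (hGc : Continuous G) (hGp : Function.Periodic G (2 * Real.pi))
    (h : ∀ θ, ‖G θ - F θ‖ < ‖F θ‖) : HasWinding G d := by
  obtain ⟨hF0, φ, hφ, hφF, hφd⟩ := hF
  -- The quotient `G/F` stays in the disc of radius 1 about 1, where `arg` is continuous; its
  -- argument is periodic and corrects the phase of `F` without changing the winding.
  have hre : ∀ θ, 0 < (G θ / F θ).re := by
    intro θ
    have h1 : ‖G θ / F θ - 1‖ < 1 := by
      rw [div_sub_one (hF0 θ), norm_div, div_lt_one (norm_pos_iff.2 (hF0 θ))]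
      exact h θ
    have h2 := (Complex.abs_re_le_norm (G θ / F θ - 1)).trans_lt h1
    rw [Complex.sub_re, Complex.one_re, abs_lt] at h2
    linarith [h2.1]
  have hG0 : ∀ θ, G θ ≠ 0 := fun θ h0 => by simpa [h0] using hre θ
  refine ⟨hG0, fun θ => φ θ + Complex.arg (G θ / F θ), ?_, ?_, ?_⟩
  · refine hφ.add (continuous_iff_continuousAt.2 fun θ => ?_)
    exact (Complex.continuousAt_arg (Or.inl (hre θ))).comp
      (f := fun θ => G θ / F θ) (hGc.div hFc hF0).continuousAt
  · intro θ
    have h1 := Complex.norm_mul_exp_arg_mul_I (G θ / F θ)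
    have h2 := hφF θ
    have h3 : (‖F θ‖ : ℂ) ≠ 0 := by simpa using hF0 θ
    rw [Circle.exp_add, Circle.coe_mul, Circle.coe_exp (Complex.arg _)]
    calc G θ = F θ * (G θ / F θ) := by field_simp [hF0 θ]
      _ = ((‖F θ‖ : ℂ) * Circle.exp (φ θ)) * ((‖G θ / F θ‖ : ℂ) *
          Complex.exp (Complex.arg (G θ / F θ) * Complex.I)) := by rw [h1, ← h2]
      _ = _ := by
        rw [norm_div, Complex.ofReal_div]; field_simp
  · intro θ
    simp only [hφd, hGp θ, hFp θ]; ring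

theorem continuous_arcMean {f : Circle → Circle}
    (hf : ∀ a b, IntervalIntegrable (fun t => (f (Circle.exp t) : ℂ)) volume a b) (ε : ℝ) :
    Continuous (arcMean f ε) := by
  have hc := intervalIntegral.continuous_primitive hf 0
  have : arcMean f ε = fun θ => (2 * ε)⁻¹ • ((∫ t in (0:ℝ)..(θ + ε), (f (Circle.exp t) : ℂ)) -
      ∫ t in (0:ℝ)..(θ - ε), (f (Circle.exp t) : ℂ)) := by
    funext θ
    rw [arcMean, intervalIntegral.integral_interval_sub_left (hf _ _) (hf _ _)]
  rw [this]
  exact ((hc.comp (continuous_id.add continuous_const)).sub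
    (hc.comp (continuous_id.sub continuous_const))).const_smul (2 * ε)⁻¹

theorem periodic_arcMean (f : Circle → Circle) (ε : ℝ) :
    Function.Periodic (arcMean f ε) (2 * Real.pi) := by
  intro θ
  have h := intervalIntegral.integral_comp_add_right (a := θ - ε) (b := θ + ε)
    (fun t => (f (Circle.exp t) : ℂ)) (2 * Real.pi)
  simp only [Circle.exp_add_two_pi] at h
  rw [arcMean, arcMean, h, show θ + 2 * Real.pi - ε = θ - ε + 2 * Real.pi by ring,
    show θ + 2 * Real.pi + ε = θ + ε + 2 * Real.pi by ring]

/-- Uniform continuity of `F` on the compact circle. With Rouché's principle it identifies the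
degree defined by small means with the winding of the continuous representative. -/
theorem eventually_norm_arcMean_sub_lt {f : Circle → Circle} {F : ℝ → ℂ} (hF : Continuous F)
    (hFp : Function.Periodic F (2 * Real.pi)) (hfF : ∀ᵐ t : ℝ, (f (Circle.exp t) : ℂ) = F t)
    {η : ℝ} (hη : 0 < η) :
    ∀ᶠ ε in 𝓝[>] (0 : ℝ), ∀ θ, ‖arcMean f ε θ - F θ‖ < η := by
  have huc : UniformContinuous F := by
    have h1 : Continuous (hFp.lift : AddCircle (2 * Real.pi) → ℂ) := hF.quotient_lift _
    have h2 : UniformContinuous (hFp.lift : AddCircle (2 * Real.pi) → ℂ) :=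
      CompactSpace.uniformContinuous_of_continuous h1
    exact h2.comp (uniformContinuous_of_continuousAt_zero
      (QuotientAddGroup.mk' (AddSubgroup.zmultiples (2 * Real.pi)))
      (AddCircle.continuous_mk' _).continuousAt)
  obtain ⟨δ, hδ, hδF⟩ := Metric.uniformContinuous_iff.1 huc (η / 2) (by positivity)
  filter_upwards [Ioo_mem_nhdsGT hδ] with ε hε θ
  have h1 : arcMean f ε θ - F θ = (2 * ε)⁻¹ • ∫ t in (θ - ε)..(θ + ε), (F t - F θ) := by
    rw [intervalIntegral.integral_sub (hF.intervalIntegrable _ _) (by simp),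
      intervalIntegral.integral_const, smul_sub, smul_smul, arcMean]
    have : (2 * ε)⁻¹ * (θ + ε - (θ - ε)) = 1 := by
      have := hε.1.ne'
      field_simp; ring
    rw [this, one_smul]
    congr 2
    exact intervalIntegral.integral_congr_ae (hfF.mono fun t ht _ => ht)
  have h2 : ‖∫ t in (θ - ε)..(θ + ε), (F t - F θ)‖ ≤ η / 2 * |θ + ε - (θ - ε)| := by
    refine intervalIntegral.norm_integral_le_of_norm_le_const fun t ht => ?_
    rw [Set.uIoc_of_le (by linarith [hε.1])] at ht
    rw [← dist_eq_norm]
    refine (hδF ?_).le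
    rw [Real.dist_eq, abs_lt]
    constructor <;> linarith [ht.1, ht.2, hε.2]
  have h3 : |θ + ε - (θ - ε)| = 2 * ε := by
    rw [show θ + ε - (θ - ε) = 2 * ε by ring, abs_of_pos (by linarith [hε.1])]
  rw [h3] at h2
  rw [h1, norm_smul, norm_inv, Real.norm_of_nonneg (by linarith [hε.1] : (0:ℝ) ≤ 2 * ε),
    inv_mul_lt_iff₀ (by linarith [hε.1])]
  nlinarith [hε.1]

/-- The continuous representative of a map of degree `d` has a lifting that increases by `2πd`. -/
theorem HasDegree.exists_lift {f : Circle → Circle} {d : ℤ} (hd : HasDegree f d) {F : ℝ → ℂ}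
    (hF : Continuous F) (hfF : ∀ᵐ t : ℝ, (f (Circle.exp t) : ℂ) = F t) :
    ∃ φ : ℝ → ℝ, Continuous φ ∧ (∀ θ, F θ = Circle.exp (φ θ)) ∧
      ∀ θ, φ (θ + 2 * Real.pi) = φ θ + 2 * Real.pi * d := by
  have hF1 : ∀ t, ‖F t‖ = 1 := by
    have : (fun t => ‖F t‖) = fun _ => 1 :=
      Measure.eq_of_ae_eq (μ := volume) (hfF.mono fun t ht => by
        simp only [← ht, Circle.norm_coe]) hF.norm continuous_const
    exact fun t => congrFun this t
  have hFp : Function.Periodic F (2 * Real.pi) := by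
    have : (fun t => F (t + 2 * Real.pi)) = F := by
      refine Measure.eq_of_ae_eq (μ := volume) ?_ (hF.comp (by fun_prop)) hF
      filter_upwards [hfF, (measurePreserving_add_right volume
        (2 * Real.pi)).quasiMeasurePreserving.ae hfF] with t h1 h2
      rw [← h1, ← h2, Circle.exp_add_two_pi]
    exact fun t => congrFun this t
  have hi : ∀ a b, IntervalIntegrable (fun t => (f (Circle.exp t) : ℂ)) volume a b := fun a b =>
    (hF.intervalIntegrable a b).congr_ae (ae_restrict_of_ae (hfF.mono fun t ht => ht.symm))
  -- Since `|F| = 1`, a mean within 1/2 of `F` has modulus above 1/2, which is what Rouché's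
  -- principle needs.
  obtain ⟨ε, h1, h2⟩ := (hd.and (eventually_norm_arcMean_sub_lt hF hFp hfF
    (η := 1 / 2) (by norm_num))).exists
  obtain ⟨-, φ, hφ, hφF, hφd⟩ := h1.of_norm_sub_lt (continuous_arcMean hi ε)
    (periodic_arcMean f ε) hF hFp fun θ => by
      have h3 := h2 θ
      have h4 := norm_sub_norm_le (F θ) (arcMean f ε θ)
      rw [norm_sub_rev] at h3
      rw [hF1] at h4
      linarith
  refine ⟨φ, hφ, fun θ => ?_, hφd⟩
  have := hφF θ
  rwa [hF1, Complex.ofReal_one, one_mul] at this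

theorem hasDegree_of_lift {f : Circle → Circle} {d : ℤ} {φ : ℝ → ℝ} (hφ : Continuous φ)
    (hf : ∀ θ, f (Circle.exp θ) = Circle.exp (φ θ))
    (hφd : ∀ θ, φ (θ + 2 * Real.pi) = φ θ + 2 * Real.pi * d) : HasDegree f d := by
  have hF : Continuous fun θ => (Circle.exp (φ θ) : ℂ) := by fun_prop
  have hFp : Function.Periodic (fun θ => (Circle.exp (φ θ) : ℂ)) (2 * Real.pi) := fun θ => by
    simp only [← hf, Circle.exp_add_two_pi]
  have hw : HasWinding (fun θ => (Circle.exp (φ θ) : ℂ)) d :=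
    ⟨fun θ => Circle.coe_ne_zero _, φ, hφ, fun θ => by simp, hφd⟩
  filter_upwards [eventually_norm_arcMean_sub_lt hF hFp
    (ae_of_all _ fun t => by rw [hf]) (f := f) one_pos] with ε hε
  refine hw.of_norm_sub_lt hF hFp (continuous_arcMean (fun a b => ?_) ε) (periodic_arcMean f ε)
    fun θ => by simpa using hε θ
  simp_rw [hf]
  exact hF.intervalIntegrable a b

end Degree

/-! ### Energy on an interval, Poincaré-type bounds, and repeated Rolle. -/

theorem lintegral_le_rpow_mul_measure_univ {α : Type*} [MeasurableSpace α] {μ : Measure α}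
    {g : α → ℝ≥0∞} (hg : AEMeasurable g μ) {p : ℝ} (hp : 1 ≤ p) :
    ∫⁻ x, g x ∂μ ≤ (∫⁻ x, g x ^ p ∂μ) ^ (1 / p) * μ Set.univ ^ (1 - 1 / p) := by
  have h := eLpNorm'_le_eLpNorm'_mul_rpow_measure_univ (μ := μ) (f := g) one_pos hp
    hg.aestronglyMeasurable
  simpa [eLpNorm'] using h

/-- The Gagliardo energy of a function of a real variable on an interval. -/
noncomputable def localEnergy (σ p : ℝ) (V : ℝ → ℂ) (a b : ℝ) : ℝ≥0∞ :=
  ∫⁻ x in Set.Ioc a b, ∫⁻ y in Set.Ioc a b, ‖V x - V y‖ₑ ^ p / ‖x - y‖ₑ ^ (1 + σ * p)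

theorem localEnergy_mono {σ p : ℝ} {V : ℝ → ℂ} {a b a' b' : ℝ} (ha : a ≤ a') (hb : b' ≤ b) :
    localEnergy σ p V a' b' ≤ localEnergy σ p V a b := by
  have h : Set.Ioc a' b' ⊆ Set.Ioc a b := Set.Ioc_subset_Ioc ha hb
  exact (lintegral_mono fun x => lintegral_mono_set h).trans (lintegral_mono_set h)

/-- Exponent count for two uses of Hölder on an interval of length `ℓ`: `(1 + σp)/p + 2(1 - 1/p) = 2
+ σ - 1/p`. -/
theorem ofReal_rpow_mul_rpow_one_div {ℓ σ p : ℝ} (hℓ : 0 < ℓ) (hp : 1 ≤ p) (E : ℝ≥0∞) :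
    (ENNReal.ofReal ℓ ^ (1 + σ * p) * E) ^ (1 / p) * ENNReal.ofReal ℓ ^ (1 - 1 / p) *
      ENNReal.ofReal ℓ ^ (1 - 1 / p) = ENNReal.ofReal (ℓ ^ (2 + σ - 1 / p)) * E ^ (1 / p) := by
  have hp0 : 0 < p := by linarith
  have h0 : ENNReal.ofReal ℓ ≠ 0 := by simpa using hℓ
  rw [ENNReal.mul_rpow_of_nonneg _ _ (by positivity), ← ENNReal.rpow_mul,
    ← ENNReal.ofReal_rpow_of_pos hℓ, mul_assoc, ← ENNReal.rpow_add _ _ h0 ENNReal.ofReal_ne_top,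
    mul_right_comm, ← ENNReal.rpow_add _ _ h0 ENNReal.ofReal_ne_top]
  congr 2
  field_simp
  ring

/-- On the square, `|x - y| ≤ b - a` bounds the singular kernel from below, so the energy dominates
the `p`-th powers of the differences; Hölder in each variable then passes to the first power. -/
theorem lintegral_enorm_sub_le_localEnergy {σ p : ℝ} (hσ : 0 ≤ σ) (hp : 1 ≤ p) {V : ℝ → ℂ}
    (hV : Measurable V) {a b : ℝ} (hab : a < b) :
    ∫⁻ x in Set.Ioc a b, ∫⁻ y in Set.Ioc a b, ‖V x - V y‖ₑ ≤
      ENNReal.ofReal ((b - a) ^ (2 + σ - 1 / p)) * localEnergy σ p V a b ^ (1 / p) := by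
  have hp0 : 0 < p := by linarith
  have hℓ : 0 < b - a := sub_pos.2 hab
  have hm : Measurable fun q : ℝ × ℝ => ‖V q.1 - V q.2‖ₑ ^ p := by fun_prop
  have huniv : (volume.restrict (Set.Ioc a b)) Set.univ = ENNReal.ofReal (b - a) := by simp
  have hpt : ∀ x ∈ Set.Ioc a b, ∀ y ∈ Set.Ioc a b, ‖V x - V y‖ₑ ^ p ≤
      ENNReal.ofReal (b - a) ^ (1 + σ * p) * (‖V x - V y‖ₑ ^ p / ‖x - y‖ₑ ^ (1 + σ * p)) := by
    intro x hx y hy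
    rcases eq_or_ne x y with rfl | hxy
    · simp [hp0]
    · have hle : ‖x - y‖ₑ ≤ ENNReal.ofReal (b - a) := by
        rw [← ofReal_norm, Real.norm_eq_abs]
        refine ENNReal.ofReal_le_ofReal (abs_le.2 ⟨?_, ?_⟩) <;> linarith [hx.1, hx.2, hy.1, hy.2]
      have h0 : ‖x - y‖ₑ ≠ 0 := by simpa [sub_eq_zero] using hxy
      have h1 : ‖x - y‖ₑ ^ (1 + σ * p) ≠ 0 := by
        simp [ENNReal.rpow_eq_zero_iff, h0]
      have h2 : ‖x - y‖ₑ ^ (1 + σ * p) ≠ ⊤ :=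
        ENNReal.rpow_ne_top_of_nonneg (by positivity) (by simp)
      calc ‖V x - V y‖ₑ ^ p = ‖x - y‖ₑ ^ (1 + σ * p) *
            (‖V x - V y‖ₑ ^ p / ‖x - y‖ₑ ^ (1 + σ * p)) := (ENNReal.mul_div_cancel h1 h2).symm
        _ ≤ _ := by gcongr
  have hrest : ∫⁻ x in Set.Ioc a b, ∫⁻ y in Set.Ioc a b, ‖V x - V y‖ₑ ^ p ≤
      ENNReal.ofReal (b - a) ^ (1 + σ * p) * localEnergy σ p V a b := by
    have htop : ENNReal.ofReal (b - a) ^ (1 + σ * p) ≠ ⊤ :=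
      ENNReal.rpow_ne_top_of_nonneg (by positivity) (by simp)
    rw [localEnergy, ← lintegral_const_mul' _ _ htop]
    refine setLIntegral_mono' measurableSet_Ioc fun x hx => ?_
    rw [← lintegral_const_mul' _ _ htop]
    exact setLIntegral_mono' measurableSet_Ioc fun y hy => hpt x hx y hy
  calc ∫⁻ x in Set.Ioc a b, ∫⁻ y in Set.Ioc a b, ‖V x - V y‖ₑ
      ≤ ∫⁻ x in Set.Ioc a b, (∫⁻ y in Set.Ioc a b, ‖V x - V y‖ₑ ^ p) ^ (1 / p) *
          ENNReal.ofReal (b - a) ^ (1 - 1 / p) := by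
        refine lintegral_mono fun x => ?_
        rw [← huniv]
        exact lintegral_le_rpow_mul_measure_univ (by fun_prop) hp
    _ = (∫⁻ x in Set.Ioc a b, (∫⁻ y in Set.Ioc a b, ‖V x - V y‖ₑ ^ p) ^ (1 / p)) *
          ENNReal.ofReal (b - a) ^ (1 - 1 / p) := by
        rw [lintegral_mul_const' _ _ (ENNReal.rpow_ne_top_of_nonneg
          (by rw [sub_nonneg, div_le_one hp0]; exact hp) (by simp))]
    _ ≤ (∫⁻ x in Set.Ioc a b, ∫⁻ y in Set.Ioc a b, ‖V x - V y‖ₑ ^ p) ^ (1 / p) *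
          ENNReal.ofReal (b - a) ^ (1 - 1 / p) * ENNReal.ofReal (b - a) ^ (1 - 1 / p) := by
        gcongr
        have hmi : Measurable fun x => ∫⁻ y in Set.Ioc a b, ‖V x - V y‖ₑ ^ p :=
          hm.lintegral_prod_right'
        have := lintegral_le_rpow_mul_measure_univ (μ := volume.restrict (Set.Ioc a b))
          (hmi.pow_const (1 / p)).aemeasurable hp
        rw [huniv] at this
        refine this.trans_eq ?_
        congr 3
        funext x
        rw [← ENNReal.rpow_mul, one_div_mul_cancel hp0.ne', ENNReal.rpow_one]
    _ ≤ _ := by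
        rw [← ofReal_rpow_mul_rpow_one_div hℓ hp]
        gcongr

/-- The left side is a double integral of `V x - V y` over `[a₁, b₁] × [a, b]`. With a half-length
subinterval it compares two means, as Morrey's argument requires; when the integral over `[a, b]`
vanishes it is a Poincaré inequality for the primitive. -/
theorem enorm_smul_integral_sub_le {E : Type*} [NormedAddCommGroup E] [NormedSpace ℝ E]
    [CompleteSpace E] {V : ℝ → E}
    (hV : ∀ a b, IntervalIntegrable V volume a b) {a b a₁ b₁ : ℝ} (ha : a ≤ a₁) (h1 : a₁ ≤ b₁)
    (hb : b₁ ≤ b) :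
    ‖(b - a) • (∫ t in a₁..b₁, V t) - (b₁ - a₁) • ∫ t in a..b, V t‖ₑ ≤
      ∫⁻ x in Set.Ioc a b, ∫⁻ y in Set.Ioc a b, ‖V x - V y‖ₑ := by
  have e : (b - a) • (∫ t in a₁..b₁, V t) - (b₁ - a₁) • ∫ t in a..b, V t =
      ∫ x in a₁..b₁, ∫ y in a..b, (V x - V y) := by
    have : ∀ x, ∫ y in a..b, (V x - V y) = (b - a) • V x - ∫ y in a..b, V y := fun x => by
      rw [intervalIntegral.integral_sub (by simp) (hV _ _), intervalIntegral.integral_const]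
    simp_rw [this]
    rw [intervalIntegral.integral_sub (f := fun x => (b - a) • V x) ((hV _ _).smul (b - a))
      intervalIntegrable_const, intervalIntegral.integral_smul,
      intervalIntegral.integral_const]
  rw [e, intervalIntegral.integral_of_le h1]
  refine (enorm_integral_le_lintegral_enorm _).trans ?_
  refine (lintegral_mono_set (Set.Ioc_subset_Ioc ha hb)).trans (lintegral_mono fun x => ?_)
  rw [intervalIntegral.integral_of_le (ha.trans (h1.trans hb))]
  exact enorm_integral_le_lintegral_enorm _

/-- A function with `2k + 2` zeros is controlled between the two middle ones by its `k`-th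
derivative. -/
theorem abs_le_pow_mul_of_zeros {k : ℕ} {R : ℕ → ℝ → ℝ}
    (hR : ∀ i < k, ∀ x, HasDerivAt (R i) (R (i + 1) x) x) {y : ℕ → ℝ} {α β B : ℝ} (hB : 0 ≤ B)
    (hy : ∀ i < 2 * k + 1, y i < y (i + 1)) (hα : α ≤ y 0) (hβ : y (2 * k + 1) ≤ β)
    (h0 : ∀ i ≤ 2 * k + 1, R 0 (y i) = 0)
    (hk : ∀ a b x, α ≤ a → b ≤ β → a < b → R k a = 0 → R k b = 0 → x ∈ Set.Icc a b →
      |R k x| ≤ B) {x : ℝ} (hx : x ∈ Set.Icc (y k) (y (k + 1))) :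
    |R 0 x| ≤ (β - α) ^ k * B := by
  induction k generalizing R y x with
  | zero =>
    have := hk (y 0) (y 1) x hα (by simpa using hβ) (hy 0 (by norm_num)) (h0 0 (by norm_num))
      (h0 1 (by norm_num)) hx
    simpa using this
  | succ k ih =>
    have hmono : ∀ i j, i ≤ j → j ≤ 2 * (k + 1) + 1 → y i ≤ y j := by
      intro i j hij
      induction j, hij using Nat.le_induction with
      | base => intro _; exact le_rfl
      | succ j hij ih2 => intro hj; exact (ih2 (by omega)).trans (hy j (by omega)).le
    have hz : ∀ i, ∃ z, i < 2 * (k + 1) + 1 → z ∈ Set.Ioo (y i) (y (i + 1)) ∧ R 1 z = 0 := by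
      intro i
      by_cases hi : i < 2 * (k + 1) + 1
      · obtain ⟨z, hz1, hz2⟩ := exists_hasDerivAt_eq_zero (hy i hi)
          (fun t _ => (hR 0 (by omega) t).continuousAt.continuousWithinAt)
          ((h0 i (by omega)).trans (h0 (i + 1) (by omega)).symm)
          (fun t _ => hR 0 (by omega) t)
        exact ⟨z, fun _ => ⟨hz1, hz2⟩⟩
      · exact ⟨0, fun h => absurd h hi⟩
    choose z hz using hz
    have hαβ : 0 ≤ β - α := by
      have := hmono 0 (2 * (k + 1) + 1) (by omega) le_rfl
      linarith
    have hlen : y (k + 2) - y (k + 1) ≤ β - α := by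
      have h1 := hmono 0 (k + 1) (by omega) (by omega)
      have h2 := hmono (k + 2) (2 * (k + 1) + 1) (by omega) le_rfl
      linarith
    -- Rolle yields `2k + 3` zeros of `R 1`, one more than the induction hypothesis uses. Dropping
    -- the last one (`s = 0`) or the first one (`s = 1`) gives two adjacent middle intervals, and
    -- their union contains `[y (k + 1), y (k + 2)]`.
    have hIH : ∀ s ≤ 1, ∀ t ∈ Set.Icc (z (k + s)) (z (k + 1 + s)),
        |R 1 t| ≤ (β - α) ^ k * B := by
      intro s hs t ht
      refine ih (R := fun i => R (i + 1)) (y := fun i => z (i + s))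
        (fun i hi x => hR (i + 1) (by omega) x) ?_ ?_ ?_ ?_ hk ht
      · intro i hi
        have h1 := (hz (i + s) (by omega)).1.2
        have h2 := (hz (i + 1 + s) (by omega)).1.1
        rw [show i + 1 + s = i + s + 1 by ring] at h2 ⊢
        exact h1.trans h2
      · exact hα.trans ((hmono 0 (0 + s) (by omega) (by omega)).trans
          (hz (0 + s) (by omega)).1.1.le)
      · exact ((hz (2 * k + 1 + s) (by omega)).1.2.le.trans
          (hmono _ _ (by omega) le_rfl)).trans hβ
      · intro i hi
        exact (hz (i + s) (by omega)).2
    have hmv : ∀ u w : ℝ, (∀ t ∈ Set.uIcc u w, |R 1 t| ≤ (β - α) ^ k * B) → R 0 u = 0 →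
        |w - u| ≤ β - α → |R 0 w| ≤ (β - α) ^ (k + 1) * B := by
      intro u w h1 h2 h3
      have := (convex_uIcc u w).norm_image_sub_le_of_norm_hasDerivWithin_le
        (f := R 0) (f' := R 1) (fun t _ => (hR 0 (by omega) t).hasDerivWithinAt)
        (fun t ht => h1 t ht) Set.left_mem_uIcc Set.right_mem_uIcc
      rw [h2, sub_zero, Real.norm_eq_abs, Real.norm_eq_abs] at this
      refine this.trans ?_
      rw [pow_succ, mul_right_comm]
      gcongr
    have hzk := (hz (k + 1) (by omega)).1
    have hzk0 := (hz k (by omega)).1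
    have hzk2 := (hz (k + 2) (by omega)).1
    -- The mean value theorem starts at the zero of `R 0` that is on the same side of `z (k + 1)` as
    -- `x`, so that the segment stays in one of the two middle intervals.
    rcases le_total x (z (k + 1)) with hxz | hxz
    · refine hmv (y (k + 1)) x (fun t ht => ?_) (h0 _ (by omega)) ?_
      · rw [Set.uIcc_of_le hx.1] at ht
        exact hIH 0 (by norm_num) t ⟨hzk0.2.le.trans ht.1, ht.2.trans hxz⟩
      · rw [abs_of_nonneg (by linarith [hx.1])]
        linarith [hx.2]
    · refine hmv (y (k + 2)) x (fun t ht => ?_) (h0 _ (by omega)) ?_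
      · rw [Set.uIcc_of_ge hx.2] at ht
        exact hIH 1 le_rfl t ⟨hxz.trans ht.1, ht.2.trans hzk2.1.le⟩
      · rw [abs_of_nonpos (by linarith [hx.2])]
        have := hx.1
        linarith [hx.1]

/-! ### Chords against angles, and windows of several turns. -/

section Chord

theorem enorm_circle_exp_sub_le (x y : ℝ) :
    ‖(Circle.exp x : ℂ) - (Circle.exp y : ℂ)‖ₑ ≤ ‖x - y‖ₑ := by
  rw [← ofReal_norm, ← ofReal_norm]
  refine ENNReal.ofReal_le_ofReal ?_
  have h : (Circle.exp x : ℂ) - (Circle.exp y : ℂ) =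
      Circle.exp y * (Complex.exp (Complex.I * ((x - y : ℝ) : ℂ)) - 1) := by
    rw [mul_sub, mul_one, Circle.coe_exp, Circle.coe_exp, ← Complex.exp_add]
    congr 2; push_cast; ring
  rw [h, norm_mul, Circle.norm_coe, one_mul]
  exact Real.norm_exp_I_mul_ofReal_sub_one_le

theorem norm_circle_exp_sub (x y : ℝ) :
    ‖(Circle.exp x : ℂ) - (Circle.exp y : ℂ)‖ = 2 * |Real.sin ((x - y) / 2)| := by
  have h : (Circle.exp x : ℂ) - (Circle.exp y : ℂ) =
      Circle.exp y * (Complex.exp (Complex.I * ((x - y : ℝ) : ℂ)) - 1) := by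
    rw [mul_sub, mul_one, Circle.coe_exp, Circle.coe_exp, ← Complex.exp_add]
    congr 2; push_cast; ring
  rw [h, norm_mul, Circle.norm_coe, one_mul, Complex.norm_exp_I_mul_ofReal_sub_one, norm_mul]
  simp

end Chord

theorem lintegral_window (a : ℝ) (M : ℕ) (G : Circle → ℝ≥0∞) :
    ∫⁻ t in Set.Ioc a (a + M * (2 * Real.pi)), G (Circle.exp t) = M * ∫⁻ z, G z ∂arcLength := by
  induction M with
  | zero => simp
  | succ M ih =>
    have h1 : a ≤ a + M * (2 * Real.pi) := by
      have := Real.pi_pos; linarith [mul_nonneg M.cast_nonneg (by linarith : 0 ≤ 2 * Real.pi)]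
    rw [show a + ((M + 1 : ℕ) : ℝ) * (2 * Real.pi) = a + M * (2 * Real.pi) + 2 * Real.pi by
      push_cast; ring, ← Set.Ioc_union_Ioc_eq_Ioc h1 (by linarith [Real.pi_pos]),
      lintegral_union measurableSet_Ioc (Set.Ioc_disjoint_Ioc_of_le le_rfl), ih,
      ← lintegral_arcLength]
    push_cast; ring

theorem gagliardo_rpow {σ p : ℝ} (hp : 0 < p) (v : Circle → ℂ) :
    gagliardo σ p v ^ p =
      ∫⁻ x, ∫⁻ y, ‖v x - v y‖ₑ ^ p / ‖(x : ℂ) - (y : ℂ)‖ₑ ^ (1 + σ * p) ∂arcLength ∂arcLength := by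
  rw [gagliardo, ← ENNReal.rpow_mul, one_div_mul_cancel hp.ne', ENNReal.rpow_one]

/-- A chord is no longer than the difference of the angles, so the kernel on the line is smaller
than that on the circle. Each of the two variables covers the circle `M` times, hence the factor
`M²`. -/
theorem lintegral_window_energy_le {σ p : ℝ} (hσ : 0 ≤ σ) (hp : 0 < p) (v : Circle → ℂ) (a : ℝ)
    (M : ℕ) :
    localEnergy σ p (fun t => v (Circle.exp t)) a (a + M * (2 * Real.pi)) ≤
      M * (M * gagliardo σ p v ^ p) := by
  rw [gagliardo_rpow hp, ← lintegral_const_mul' _ _ (ENNReal.natCast_ne_top M)]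
  rw [← lintegral_window a M]
  refine lintegral_mono fun x => ?_
  rw [← lintegral_window a M (fun y => ‖v (Circle.exp x) - v y‖ₑ ^ p /
    ‖(Circle.exp x : ℂ) - (y : ℂ)‖ₑ ^ (1 + σ * p))]
  refine lintegral_mono fun y => ?_
  gcongr
  exact enorm_circle_exp_sub_le x y

/-! ### Morrey's inequality through means over nested intervals. -/

section Morrey

variable {E : Type*} [NormedAddCommGroup E] [NormedSpace ℝ E]

/-- The means of a function over intervals shrinking to a Lebesgue point converge. -/
theorem tendsto_interval_mean [CompleteSpace E] {V : ℝ → E}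
    (hV : ∀ a b, IntervalIntegrable V volume a b) {x : ℝ} {L : E}
    (hx : HasDerivAt (fun s => ∫ t in (0:ℝ)..s, V t) L x) {h : ℕ → ℝ} (h0 : ∀ n, h n ≠ 0)
    (hh : Tendsto h atTop (𝓝 0)) :
    Tendsto (fun n => (h n)⁻¹ • ∫ t in x..(x + h n), V t) atTop (𝓝 L) := by
  have := hasDerivAt_iff_tendsto_slope_zero.1 hx
  have h2 : Tendsto h atTop (𝓝[≠] 0) :=
    tendsto_nhdsWithin_iff.2 ⟨hh, Eventually.of_forall h0⟩
  refine (this.comp h2).congr fun n => ?_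
  simp only [Function.comp]
  rw [intervalIntegral.integral_interval_sub_left (hV _ _) (hV _ _)]

/-- Halving an interval moves the mean by at most `2/(b - a)²` times the double integral of the
differences. The resulting power of the length is `σ - 1/p`; when it is positive, the moves along
repeated halvings are summable. -/
theorem dist_interval_mean_le {σ p : ℝ} (hσ : 0 ≤ σ) (hp : 1 ≤ p) {V : ℝ → ℂ} (hVm : Measurable V)
    (hV : ∀ a b, IntervalIntegrable V volume a b) {B : ℝ} (hB : 0 ≤ B) {a b a₁ b₁ : ℝ}
    (hab : a < b) (ha : a ≤ a₁) (hb : b₁ ≤ b) (hhalf : b₁ - a₁ = (b - a) / 2)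
    (hE : localEnergy σ p V a b ^ (1 / p) ≤ ENNReal.ofReal B) :
    ‖(b₁ - a₁)⁻¹ • (∫ t in a₁..b₁, V t) - (b - a)⁻¹ • ∫ t in a..b, V t‖ ≤
      2 * (b - a) ^ (σ - 1 / p) * B := by
  have hℓ : 0 < b - a := sub_pos.2 hab
  have h1 := (enorm_smul_integral_sub_le hV ha (by linarith) hb).trans
    (lintegral_enorm_sub_le_localEnergy hσ hp hVm hab)
  have h2 : ‖(b - a) • (∫ t in a₁..b₁, V t) - (b₁ - a₁) • ∫ t in a..b, V t‖ ≤
      (b - a) ^ (2 + σ - 1 / p) * B := by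
    have h3 := h1.trans (mul_le_mul_right hE _)
    rw [← ENNReal.ofReal_mul (by positivity), ← ofReal_norm,
      ENNReal.ofReal_le_ofReal_iff (by positivity)] at h3
    exact h3
  have h4 : (b₁ - a₁)⁻¹ • (∫ t in a₁..b₁, V t) - (b - a)⁻¹ • ∫ t in a..b, V t =
      (2 / (b - a) ^ 2) • ((b - a) • (∫ t in a₁..b₁, V t) - (b₁ - a₁) • ∫ t in a..b, V t) := by
    rw [smul_sub, smul_smul, smul_smul, hhalf]
    congr 2 <;> field_simp
  rw [h4, norm_smul, Real.norm_of_nonneg (by positivity)]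
  refine (mul_le_mul_of_nonneg_left h2 (by positivity)).trans_eq ?_
  rw [show 2 + σ - 1 / p = (σ - 1 / p) + 2 by ring, Real.rpow_add hℓ, Real.rpow_two]
  field_simp

/-- The constant of the one-dimensional Morrey inequality. -/
noncomputable def morreyConst (α : ℝ) : ℝ := 2 / (1 - 2 ^ (-α))

theorem morreyConst_pos {α : ℝ} (hα : 0 < α) : 0 < morreyConst α := by
  have : (2:ℝ) ^ (-α) < 1 := Real.rpow_lt_one_of_one_lt_of_neg (by norm_num) (by linarith)
  exact div_pos two_pos (by linarith)

/-- The means over dyadically shrinking nested intervals converge geometrically. -/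
theorem cauchySeq_nested_mean {σ p : ℝ} (hσ : 0 ≤ σ) (hp : 1 ≤ p) (hσp : 0 < σ - 1 / p) {V : ℝ → ℂ}
    (hVm : Measurable V) (hV : ∀ a b, IntervalIntegrable V volume a b) {B ℓ : ℝ} (hB : 0 ≤ B)
    (hℓ : 0 < ℓ) {a b : ℕ → ℝ} (hlen : ∀ n, b n - a n = ℓ / 2 ^ n)
    (ha : ∀ n, a n ≤ a (n + 1)) (hb : ∀ n, b (n + 1) ≤ b n)
    (hE : localEnergy σ p V (a 0) (b 0) ^ (1 / p) ≤ ENNReal.ofReal B) :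
    CauchySeq (fun n => (b n - a n)⁻¹ • ∫ t in (a n)..(b n), V t) ∧
      ∀ L, Tendsto (fun n => (b n - a n)⁻¹ • ∫ t in (a n)..(b n), V t) atTop (𝓝 L) →
        ∀ n, dist ((b n - a n)⁻¹ • ∫ t in (a n)..(b n), V t) L ≤
          morreyConst (σ - 1 / p) * ℓ ^ (σ - 1 / p) * B * ((2:ℝ) ^ (-(σ - 1 / p))) ^ n := by
  set α := σ - 1 / p with hα
  have hr : (2:ℝ) ^ (-α) < 1 := Real.rpow_lt_one_of_one_lt_of_neg (by norm_num) (by linarith)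
  have hstep : ∀ n, dist ((b n - a n)⁻¹ • ∫ t in (a n)..(b n), V t)
      ((b (n + 1) - a (n + 1))⁻¹ • ∫ t in (a (n + 1))..(b (n + 1)), V t) ≤
      2 * ℓ ^ α * B * ((2:ℝ) ^ (-α)) ^ n := by
    intro n
    have hp0 : 0 < p := by linarith
    have hmono : localEnergy σ p V (a n) (b n) ^ (1 / p) ≤ ENNReal.ofReal B := by
      refine le_trans ?_ hE
      gcongr
      exact localEnergy_mono (monotone_nat_of_le_succ ha (Nat.zero_le n))
        (antitone_nat_of_succ_le hb (Nat.zero_le n))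
    have hpos : 0 < b n - a n := by rw [hlen]; positivity
    have := dist_interval_mean_le hσ hp hVm hV hB (sub_pos.1 hpos) (ha n) (hb n) (by
      rw [hlen, hlen, pow_succ]; field_simp) hmono
    rw [dist_comm, dist_eq_norm]
    refine this.trans_eq ?_
    rw [hlen, Real.div_rpow hℓ.le (by positivity), ← Real.rpow_natCast, ← Real.rpow_mul two_pos.le,
      ← Real.rpow_natCast, ← Real.rpow_mul two_pos.le, div_eq_mul_inv, ← Real.rpow_neg two_pos.le]
    rw [show -((n:ℝ) * α) = -α * n by ring]
    ring
  refine ⟨cauchySeq_of_le_geometric _ _ hr hstep, fun L hL n => ?_⟩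
  refine (dist_le_of_le_geometric_of_tendsto _ _ hr hstep hL n).trans_eq ?_
  rw [morreyConst]; ring

/-- Morrey's inequality on an interval. -/
theorem norm_sub_le_of_localEnergy_le {σ p : ℝ} (hσ : 0 ≤ σ) (hp : 1 ≤ p) (hσp : 0 < σ - 1 / p)
    {F : ℝ → ℂ} (hF : Continuous F) {B x y : ℝ} (hB : 0 ≤ B) (hxy : x < y)
    (hE : localEnergy σ p F x y ^ (1 / p) ≤ ENNReal.ofReal B) :
    ‖F x - F y‖ ≤ 2 * morreyConst (σ - 1 / p) * (y - x) ^ (σ - 1 / p) * B := by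
  have hi : ∀ a b, IntervalIntegrable F volume a b := fun a b => hF.intervalIntegrable a b
  have hd : ∀ z, HasDerivAt (fun s => ∫ t in (0:ℝ)..s, F t) (F z) z := fun z =>
    intervalIntegral.integral_hasDerivAt_right (hi _ _) (hF.stronglyMeasurableAtFilter _ _)
      hF.continuousAt
  have hℓ : 0 < y - x := sub_pos.2 hxy
  have hlim : Tendsto (fun n : ℕ => (y - x) / 2 ^ n) atTop (𝓝 0) := by
    have := (tendsto_pow_atTop_nhds_zero_of_lt_one (r := (1 / 2 : ℝ)) (by norm_num)
      (by norm_num)).const_mul (y - x)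
    simpa [div_eq_mul_inv] using this
  have hdecr : ∀ n : ℕ, (y - x) / 2 ^ (n + 1) ≤ (y - x) / 2 ^ n := fun n => by
    gcongr <;> norm_num
  -- Halve `[x, y]` towards `x` here and towards `y` in `h2`. Both sequences start with the mean
  -- over `[x, y]`, which serves as the intermediate point of the triangle inequality.
  have h1 := (cauchySeq_nested_mean hσ hp hσp hF.measurable hi hB hℓ (a := fun _ => x)
    (b := fun n => x + (y - x) / 2 ^ n) (fun n => by ring) (fun n => le_rfl)
    (fun n => by linarith [hdecr n]) (by simpa using hE)).2 (F x) (by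
      simpa using tendsto_interval_mean hi (hd x) (fun n => by positivity) hlim) 0
  have h2 := (cauchySeq_nested_mean hσ hp hσp hF.measurable hi hB hℓ
    (a := fun n => y - (y - x) / 2 ^ n) (b := fun _ => y) (fun n => by ring)
    (fun n => by linarith [hdecr n]) (fun n => le_rfl) (by simpa using hE)).2 (F y) (by
      have := tendsto_interval_mean hi (hd y) (h := fun n => -((y - x) / 2 ^ n))
        (fun n => neg_ne_zero.2 (by positivity)) (by simpa using hlim.neg)
      refine this.congr fun n => ?_
      rw [intervalIntegral.integral_symm, inv_neg, neg_smul_neg]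
      congr 2
      ring) 0
  simp only [pow_zero, div_one, mul_one, add_sub_cancel, sub_sub_cancel] at h1 h2
  rw [← dist_eq_norm]
  refine (dist_triangle_left _ _ _).trans ((add_le_add h1 h2).trans_eq ?_)
  ring

end Morrey

/-! ### Continuous representatives when `sp > 1`. -/

theorem gagliardo_congr_ae {σ p : ℝ} {v w : Circle → ℂ} (h : v =ᵐ[arcLength] w) :
    gagliardo σ p v = gagliardo σ p w := by
  unfold gagliardo
  congr 1
  refine lintegral_congr_ae (h.mono fun x hx => ?_)
  refine lintegral_congr_ae (h.mono fun y hy => ?_)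
  simp only [hx, hy]

theorem HasWeakDeriv.congr_right {k : ℕ} {u v w : Circle → ℂ} (h : HasWeakDeriv k u v)
    (hvw : v =ᵐ[arcLength] w) : HasWeakDeriv k u w := by
  refine ⟨h.1, h.2.1.congr hvw, fun φ hφ hφp => ?_⟩
  rw [h.2.2 φ hφ hφp]
  congr 1
  refine intervalIntegral.integral_congr_ae ?_
  filter_upwards [ae_exp_of_ae_arcLength hvw] with t ht _
  rw [ht]

/-- A weak derivative may be taken to be measurable. -/
theorem HasWeakDeriv.exists_measurable {k : ℕ} {u v : Circle → ℂ} (h : HasWeakDeriv k u v) :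
    ∃ w, Measurable w ∧ v =ᵐ[arcLength] w ∧ HasWeakDeriv k u w :=
  ⟨h.2.1.aestronglyMeasurable.mk v, h.2.1.aestronglyMeasurable.stronglyMeasurable_mk.measurable,
    h.2.1.aestronglyMeasurable.ae_eq_mk, h.congr_right h.2.1.aestronglyMeasurable.ae_eq_mk⟩

/-- A map of finite Gagliardo energy has a continuous representative in the supercritical case. -/
theorem exists_continuous_of_gagliardo_lt_top {σ p : ℝ} (hσ : 0 ≤ σ) (hp : 1 ≤ p)
    (hσp : 0 < σ - 1 / p) {v : Circle → ℂ} (hv : Measurable v) (hi : Integrable v arcLength)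
    (hg : gagliardo σ p v < ⊤) :
    ∃ F : ℝ → ℂ, Continuous F ∧ ∀ᵐ t : ℝ, v (Circle.exp t) = F t := by
  have hp0 : 0 < p := by linarith
  set V : ℝ → ℂ := fun t => v (Circle.exp t) with hVdef
  have hVm : Measurable V := hv.comp Circle.exp.continuous.measurable
  have hV : ∀ a b, IntervalIntegrable V volume a b := intervalIntegrable_exp_of_integrable hi
  set B := (gagliardo σ p v).toReal with hBdef
  -- A window of length 2 is shorter than a turn, so its energy is bounded by that of the circle,
  -- uniformly in the centre. Hence the means over shrinking windows converge uniformly and their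
  -- limit is continuous.
  have hE : ∀ θ, localEnergy σ p V (θ - 1) (θ + 1) ^ (1 / p) ≤ ENNReal.ofReal B := by
    intro θ
    have h1 := lintegral_window_energy_le hσ hp0 v (θ - 1) 1
    have h2 : localEnergy σ p V (θ - 1) (θ + 1) ≤ gagliardo σ p v ^ p := by
      refine (localEnergy_mono le_rfl ?_).trans (h1.trans_eq (by simp))
      have := Real.pi_gt_three
      push_cast; linarith
    rw [hBdef, ENNReal.ofReal_toReal hg.ne]
    calc _ ≤ (gagliardo σ p v ^ p) ^ (1 / p) := by gcongr
      _ = _ := by rw [← ENNReal.rpow_mul, mul_one_div_cancel hp0.ne', ENNReal.rpow_one]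
  set a : ℝ → ℕ → ℝ := fun θ n => θ - 1 / 2 ^ n with ha
  set b : ℝ → ℕ → ℝ := fun θ n => θ + 1 / 2 ^ n with hb
  set A : ℕ → ℝ → ℂ := fun n θ => (b θ n - a θ n)⁻¹ • ∫ t in (a θ n)..(b θ n), V t with hA
  have hdecr : ∀ n : ℕ, (1:ℝ) / 2 ^ (n + 1) ≤ 1 / 2 ^ n := fun n => by
    gcongr <;> norm_num
  have hnest := fun θ => cauchySeq_nested_mean hσ hp hσp hVm hV (B := B) (ℓ := 2)
    ENNReal.toReal_nonneg two_pos (a := a θ) (b := b θ) (fun n => by simp only [ha, hb]; ring)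
    (fun n => by simp only [ha]; linarith [hdecr n])
    (fun n => by simp only [hb]; linarith [hdecr n]) (by simpa [ha, hb] using hE θ)
  have hlim : ∀ θ, ∃ L, Tendsto (fun n => A n θ) atTop (𝓝 L) := fun θ =>
    cauchySeq_tendsto_of_complete (hnest θ).1
  choose F hF using hlim
  have hr : (2:ℝ) ^ (-(σ - 1 / p)) < 1 :=
    Real.rpow_lt_one_of_one_lt_of_neg (by norm_num) (by linarith)
  refine ⟨F, ?_, ?_⟩
  · have hunif : TendstoUniformly A F atTop := by
      rw [Metric.tendstoUniformly_iff]
      intro ε hε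
      have h0 := (tendsto_pow_atTop_nhds_zero_of_lt_one (by positivity) hr).const_mul
        (morreyConst (σ - 1 / p) * 2 ^ (σ - 1 / p) * B)
      rw [mul_zero] at h0
      filter_upwards [h0.eventually_lt_const hε] with n hn θ
      rw [dist_comm]
      exact ((hnest θ).2 (F θ) (hF θ) n).trans_lt hn
    refine hunif.continuous (Eventually.of_forall fun n => ?_).frequently
    have hc := intervalIntegral.continuous_primitive hV 0
    have : A n = fun θ => ((2:ℝ) / 2 ^ n)⁻¹ • ((∫ t in (0:ℝ)..(θ + 1 / 2 ^ n), V t) -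
        ∫ t in (0:ℝ)..(θ - 1 / 2 ^ n), V t) := by
      funext θ
      simp only [hA, ha, hb]
      rw [intervalIntegral.integral_interval_sub_left (hV _ _) (hV _ _)]
      congr 2; ring
    rw [this]
    exact ((hc.comp (continuous_id.add continuous_const)).sub
      (hc.comp (continuous_id.sub continuous_const))).const_smul ((2:ℝ) / 2 ^ n)⁻¹
  -- At a Lebesgue point both one-sided means tend to `V x`; the symmetric mean is their half sum.
  · filter_upwards [_root_.LocallyIntegrable.ae_hasDerivAt_integral
      (locallyIntegrable_exp_of_integrable hi)] with x hx
    refine tendsto_nhds_unique ?_ (hF x)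
    have hh : Tendsto (fun n : ℕ => (1:ℝ) / 2 ^ n) atTop (𝓝 0) := by
      simpa [div_eq_mul_inv] using tendsto_pow_atTop_nhds_zero_of_lt_one (r := (1 / 2 : ℝ))
        (by norm_num) (by norm_num)
    have h1 := tendsto_interval_mean hV (hx 0) (fun n => by positivity) hh
    have h2 := tendsto_interval_mean hV (hx 0) (h := fun n : ℕ => -((1:ℝ) / 2 ^ n))
      (fun n => neg_ne_zero.2 (by positivity)) (by simpa using hh.neg)
    have h3 := (h1.add h2).const_smul (1 / 2 : ℝ)
    rw [← two_smul ℝ (V x), smul_smul] at h3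
    norm_num only at h3
    rw [one_smul] at h3
    refine h3.congr fun n => ?_
    simp only [hA, ha, hb]
    rw [← sub_eq_add_neg x, intervalIntegral.integral_symm (x - 1 / 2 ^ n) x, inv_neg,
      neg_smul_neg, ← smul_add, add_comm,
      intervalIntegral.integral_add_adjacent_intervals (hV _ _) (hV _ _), smul_smul]
    congr 1
    field_simp
    norm_num

theorem exists_weakDeriv_of_sobolevSeminorm_lt_top {s p : ℝ} {u : Circle → ℂ}
    (h : sobolevSeminorm s p u < ⊤) : ∃ v, HasWeakDeriv ⌊s⌋₊ u v := by
  unfold sobolevSeminorm weakDerivLpNorm at h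
  split_ifs at h
  · obtain ⟨v, hv⟩ := iInf_lt_iff.1 h
    obtain ⟨hv, -⟩ := iInf_lt_iff.1 hv
    exact ⟨v, hv⟩
  · obtain ⟨v, hv⟩ := iInf_lt_iff.1 h
    obtain ⟨hv, -⟩ := iInf_lt_iff.1 hv
    exact ⟨v, hv⟩

theorem fract_eq_self_of_natFloor_eq_zero {s : ℝ} (hs : 0 ≤ s) (h : ⌊s⌋₊ = 0) :
    Int.fract s = s :=
  Int.fract_eq_self.2 ⟨hs, Nat.floor_eq_zero.1 h⟩

/-- Maps in `W^{s,p}` of the circle are continuous when `sp > 1`. -/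
theorem exists_continuous_of_sobolevSeminorm_lt_top {s p : ℝ} (hs : 0 < s) (hp : 1 ≤ p)
    (hsp : 1 < s * p) {u : Circle → ℂ} (h : sobolevSeminorm s p u < ⊤) :
    ∃ F : ℝ → ℂ, Continuous F ∧ ∀ᵐ t : ℝ, u (Circle.exp t) = F t := by
  rcases hm : ⌊s⌋₊ with _ | k
  · have hfr := fract_eq_self_of_natFloor_eq_zero hs.le hm
    unfold sobolevSeminorm at h
    rw [hfr, if_neg hs.ne', hm] at h
    obtain ⟨v, hv⟩ := iInf_lt_iff.1 h
    obtain ⟨hv, hg⟩ := iInf_lt_iff.1 hv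
    obtain ⟨w, hw, hvw, huw⟩ := hv.exists_measurable
    rw [gagliardo_congr_ae hvw] at hg
    obtain ⟨F, hF, hwF⟩ := exists_continuous_of_gagliardo_lt_top hs.le hp (by
      rw [sub_pos, div_lt_iff₀ (by linarith)]; exact hsp) hw huw.2.1 hg
    refine ⟨F, hF, ?_⟩
    filter_upwards [ae_exp_of_ae_arcLength huw.ae_eq, hwF] with t h1 h2
    rw [h1, h2]
  · obtain ⟨v, hv⟩ := exists_weakDeriv_of_sobolevSeminorm_lt_top h
    rw [hm] at hv
    obtain ⟨U, -, -, hU, hae⟩ := hv.exists_derivative_chain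
    exact ⟨U 0, hU, hae⟩

/-! ### Counting intervals and adding up their energies. -/

/-- A continuous function that increases by `n` steps takes the intermediate values in order. -/
theorem exists_strictMono_values {ψ : ℝ → ℝ} (hψ : Continuous ψ) {h : ℝ} (hh : 0 < h) (n : ℕ)
    {a b : ℝ} (hab : a ≤ b) (hb : ψ a + n * h ≤ ψ b) :
    ∃ x : ℕ → ℝ, (∀ i < n, x i < x (i + 1)) ∧ (∀ i ≤ n, x i ∈ Set.Icc a b) ∧
      ∀ i ≤ n, ψ (x i) = ψ a + i * h := by
  induction n generalizing b with
  | zero => exact ⟨fun _ => a, by simp, fun _ _ => ⟨le_rfl, hab⟩, by simp⟩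
  | succ n ih =>
    push_cast at hb
    obtain ⟨z, hz, hzψ⟩ : ψ a + (n + 1) * h ∈ ψ '' Set.Icc a b :=
      intermediate_value_Icc hab hψ.continuousOn ⟨by nlinarith [n.cast_nonneg (α := ℝ)], hb⟩
    -- The last point is chosen first; the others are then sought to its left, which makes the order
    -- automatic.
    obtain ⟨x, h1, h2, h3⟩ := ih hz.1 (by rw [hzψ]; nlinarith)
    have hxn : x n < z := by
      refine lt_of_le_of_ne (h2 n le_rfl).2 fun he => ?_
      have := h3 n le_rfl
      rw [he, hzψ] at this
      nlinarith
    refine ⟨fun i => if i ≤ n then x i else z, fun i hi => ?_, fun i hi => ?_, fun i hi => ?_⟩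
    · rcases Nat.lt_or_ge i n with h | h
      · simpa [h.le, Nat.succ_le_of_lt h] using h1 i h
      · obtain rfl : i = n := by omega
        simpa using hxn
    · by_cases h : i ≤ n
      · simpa [h] using ⟨(h2 i h).1, (h2 i h).2.trans hz.2⟩
      · simpa [h] using hz
    · by_cases h : i ≤ n
      · simpa [h] using h3 i h
      · obtain rfl : i = n + 1 := by omega
        simp [hzψ]

theorem sum_lintegral_Ioc_eq (Φ : ℝ → ℝ≥0∞) {Y : ℕ → ℝ} {n : ℕ}
    (hY : ∀ j < n, Y j ≤ Y (j + 1)) :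
    Y 0 ≤ Y n ∧ ∑ j ∈ Finset.range n, ∫⁻ x in Set.Ioc (Y j) (Y (j + 1)), Φ x =
      ∫⁻ x in Set.Ioc (Y 0) (Y n), Φ x := by
  induction n with
  | zero => simp
  | succ n ih =>
    obtain ⟨h1, h2⟩ := ih fun j hj => hY j (by omega)
    have h3 := hY n (by omega)
    refine ⟨h1.trans h3, ?_⟩
    rw [Finset.sum_range_succ, h2, ← Set.Ioc_union_Ioc_eq_Ioc h1 h3,
      lintegral_union measurableSet_Ioc (Set.Ioc_disjoint_Ioc_of_le le_rfl)]

/-- Disjoint intervals in a bounded window, on each of which the energy is bounded below by a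
negative power of the length, carry a large total energy. -/
theorem rpow_le_of_sum_le {n : ℕ} {q K L e : ℝ} (hq : 0 ≤ q) (hK : 0 ≤ K) (hL : 0 < L)
    {ℓ E : ℕ → ℝ} (hn : 0 < n) (hℓ : ∀ j < n, 0 < ℓ j) (hE : ∀ j < n, 0 ≤ E j)
    (hloc : ∀ j < n, 1 ≤ K * ℓ j ^ q * E j) (hsum : ∑ j ∈ Finset.range n, ℓ j ≤ L)
    (hEsum : ∑ j ∈ Finset.range n, E j ≤ e) :
    (n : ℝ) ^ (1 + q) ≤ 2 * (2 * L) ^ q * K * e := by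
  have hn' : (0:ℝ) < n := by exact_mod_cast hn
  -- Twice the mean available length. An interval longer than `lam` contributes at least 1 to `∑ ℓ j
  -- / lam ≤ n/2`; a shorter one has `K lam^q E j ≥ 1`. So the energies account for at least `n/2`.
  set lam : ℝ := 2 * L / n with hlam
  have hlam0 : 0 < lam := by positivity
  have h1 : ∀ j ∈ Finset.range n, (1:ℝ) ≤ ℓ j / lam + K * lam ^ q * E j := by
    intro j hj
    have hj := Finset.mem_range.1 hj
    have hℓj := hℓ j hj
    have hEj := hE j hj
    rcases le_total (ℓ j) lam with h | h
    · have : K * ℓ j ^ q * E j ≤ K * lam ^ q * E j := by gcongr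
      have h2 : 0 ≤ ℓ j / lam := by positivity
      linarith [hloc j hj]
    · have : 1 ≤ ℓ j / lam := (one_le_div hlam0).2 h
      have h2 : 0 ≤ K * lam ^ q * E j := by positivity
      linarith
  have h2 := Finset.sum_le_sum h1
  rw [Finset.sum_add_distrib, ← Finset.sum_div, ← Finset.mul_sum] at h2
  simp only [Finset.sum_const, Finset.card_range, nsmul_eq_mul, mul_one] at h2
  have h3 : (∑ j ∈ Finset.range n, ℓ j) / lam ≤ n / 2 := by
    rw [div_le_iff₀ hlam0, hlam]
    refine hsum.trans_eq ?_
    field_simp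
  have h4 : K * lam ^ q * ∑ j ∈ Finset.range n, E j ≤ K * lam ^ q * e := by gcongr
  have h5 : (n : ℝ) / 2 ≤ K * lam ^ q * e := by linarith
  have h6 : lam ^ q * (n:ℝ) ^ q = (2 * L) ^ q := by
    rw [hlam, Real.div_rpow (by positivity) hn'.le]
    field_simp
  rw [Real.rpow_add hn', Real.rpow_one]
  calc (n:ℝ) * (n:ℝ) ^ q = 2 * ((n:ℝ) / 2) * (n:ℝ) ^ q := by ring
    _ ≤ 2 * (K * lam ^ q * e) * (n:ℝ) ^ q := by gcongr
    _ = 2 * (lam ^ q * (n:ℝ) ^ q) * K * e := by ring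
    _ = _ := by rw [h6]

/-- The energy of a curve whose phase winds `d` times is at least a multiple of `d^{sp}`, if a
fixed multiple of `|J|^{1-sp}` is needed on each interval `J` that contains `2k + 2` zeros of the
difference and a point of maximal distance between the middle ones. -/
theorem rpow_winding_le_energy {ψ : ℝ → ℝ} (hψ : Continuous ψ) {d k : ℕ} (hd : 0 < d)
    (hψd : ∀ θ, ψ (θ + 2 * Real.pi) = ψ θ + 2 * Real.pi * d) {E : ℝ → ℝ → ℝ≥0∞} {T : ℝ≥0∞}
    {C q p : ℝ} (hC : 0 < C) (hq : 0 ≤ q) (hp : 0 < p)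
    (hT : ∀ (a : ℝ) (Y : ℕ → ℝ) (n : ℕ), a ≤ Y 0 → (∀ j < n, Y j ≤ Y (j + 1)) →
      Y n ≤ a + ((2 * k + 1 : ℕ) : ℝ) * (2 * Real.pi) →
        ∑ j ∈ Finset.range n, E (Y j) (Y (j + 1)) ≤ T)
    (hloc : ∀ (y : ℕ → ℝ) (x : ℝ), (∀ i < 2 * k + 1, y i < y (i + 1)) →
      (∀ i ≤ 2 * k + 1, Circle.exp (ψ (y i)) = 1) → x ∈ Set.Icc (y k) (y (k + 1)) →
      Circle.exp (ψ x) = Circle.exp Real.pi →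
        2 ≤ ENNReal.ofReal (C * (y (2 * k + 1) - y 0) ^ (q / p)) *
          E (y 0) (y (2 * k + 1)) ^ (1 / p)) :
    ENNReal.ofReal ((d : ℝ) ^ (1 + q)) ≤
      ENNReal.ofReal (2 * (2 * (((2 * k + 1 : ℕ) : ℝ) * (2 * Real.pi))) ^ q * (C / 2) ^ p) * T := by
  set M : ℕ := 2 * k + 1 with hM
  have hπ := Real.pi_pos
  have hMpos : (0:ℝ) < M := by rw [hM]; positivity
  rcases eq_or_ne T ⊤ with rfl | hTtop
  · rw [ENNReal.mul_top]
    · exact le_top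
    · simp only [ne_eq, ENNReal.ofReal_eq_zero, not_le]; positivity
  -- Since `d ≥ 1`, the phase gains at least `2π` over a turn and meets a multiple of `2π` there.
  obtain ⟨a, n, ha⟩ : ∃ (a : ℝ) (n : ℤ), ψ a = n * (2 * Real.pi) := by
    have h1 : (1:ℝ) ≤ d := by exact_mod_cast hd
    have h2 := Int.le_ceil (ψ 0 / (2 * Real.pi))
    have h3 := (Int.ceil_lt_add_one (ψ 0 / (2 * Real.pi))).le
    rw [div_le_iff₀ (by positivity)] at h2
    rw [div_add_one (by positivity), le_div_iff₀ (by positivity)] at h3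
    obtain ⟨a, -, ha⟩ : (⌈ψ 0 / (2 * Real.pi)⌉ : ℝ) * (2 * Real.pi) ∈
        ψ '' Set.Icc 0 (0 + 2 * Real.pi) :=
      intermediate_value_Icc (by linarith) hψ.continuousOn ⟨h2, by rw [hψd]; nlinarith⟩
    exact ⟨a, _, ha⟩
  have hend : ∀ j : ℕ, ψ (a + j * (2 * Real.pi)) = ψ a + j * (2 * Real.pi * d) := by
    intro j
    induction j with
    | zero => simp
    | succ j ih =>
      rw [show a + ((j + 1 : ℕ) : ℝ) * (2 * Real.pi) = a + j * (2 * Real.pi) + 2 * Real.pi by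
        push_cast; ring, hψd, ih]
      push_cast; ring
  -- The phase takes the values `ψ a + iπ` in increasing order over `M` turns: even indices give
  -- zeros of the difference of the two maps, odd ones antipodal values.
  obtain ⟨x, hx1, hx2, hx3⟩ := exists_strictMono_values hψ hπ (2 * (M * d))
    (a := a) (b := a + M * (2 * Real.pi)) (by nlinarith) (by
      rw [hend]; push_cast; exact le_of_eq (by ring))
  have hmono : ∀ i j, i ≤ j → j ≤ 2 * (M * d) → x i ≤ x j := by
    intro i j hij
    induction j, hij using Nat.le_induction with
    | base => intro _; exact le_rfl
    | succ j hij ih => intro hj; exact (ih (by omega)).trans (hx1 j (by omega)).le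
  have hidx : ∀ j < d, M * j + M ≤ M * d := fun j hj => by
    have := Nat.mul_le_mul_left M (Nat.succ_le_of_lt hj)
    rwa [Nat.mul_succ] at this
  have heven : ∀ i, 2 * i ≤ 2 * (M * d) → Circle.exp (ψ (x (2 * i))) = 1 := by
    intro i hi
    rw [hx3 _ hi, ha, Circle.exp_eq_one]
    exact ⟨n + i, by push_cast; ring⟩
  have hodd : ∀ i, 2 * i + 1 ≤ 2 * (M * d) →
      Circle.exp (ψ (x (2 * i + 1))) = Circle.exp Real.pi := by
    intro i hi
    rw [hx3 _ hi, ha, Circle.exp_eq_exp]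
    exact ⟨n + i, by push_cast; ring⟩
  -- Ends of the groups: each covers `M = 2k + 1` gaps between consecutive zeros, so neighbouring
  -- groups share only an endpoint, and the `M * d` gaps make `d` groups.
  set Y : ℕ → ℝ := fun j => x (2 * (M * j)) with hY
  have hYlt : ∀ j < d, Y j < Y (j + 1) := by
    intro j hj
    have := hidx j hj
    refine (hx1 (2 * (M * j)) (by omega)).trans_le ?_
    refine hmono _ _ ?_ ?_ <;> rw [Nat.mul_succ] <;> omega
  have hgroup : ∀ j < d, 2 ≤ ENNReal.ofReal (C * (Y (j + 1) - Y j) ^ (q / p)) *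
      E (Y j) (Y (j + 1)) ^ (1 / p) := by
    intro j hj
    have hj' := hidx j hj
    -- The point of maximal distance lies in the middle gap, between the zeros numbered `k` and `k +
    -- 1` of the group.
    have := hloc (fun i => x (2 * (M * j + i))) (x (2 * (M * j + k) + 1)) ?_ ?_ ?_ ?_
    · simpa only [hY, Nat.mul_succ, ← hM, add_zero] using this
    · intro i hi
      refine (hx1 _ (by omega)).trans ?_
      exact hx1 (2 * (M * j + i) + 1) (by omega)
    · intro i hi
      exact heven _ (by omega)
    · exact ⟨hmono _ _ (by omega) (by omega), hmono _ _ (by omega) (by omega)⟩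
    · exact hodd _ (by omega)
  have hY0 : a ≤ Y 0 := (hx2 _ (by simp)).1
  have hYd : Y d ≤ a + M * (2 * Real.pi) := (hx2 _ le_rfl).2
  have hsumT := hT a Y d hY0 (fun j hj => (hYlt j hj).le) hYd
  have hEtop : ∀ j < d, E (Y j) (Y (j + 1)) ≠ ⊤ := fun j hj =>
    (((Finset.single_le_sum (f := fun j => E (Y j) (Y (j + 1))) (fun _ _ => zero_le)
      (Finset.mem_range.2 hj)).trans hsumT).trans_lt hTtop.lt_top).ne
  -- The constant `(C / 2) ^ p` comes from dividing the local bound by 2 and raising it to the power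
  -- `p`.
  have key := rpow_le_of_sum_le (n := d) (q := q) (K := (C / 2) ^ p) (L := M * (2 * Real.pi))
    (e := T.toReal) (ℓ := fun j => Y (j + 1) - Y j) (E := fun j => (E (Y j) (Y (j + 1))).toReal)
    hq (by positivity) (by positivity) hd (fun j hj => sub_pos.2 (hYlt j hj))
    (fun j _ => ENNReal.toReal_nonneg) ?_ ?_ ?_
  · rw [← ENNReal.ofReal_toReal hTtop, ← ENNReal.ofReal_mul (by positivity)]
    exact ENNReal.ofReal_le_ofReal key
  · intro j hj
    have hℓ : 0 < Y (j + 1) - Y j := sub_pos.2 (hYlt j hj)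
    set e := (E (Y j) (Y (j + 1))).toReal with he
    have he0 : 0 ≤ e := ENNReal.toReal_nonneg
    have h1 := hgroup j hj
    rw [← ENNReal.ofReal_toReal (hEtop j hj), ← he,
      ENNReal.ofReal_rpow_of_nonneg he0 (by positivity), ← ENNReal.ofReal_mul (by positivity),
      show (2:ℝ≥0∞) = ENNReal.ofReal 2 by simp, ENNReal.ofReal_le_ofReal_iff (by positivity)] at h1
    have h2 : 1 ≤ C / 2 * (Y (j + 1) - Y j) ^ (q / p) * e ^ (1 / p) := by linarith
    have h3 := Real.rpow_le_rpow zero_le_one h2 hp.le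
    rw [Real.one_rpow, Real.mul_rpow (by positivity) (by positivity),
      Real.mul_rpow (by positivity) (by positivity), ← Real.rpow_mul hℓ.le,
      ← Real.rpow_mul he0, div_mul_cancel₀ _ hp.ne', one_div_mul_cancel hp.ne',
      Real.rpow_one] at h3
    exact h3
  · rw [Finset.sum_range_sub]
    linarith
  · rw [← ENNReal.toReal_sum fun j hj => hEtop j (Finset.mem_range.1 hj)]
    exact ENNReal.toReal_mono hTtop hsumT

/-! ### Local lower bounds for the energy between zeros. -/

section LocalEstimates

/-- Superadditivity: in each piece only the inner variable is enlarged to the whole window; the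
pieces of the outer variable are then disjoint. -/
theorem sum_localEnergy_le {σ p : ℝ} {V : ℝ → ℂ} {a b : ℝ} {Y : ℕ → ℝ} {n : ℕ} (ha : a ≤ Y 0)
    (hY : ∀ j < n, Y j ≤ Y (j + 1)) (hb : Y n ≤ b) :
    ∑ j ∈ Finset.range n, localEnergy σ p V (Y j) (Y (j + 1)) ≤ localEnergy σ p V a b := by
  have hmono : ∀ i j, i ≤ j → j ≤ n → Y i ≤ Y j := by
    intro i j hij
    induction j, hij using Nat.le_induction with
    | base => intro _; exact le_rfl
    | succ j hij ih => intro hj; exact (ih (by omega)).trans (hY j (by omega))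
  calc _ ≤ ∑ j ∈ Finset.range n, ∫⁻ x in Set.Ioc (Y j) (Y (j + 1)), ∫⁻ y in Set.Ioc a b,
        ‖V x - V y‖ₑ ^ p / ‖x - y‖ₑ ^ (1 + σ * p) := by
        refine Finset.sum_le_sum fun j hj => lintegral_mono fun x => lintegral_mono_set ?_
        have hj := Finset.mem_range.1 hj
        exact Set.Ioc_subset_Ioc (ha.trans (hmono 0 j (by omega) (by omega)))
          ((hmono (j + 1) n (by omega) le_rfl).trans hb)
    _ = ∫⁻ x in Set.Ioc (Y 0) (Y n), ∫⁻ y in Set.Ioc a b,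
        ‖V x - V y‖ₑ ^ p / ‖x - y‖ₑ ^ (1 + σ * p) := (sum_lintegral_Ioc_eq _ hY).2
    _ ≤ _ := lintegral_mono_set (Set.Ioc_subset_Ioc ha hb)

/-- A function with `2k + 2` zeros and `k` derivatives, the last one of which is a primitive of
`V`, is controlled by the oscillation of the primitives of `V`. -/
theorem norm_le_of_zeros {k : ℕ} {U : ℕ → ℝ → ℂ} {V : ℝ → ℂ}
    (hV : ∀ a b, IntervalIntegrable V volume a b)
    (hU : ∀ i < k, ∀ x, HasDerivAt (U i) (U (i + 1) x) x)
    (hUV : ∀ x y, U k y - U k x = ∫ t in x..y, V t) {y : ℕ → ℝ} {B : ℝ} (hB : 0 ≤ B)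
    (hy : ∀ i < 2 * k + 1, y i < y (i + 1)) (h0 : ∀ i ≤ 2 * k + 1, U 0 (y i) = 0)
    (hosc : ∀ (c : ℂ) (a b x : ℝ), ‖c‖ = 1 → y 0 ≤ a → b ≤ y (2 * k + 1) → a < b →
      x ∈ Set.Icc a b → ∫ t in a..b, (c * V t).re = 0 → |∫ t in a..x, (c * V t).re| ≤ B)
    {x : ℝ} (hx : x ∈ Set.Icc (y k) (y (k + 1))) :
    ‖U 0 x‖ ≤ (y (2 * k + 1) - y 0) ^ k * B := by
  rcases eq_or_ne (U 0 x) 0 with h | h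
  · rw [h, norm_zero]
    have : ∀ j ≤ 2 * k + 1, y 0 ≤ y j := by
      intro j
      induction j with
      | zero => intro _; exact le_rfl
      | succ j ih => intro hj; exact (ih (by omega)).trans (hy j (by omega)).le
    have := this _ le_rfl
    have : 0 ≤ y (2 * k + 1) - y 0 := by linarith
    positivity
  -- Rolle's theorem needs real functions. The rotation `c` makes `U 0 x` real and positive, and the
  -- real parts of `c * U i` keep the zeros and the derivative relations.
  set c : ℂ := (starRingEnd ℂ) (U 0 x) / ‖U 0 x‖ with hc
  have hn : (‖U 0 x‖ : ℂ) ≠ 0 := by simpa using h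
  have hc1 : ‖c‖ = 1 := by
    rw [hc, norm_div, RCLike.norm_conj]; simp [h]
  have hcx : (c * U 0 x).re = ‖U 0 x‖ := by
    have : c * U 0 x = ‖U 0 x‖ := by
      rw [hc, div_mul_eq_mul_div, Complex.conj_mul', pow_two]; field_simp
    rw [this, Complex.ofReal_re]
  have hprim : ∀ a b, (c * U k b).re - (c * U k a).re = ∫ t in a..b, (c * V t).re := by
    intro a b
    rw [← Complex.sub_re, ← mul_sub, hUV, ← intervalIntegral.integral_const_mul]
    exact (Complex.reCLM.intervalIntegral_comp_comm ((hV a b).const_mul c)).symm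
  have key := abs_le_pow_mul_of_zeros (k := k) (R := fun i t => (c * U i t).re)
    (fun i hi t => Complex.reCLM.hasFDerivAt.comp_hasDerivAt t ((hU i hi t).const_mul c))
    hB hy le_rfl le_rfl (fun i hi => by simp [h0 i hi]) (fun a b t ha hb hab h1 h2 ht => by
      have := hosc c a b t hc1 ha hb hab ht (by rw [← hprim, h1, h2, sub_zero])
      rwa [← hprim, h1, sub_zero] at this) hx
  rwa [hcx, abs_of_nonneg (norm_nonneg _)] at key

theorem intervalIntegrable_re_mul {V : ℝ → ℂ} (hV : ∀ a b, IntervalIntegrable V volume a b)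
    (c : ℂ) (a b : ℝ) : IntervalIntegrable (fun t => (c * V t).re) volume a b :=
  ⟨Complex.reCLM.integrable_comp ((hV a b).const_mul c).1,
    Complex.reCLM.integrable_comp ((hV a b).const_mul c).2⟩

theorem norm_re_mul_le {c : ℂ} (hc : ‖c‖ = 1) (z : ℂ) : |(c * z).re| ≤ ‖z‖ := by
  simpa [hc] using Complex.abs_re_le_norm (c * z)

/-- Between two zeros of the projected `k`-th derivative the projection of `V` has zero mean, so
`enorm_smul_integral_sub_le` acts as a Poincaré inequality with the fractional energy on the right.
-/
theorem enorm_le_of_zeros_of_fract_pos {k : ℕ} {U : ℕ → ℝ → ℂ} {V : ℝ → ℂ} {σ p : ℝ} (hσ : 0 ≤ σ)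
    (hp : 1 ≤ p) (hVm : Measurable V) (hV : ∀ a b, IntervalIntegrable V volume a b)
    (hU : ∀ i < k, ∀ x, HasDerivAt (U i) (U (i + 1) x) x)
    (hUV : ∀ x y, U k y - U k x = ∫ t in x..y, V t) {y : ℕ → ℝ}
    (hy : ∀ i < 2 * k + 1, y i < y (i + 1)) (hy0 : y 0 < y (2 * k + 1))
    (h0 : ∀ i ≤ 2 * k + 1, U 0 (y i) = 0)
    {x : ℝ} (hx : x ∈ Set.Icc (y k) (y (k + 1))) :
    ‖U 0 x‖ₑ ≤ ENNReal.ofReal ((y (2 * k + 1) - y 0) ^ (k + 1 + σ - 1 / p)) *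
      localEnergy σ p V (y 0) (y (2 * k + 1)) ^ (1 / p) := by
  have hp0 : 0 < p := by linarith
  have hℓ : 0 < y (2 * k + 1) - y 0 := sub_pos.2 hy0
  have hp1 : 1 / p ≤ 1 := by rw [div_le_one hp0]; exact hp
  rcases eq_or_ne (localEnergy σ p V (y 0) (y (2 * k + 1)) ^ (1 / p)) ⊤ with hE | hE
  · rw [hE, ENNReal.mul_top]
    · exact le_top
    · simp only [ne_eq, ENNReal.ofReal_eq_zero, not_le]; positivity
  set B := (localEnergy σ p V (y 0) (y (2 * k + 1)) ^ (1 / p)).toReal with hBdef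
  have hB : 0 ≤ B := ENNReal.toReal_nonneg
  have key := norm_le_of_zeros hV hU hUV
    (B := (y (2 * k + 1) - y 0) ^ (1 + σ - 1 / p) * B) (by positivity) hy h0 ?_ hx
  · rw [← ENNReal.ofReal_toReal hE, ← hBdef, ← ENNReal.ofReal_mul (by positivity), ← ofReal_norm]
    refine ENNReal.ofReal_le_ofReal (key.trans_eq ?_)
    rw [show (k:ℝ) + 1 + σ - 1 / p = k + (1 + σ - 1 / p) by ring, Real.rpow_add hℓ,
      Real.rpow_natCast, mul_assoc]
  · intro c a b t hc ha hb hab ht hint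
    have hba : 0 < b - a := sub_pos.2 hab
    have h1 := enorm_smul_integral_sub_le (intervalIntegrable_re_mul hV c) le_rfl ht.1 ht.2
    rw [hint, smul_zero, sub_zero] at h1
    have h2 : ∫⁻ x in Set.Ioc a b, ∫⁻ y in Set.Ioc a b, ‖(c * V x).re - (c * V y).re‖ₑ ≤
        ∫⁻ x in Set.Ioc a b, ∫⁻ y in Set.Ioc a b, ‖V x - V y‖ₑ := by
      refine lintegral_mono fun x => lintegral_mono fun y => ?_
      rw [← ofReal_norm, ← ofReal_norm, ← Complex.sub_re, ← mul_sub]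
      exact ENNReal.ofReal_le_ofReal (norm_re_mul_le hc _)
    have h3 : ‖(b - a) • ∫ t in a..t, (c * V t).re‖ₑ ≤
        ENNReal.ofReal ((b - a) ^ (2 + σ - 1 / p) * B) := by
      refine (h1.trans (h2.trans (lintegral_enorm_sub_le_localEnergy hσ hp hVm hab))).trans ?_
      rw [ENNReal.ofReal_mul (by positivity), hBdef, ENNReal.ofReal_toReal hE]
      gcongr
      exact localEnergy_mono ha hb
    rw [← ofReal_norm, ENNReal.ofReal_le_ofReal_iff (by positivity), norm_smul,
      Real.norm_of_nonneg hba.le, show 2 + σ - 1 / p = 1 + (1 + σ - 1 / p) by ring,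
      Real.rpow_add hba, Real.rpow_one, mul_assoc, mul_le_mul_iff_right₀ hba] at h3
    refine h3.trans ?_
    gcongr
    linarith

/-- In the integer case the `k`-th derivative starts from a zero and Hölder bounds the integral of
`V`; the second zero plays no role in this last estimate. -/
theorem enorm_le_of_zeros_of_fract_eq_zero {k : ℕ} {U : ℕ → ℝ → ℂ} {V : ℝ → ℂ} {p : ℝ}
    (hp : 1 ≤ p) (hVm : Measurable V) (hV : ∀ a b, IntervalIntegrable V volume a b)
    (hU : ∀ i < k, ∀ x, HasDerivAt (U i) (U (i + 1) x) x)
    (hUV : ∀ x y, U k y - U k x = ∫ t in x..y, V t) {y : ℕ → ℝ}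
    (hy : ∀ i < 2 * k + 1, y i < y (i + 1)) (hy0 : y 0 < y (2 * k + 1))
    (h0 : ∀ i ≤ 2 * k + 1, U 0 (y i) = 0)
    {x : ℝ} (hx : x ∈ Set.Icc (y k) (y (k + 1))) :
    ‖U 0 x‖ₑ ≤ ENNReal.ofReal ((y (2 * k + 1) - y 0) ^ (k + 1 - 1 / p)) *
      (∫⁻ t in Set.Ioc (y 0) (y (2 * k + 1)), ‖V t‖ₑ ^ p) ^ (1 / p) := by
  have hp0 : 0 < p := by linarith
  have hℓ : 0 < y (2 * k + 1) - y 0 := sub_pos.2 hy0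
  have hp1 : 1 / p ≤ 1 := by rw [div_le_one hp0]; exact hp
  set e := (∫⁻ t in Set.Ioc (y 0) (y (2 * k + 1)), ‖V t‖ₑ ^ p) ^ (1 / p) with he
  rcases eq_or_ne e ⊤ with hE | hE
  · rw [hE, ENNReal.mul_top]
    · exact le_top
    · simp only [ne_eq, ENNReal.ofReal_eq_zero, not_le]; positivity
  have hB : 0 ≤ e.toReal := ENNReal.toReal_nonneg
  have key := norm_le_of_zeros hV hU hUV
    (B := (y (2 * k + 1) - y 0) ^ (1 - 1 / p) * e.toReal) (by positivity) hy h0 ?_ hx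
  · rw [← ENNReal.ofReal_toReal hE, ← ENNReal.ofReal_mul (by positivity), ← ofReal_norm]
    refine ENNReal.ofReal_le_ofReal (key.trans_eq ?_)
    rw [show (k:ℝ) + 1 - 1 / p = k + (1 - 1 / p) by ring, Real.rpow_add hℓ,
      Real.rpow_natCast, mul_assoc]
  · intro c a b t hc ha hb hab ht _
    have h1 : ‖∫ t in a..t, (c * V t).re‖ₑ ≤
        ∫⁻ t in Set.Ioc (y 0) (y (2 * k + 1)), ‖V t‖ₑ := by
      rw [intervalIntegral.integral_of_le ht.1]
      refine (enorm_integral_le_lintegral_enorm _).trans ?_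
      refine (lintegral_mono_set (Set.Ioc_subset_Ioc ha (ht.2.trans hb))).trans
        (lintegral_mono fun s => ?_)
      rw [← ofReal_norm, ← ofReal_norm]
      exact ENNReal.ofReal_le_ofReal (norm_re_mul_le hc _)
    have h2 := lintegral_le_rpow_mul_measure_univ
      (μ := volume.restrict (Set.Ioc (y 0) (y (2 * k + 1)))) (g := fun t => ‖V t‖ₑ)
      (by fun_prop) hp
    rw [← he, Measure.restrict_apply MeasurableSet.univ, Set.univ_inter, Real.volume_Ioc,
      ENNReal.ofReal_rpow_of_pos hℓ] at h2
    have h3 := h1.trans h2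
    rw [← ENNReal.ofReal_toReal hE, ← ENNReal.ofReal_mul hB, ← ofReal_norm,
      ENNReal.ofReal_le_ofReal_iff (by positivity), mul_comm] at h3
    exact h3

end LocalEstimates

/-! ### The lower bound `|d₁ - d₂|^s`. -/

section LowerBound

/-- Passing from energies to norms. -/
theorem ofReal_mul_rpow_le_of_rpow_le {s p K : ℝ} (hp : 0 < p) (hK : 0 < K) {d : ℝ}
    (hd : 0 ≤ d) {X : ℝ≥0∞}
    (h : ENNReal.ofReal (d ^ (s * p)) ≤ ENNReal.ofReal K * X ^ p) :
    ENNReal.ofReal (K ^ (-(1 / p)) * d ^ s) ≤ X := by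
  have h1 := ENNReal.rpow_le_rpow h (show 0 ≤ 1 / p by positivity)
  rw [ENNReal.mul_rpow_of_nonneg _ _ (by positivity), ← ENNReal.rpow_mul,
    mul_one_div_cancel hp.ne', ENNReal.rpow_one, ENNReal.ofReal_rpow_of_pos hK,
    ENNReal.ofReal_rpow_of_nonneg (by positivity) (by positivity), ← Real.rpow_mul hd,
    mul_assoc, mul_one_div_cancel hp.ne', mul_one] at h1
  rw [Real.rpow_neg hK.le, ENNReal.ofReal_mul (by positivity)]
  calc _ ≤ ENNReal.ofReal ((K ^ (1 / p))⁻¹) * (ENNReal.ofReal (K ^ (1 / p)) * X) := by gcongr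
    _ = X := by
      rw [← mul_assoc, ← ENNReal.ofReal_mul (by positivity), inv_mul_cancel₀ (by positivity),
        ENNReal.ofReal_one, one_mul]

theorem eLpNorm_rpow_eq {p : ℝ} (hp : 0 < p) (v : Circle → ℂ) :
    eLpNorm v (ENNReal.ofReal p) arcLength ^ p = ∫⁻ z, ‖v z‖ₑ ^ p ∂arcLength := by
  rw [eLpNorm_eq_lintegral_rpow_enorm_toReal (by simpa using hp) ENNReal.ofReal_ne_top,
    ENNReal.toReal_ofReal hp.le, ← ENNReal.rpow_mul, one_div_mul_cancel hp.ne', ENNReal.rpow_one]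

/-- Serves for `⌊s⌋ = 0`. One gap between zeros suffices: Morrey's inequality from the left zero to
the point where `|H| = 2` gives the local bound with exponent `(sp - 1)/p = s - 1/p`. -/
theorem gagliardo_winding_lower_bound {s p : ℝ} (hs : 0 < s) (hp : 1 ≤ p) (hsp : 1 < s * p) :
    ∃ K : ℝ, 0 < K ∧ ∀ (ψ : ℝ → ℝ) (d : ℕ) (H : ℝ → ℂ) (w : Circle → ℂ), Continuous ψ → 0 < d →
      (∀ θ, ψ (θ + 2 * Real.pi) = ψ θ + 2 * Real.pi * d) → Continuous H →
      (∀ θ, Circle.exp (ψ θ) = 1 → H θ = 0) →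
      (∀ θ, Circle.exp (ψ θ) = Circle.exp Real.pi → ‖H θ‖ = 2) →
      (∀ᵐ t : ℝ, w (Circle.exp t) = H t) →
      ENNReal.ofReal ((d : ℝ) ^ (s * p)) ≤ ENNReal.ofReal K * gagliardo s p w ^ p := by
  have hp0 : 0 < p := by linarith
  have hα : 0 < s - 1 / p := by rw [sub_pos, div_lt_iff₀ hp0]; exact hsp
  have hC := morreyConst_pos hα
  refine ⟨2 * (2 * (((2 * 0 + 1 : ℕ) : ℝ) * (2 * Real.pi))) ^ (s * p - 1) *
    (2 * morreyConst (s - 1 / p) / 2) ^ p, by have := Real.pi_pos; positivity, ?_⟩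
  intro ψ d H w hψ hd hψd hH hH0 hH2 hw
  have hcongr : ∀ a b, localEnergy s p H a b = localEnergy s p (fun t => w (Circle.exp t)) a b := by
    intro a b
    refine lintegral_congr_ae (ae_restrict_of_ae (hw.mono fun x hx => ?_))
    refine lintegral_congr_ae (ae_restrict_of_ae (hw.mono fun y hy => ?_))
    simp only [hx, hy]
  have key := rpow_winding_le_energy hψ (k := 0) hd hψd (E := localEnergy s p H)
    (T := gagliardo s p w ^ p) (C := 2 * morreyConst (s - 1 / p)) (q := s * p - 1) (p := p)
    (by positivity) (by linarith) hp0 ?_ ?_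
  · rwa [show 1 + (s * p - 1) = s * p by ring] at key
  · intro a Y n ha hY hb
    refine (sum_localEnergy_le ha hY hb).trans ?_
    rw [hcongr]
    simpa using lintegral_window_energy_le hs.le hp0 w a 1
  · intro y x hy h1 hx h2
    have hy01 : y 0 < y 1 := hy 0 (by norm_num)
    have hne : y 0 ≠ x := by
      rintro rfl
      have := hH2 _ h2
      rw [hH0 _ (h1 0 (by norm_num)), norm_zero] at this
      norm_num at this
    have hlt : y 0 < x := lt_of_le_of_ne hx.1 hne
    have hqp : (s * p - 1) / p = s - 1 / p := by field_simp
    rw [hqp]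
    rcases eq_or_ne (localEnergy s p H (y 0) (y 1) ^ (1 / p)) ⊤ with hE | hE
    · simp only [mul_zero, zero_add]
      rw [hE, ENNReal.mul_top]
      · exact le_top
      · have : 0 < y 1 - y 0 := sub_pos.2 hy01
        simp only [ne_eq, ENNReal.ofReal_eq_zero, not_le]; positivity
    have h3 := norm_sub_le_of_localEnergy_le hs.le hp hα hH
      (B := (localEnergy s p H (y 0) (y 1) ^ (1 / p)).toReal) ENNReal.toReal_nonneg hlt (by
        rw [ENNReal.ofReal_toReal hE]
        gcongr
        exact localEnergy_mono le_rfl hx.2)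
    rw [hH0 _ (h1 0 (by norm_num)), zero_sub, norm_neg, hH2 _ h2] at h3
    simp only [mul_zero, zero_add]
    rw [← ENNReal.ofReal_toReal hE, ← ENNReal.ofReal_mul (by
      have : 0 < y 1 - y 0 := sub_pos.2 hy01
      positivity), show (2:ℝ≥0∞) = ENNReal.ofReal 2 by simp]
    refine ENNReal.ofReal_le_ofReal (h3.trans ?_)
    have hx1 : x ≤ y 1 := hx.2
    have : 0 ≤ x - y 0 := by linarith
    gcongr

/-- Serves for `⌊s⌋ = k + 1`, with the fractional energy and the `Lᵖ` norm of the top derivative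
treated side by side. -/
theorem weakDeriv_winding_lower_bound {p : ℝ} (hp : 1 ≤ p) (k : ℕ) {σ : ℝ} (hσ : 0 ≤ σ)
    (hsp : 1 ≤ (k + 1 + σ) * p) :
    ∃ K : ℝ, 0 < K ∧ ∀ (ψ : ℝ → ℝ) (d : ℕ) (H : ℝ → ℂ) (u v : Circle → ℂ), Continuous ψ → 0 < d →
      (∀ θ, ψ (θ + 2 * Real.pi) = ψ θ + 2 * Real.pi * d) → Continuous H →
      (∀ θ, Circle.exp (ψ θ) = 1 → H θ = 0) →
      (∀ θ, Circle.exp (ψ θ) = Circle.exp Real.pi → ‖H θ‖ = 2) →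
      (∀ᵐ t : ℝ, u (Circle.exp t) = H t) → HasWeakDeriv (k + 1) u v →
      (ENNReal.ofReal ((d : ℝ) ^ ((k + 1 + σ) * p)) ≤
        ENNReal.ofReal K * gagliardo σ p v ^ p) ∧
      (σ = 0 → ENNReal.ofReal ((d : ℝ) ^ ((k + 1 + σ) * p)) ≤
        ENNReal.ofReal K * eLpNorm v (ENNReal.ofReal p) arcLength ^ p) := by
  have hp0 : 0 < p := by linarith
  have hπ := Real.pi_pos
  set M : ℕ := 2 * k + 1 with hM
  have hM0 : (0:ℝ) < M := by rw [hM]; positivity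
  have hM1 : (1:ℝ) ≤ M := by rw [hM]; push_cast; linarith [k.cast_nonneg (α := ℝ)]
  set s : ℝ := k + 1 + σ with hs
  set K₀ : ℝ := 2 * (2 * ((M : ℝ) * (2 * Real.pi))) ^ (s * p - 1) * (1 / 2) ^ p with hK₀
  have hK₀pos : 0 < K₀ := by positivity
  have hqp : (s * p - 1) / p = s - 1 / p := by field_simp
  -- The double integral sees the window of `M` turns in both variables, which costs `M²`; the `Lᵖ`
  -- norm would only cost `M`.
  refine ⟨K₀ * M ^ 2, by positivity, ?_⟩
  intro ψ d H u v hψ hd hψd hH hH0 hH2 hu huv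
  obtain ⟨w, hw, hvw, huw⟩ := huv.exists_measurable
  obtain ⟨U, hU, hUV, hUc, hUae⟩ := huw.exists_derivative_chain
  -- Zeros are pointwise information, so the regular representative must equal `H` everywhere; both
  -- are continuous.
  have hUH : U 0 = H := by
    refine Measure.eq_of_ae_eq (μ := volume) ?_ hUc hH
    filter_upwards [hu, hUae] with t h1 h2
    rw [← h1, ← h2]
  set W : ℝ → ℂ := fun t => w (Circle.exp t) with hW
  have hWm : Measurable W := hw.comp Circle.exp.continuous.measurable
  have hWi : ∀ a b, IntervalIntegrable W volume a b :=
    intervalIntegrable_exp_of_integrable huw.2.1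
  have hy0 : ∀ y : ℕ → ℝ, (∀ i < 2 * k + 1, y i < y (i + 1)) → y 0 < y (2 * k + 1) := by
    intro y hy
    have : ∀ j ≤ 2 * k, y 0 < y (j + 1) := by
      intro j
      induction j with
      | zero => intro _; exact hy 0 (by omega)
      | succ j ih => intro hj; exact (ih (by omega)).trans (hy (j + 1) (by omega))
    exact this _ le_rfl
  have hs1 : 1 + (s * p - 1) = s * p := by ring
  have h2 : ∀ x, Circle.exp (ψ x) = Circle.exp Real.pi → ‖U 0 x‖ₑ = 2 := by
    intro x hx
    rw [← ofReal_norm, hUH, hH2 x hx]; simp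
  constructor
  · rw [gagliardo_congr_ae hvw]
    have key := rpow_winding_le_energy hψ (k := k) hd hψd (E := localEnergy σ p W)
      (T := M * (M * gagliardo σ p w ^ p)) (C := 1) (q := s * p - 1) (p := p)
      one_pos (by linarith) hp0 (fun a Y n ha hY hb =>
        (sum_localEnergy_le ha hY hb).trans (lintegral_window_energy_le hσ hp0 w a M)) ?_
    · rw [hs1] at key
      refine key.trans_eq ?_
      rw [ENNReal.ofReal_mul hK₀pos.le, ENNReal.ofReal_pow hM0.le, ENNReal.ofReal_natCast]
      ring
    · intro y x hy h1 hx hx2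
      have := enorm_le_of_zeros_of_fract_pos hσ hp hWm hWi hU hUV hy (hy0 y hy)
        (fun i hi => by rw [hUH]; exact hH0 _ (h1 i hi)) hx
      rw [h2 x hx2] at this
      rwa [hqp, one_mul]
  · intro hσ0
    have hcongr : eLpNorm v (ENNReal.ofReal p) arcLength =
      eLpNorm w (ENNReal.ofReal p) arcLength := eLpNorm_congr_ae hvw
    rw [hcongr, eLpNorm_rpow_eq hp0]
    have key := rpow_winding_le_energy hψ (k := k) hd hψd
      (E := fun a b => ∫⁻ t in Set.Ioc a b, ‖W t‖ₑ ^ p)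
      (T := M * ∫⁻ z, ‖w z‖ₑ ^ p ∂arcLength) (C := 1) (q := s * p - 1) (p := p)
      one_pos (by linarith) hp0 (fun a Y n ha hY hb => ?_) ?_
    · rw [hs1] at key
      refine key.trans ?_
      rw [← mul_assoc, ← ENNReal.ofReal_natCast M, ← ENNReal.ofReal_mul (by positivity)]
      gcongr
      rw [pow_two]
      nlinarith
    · rw [(sum_lintegral_Ioc_eq _ hY).2]
      exact (lintegral_mono_set (Set.Ioc_subset_Ioc ha hb)).trans_eq
        (lintegral_window a M fun z => ‖w z‖ₑ ^ p)
    · intro y x hy h1 hx hx2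
      have := enorm_le_of_zeros_of_fract_eq_zero hp hWm hWi hU hUV hy (hy0 y hy)
        (fun i hi => by rw [hUH]; exact hH0 _ (h1 i hi)) hx
      rw [h2 x hx2] at this
      rwa [hqp, one_mul, hs, hσ0, add_zero]

theorem sobolevSemidist_lower_bound {s p : ℝ} (hs : 0 < s) (hp : 1 ≤ p) (hsp : 1 < s * p) :
    ∃ C : ℝ, 0 < C ∧ ∀ (d₁ d₂ : ℤ), ∀ f ∈ degreeClass s p d₁, ∀ g ∈ degreeClass s p d₂,
      ENNReal.ofReal (C * |(d₁ : ℝ) - d₂| ^ s) ≤ sobolevSemidist s p f g := by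
  have hp0 : 0 < p := by linarith
  obtain ⟨C, hC, hbound⟩ : ∃ C : ℝ, 0 < C ∧ ∀ (ψ : ℝ → ℝ) (d : ℕ) (H : ℝ → ℂ) (u : Circle → ℂ),
      Continuous ψ → 0 < d →
      (∀ θ, ψ (θ + 2 * Real.pi) = ψ θ + 2 * Real.pi * d) → Continuous H →
      (∀ θ, Circle.exp (ψ θ) = 1 → H θ = 0) →
      (∀ θ, Circle.exp (ψ θ) = Circle.exp Real.pi → ‖H θ‖ = 2) →
      (∀ᵐ t : ℝ, u (Circle.exp t) = H t) →
      ENNReal.ofReal (C * (d : ℝ) ^ s) ≤ sobolevSeminorm s p u := by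
    rcases hm : ⌊s⌋₊ with _ | k
    · obtain ⟨K, hK, h⟩ := gagliardo_winding_lower_bound hs hp hsp
      refine ⟨K ^ (-(1 / p)), by positivity, ?_⟩
      intro ψ d H u hψ hd hψd hH hH0 hH2 hu
      have hfr := fract_eq_self_of_natFloor_eq_zero hs.le hm
      unfold sobolevSeminorm
      rw [hfr, if_neg hs.ne', hm]
      refine le_iInf₂ fun v hv => ofReal_mul_rpow_le_of_rpow_le hp0 hK d.cast_nonneg ?_
      refine h ψ d H v hψ hd hψd hH hH0 hH2 ?_
      filter_upwards [hu, ae_exp_of_ae_arcLength hv.ae_eq] with t h1 h2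
      rw [← h2, h1]
    · have hsk : (k:ℝ) + 1 + Int.fract s = s := by
        have h1 := Int.floor_add_fract s
        rw [← Int.natCast_floor_eq_floor hs.le, hm] at h1
        push_cast at h1
        exact h1
      obtain ⟨K, hK, h⟩ := weakDeriv_winding_lower_bound hp k (Int.fract_nonneg s) (by
        rw [hsk]; exact hsp.le)
      rw [hsk] at h
      refine ⟨K ^ (-(1 / p)), by positivity, ?_⟩
      intro ψ d H u hψ hd hψd hH hH0 hH2 hu
      unfold sobolevSeminorm weakDerivLpNorm
      rw [hm]
      split_ifs with hfr
      · exact le_iInf₂ fun v hv => ofReal_mul_rpow_le_of_rpow_le hp0 hK d.cast_nonneg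
          ((h ψ d H u v hψ hd hψd hH hH0 hH2 hu hv).2 hfr)
      · exact le_iInf₂ fun v hv => ofReal_mul_rpow_le_of_rpow_le hp0 hK d.cast_nonneg
          (h ψ d H u v hψ hd hψd hH hH0 hH2 hu hv).1
  refine ⟨C, hC, fun d₁ d₂ f hf g hg => ?_⟩
  have hsemi : ∀ u : Circle → ℂ, sobolevNorm s p u < ⊤ → sobolevSeminorm s p u < ⊤ := fun u hu =>
    lt_of_le_of_lt (by unfold sobolevNorm; exact le_add_self) hu
  obtain ⟨F, hF, hfF⟩ := exists_continuous_of_sobolevSeminorm_lt_top hs hp hsp (hsemi _ hf.1)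
  obtain ⟨G, hG, hgG⟩ := exists_continuous_of_sobolevSeminorm_lt_top hs hp hsp (hsemi _ hg.1)
  obtain ⟨φ₁, hφ₁, hFφ, hφ₁d⟩ := hf.2.exists_lift hF hfF
  obtain ⟨φ₂, hφ₂, hGφ, hφ₂d⟩ := hg.2.exists_lift hG hgG
  have hae : ∀ᵐ t : ℝ, (f (Circle.exp t) : ℂ) - (g (Circle.exp t) : ℂ) = F t - G t := by
    filter_upwards [hfF, hgG] with t h1 h2
    rw [h1, h2]
  have hpi2 : ∀ a b : ℝ, Circle.exp (a - b) = Circle.exp Real.pi →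
      ‖(Circle.exp a : ℂ) - Circle.exp b‖ = 2 := by
    intro a b hab
    have : Circle.exp a = Circle.exp Real.pi * Circle.exp b := by
      rw [← hab, ← Circle.exp_add]; congr 1; ring
    rw [this, Circle.coe_mul, Circle.coe_exp Real.pi, Complex.exp_pi_mul_I,
      show -1 * (Circle.exp b : ℂ) - Circle.exp b = -2 * Circle.exp b by ring, norm_mul]
    simp
  have hone : ∀ a b : ℝ, Circle.exp (a - b) = 1 → Circle.exp a = Circle.exp b := by
    intro a b hab
    rw [show a = (a - b) + b by ring, Circle.exp_add, hab, one_mul]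
  -- The lifts are subtracted in the order that makes the winding of the difference positive.
  rcases lt_trichotomy d₁ d₂ with hlt | heq | hlt
  · obtain ⟨n, hn⟩ := Int.eq_ofNat_of_zero_le (sub_nonneg.2 hlt.le)
    have habs : |(d₁:ℝ) - d₂| = n := by
      have : ((d₂ - d₁ : ℤ) : ℝ) = n := by rw [hn]; simp
      push_cast at this
      rw [abs_sub_comm, this, abs_of_nonneg n.cast_nonneg]
    rw [habs]
    refine hbound (fun θ => φ₂ θ - φ₁ θ) n (fun θ => F θ - G θ) _ (hφ₂.sub hφ₁) (by omega) ?_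
      (hF.sub hG) ?_ ?_ hae
    · intro θ
      have : ((d₂ - d₁ : ℤ) : ℝ) = n := by rw [hn]; simp
      push_cast at this
      simp only [hφ₁d, hφ₂d, ← this]; ring
    · intro θ h
      rw [hFφ, hGφ, hone _ _ h, sub_self]
    · intro θ h
      rw [hFφ, hGφ, norm_sub_rev, hpi2 _ _ h]
  · have : |(d₁:ℝ) - d₂| = 0 := by rw [heq]; simp
    rw [this, Real.zero_rpow hs.ne']; simp
  · obtain ⟨n, hn⟩ := Int.eq_ofNat_of_zero_le (sub_nonneg.2 hlt.le)
    have hn' : (d₁:ℝ) - d₂ = n := by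
      have : ((d₁ - d₂ : ℤ) : ℝ) = n := by rw [hn]; simp
      push_cast at this
      exact this
    rw [hn', abs_of_nonneg n.cast_nonneg]
    refine hbound (fun θ => φ₁ θ - φ₂ θ) n (fun θ => F θ - G θ) _ (hφ₁.sub hφ₂) (by omega) ?_
      (hF.sub hG) ?_ ?_ hae
    · intro θ
      simp only [hφ₁d, hφ₂d, ← hn']; ring
    · intro θ h
      rw [hFφ, hGφ, hone _ _ h, sub_self]
    · intro θ h
      rw [hFφ, hGφ, hpi2 _ _ h]

end LowerBound

/-! ### Constants and the leading semi-norm. -/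

section ConstantShift

/-- A derivative of positive order of a periodic test function has zero mean and does not see the
constant; at order zero the constant must be restored. -/
theorem HasWeakDeriv.of_sub_const {k : ℕ} {u v : Circle → ℂ} {c : ℂ}
    (h : HasWeakDeriv k (fun z => u z - c) v) :
    HasWeakDeriv k u (fun z => v z + if k = 0 then c else 0) := by
  have hu : Integrable u arcLength := by
    refine (h.1.add (integrable_const c)).congr (ae_of_all _ fun z => ?_)
    simp
  refine ⟨hu, h.2.1.add (integrable_const _), fun φ hφ hφp => ?_⟩
  have h1 := h.2.2 φ hφ hφp
  have hc : Continuous (iteratedDeriv k φ) := (contDiff_iteratedDeriv hφ k).continuous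
  have hui := intervalIntegrable_exp_of_integrable hu (-Real.pi) Real.pi
  have hvi := intervalIntegrable_exp_of_integrable h.2.1 (-Real.pi) Real.pi
  have hconst : ∀ (ψ : ℝ → ℝ) (e : ℂ), Continuous ψ →
      IntervalIntegrable (fun t => ψ t • e) volume (-Real.pi) Real.pi := fun ψ e hψ =>
    (hψ.smul continuous_const).intervalIntegrable _ _
  simp only [smul_sub] at h1
  rw [intervalIntegral.integral_sub (hui.continuousOn_smul hc.continuousOn) (hconst _ _ hc),
    intervalIntegral.integral_smul_const, sub_eq_iff_eq_add] at h1
  simp only [smul_add]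
  rw [intervalIntegral.integral_add (hvi.continuousOn_smul hφ.continuous.continuousOn)
    (hconst _ _ hφ.continuous), intervalIntegral.integral_smul_const, h1, mul_add]
  congr 1
  rcases k with _ | k
  · simp
  · have h0 : ∫ t in (-Real.pi)..Real.pi, iteratedDeriv (k + 1) φ t = 0 := by
      rw [iteratedDeriv_succ]
      have hp := periodic_iteratedDeriv hφp k (-Real.pi)
      rw [show -Real.pi + 2 * Real.pi = Real.pi by ring] at hp
      have hd := contDiff_infty_iff_deriv.1 (contDiff_iteratedDeriv hφ k)
      rw [intervalIntegral.integral_deriv_eq_sub (fun x _ => hd.1 x)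
        (hd.2.continuous.intervalIntegrable _ _), hp, sub_self]
    simp [h0]

theorem sobolevSeminorm_le_sub_const {s p : ℝ} (hs : 0 < s) (u : Circle → ℂ) (c : ℂ) :
    sobolevSeminorm s p u ≤ sobolevSeminorm s p (fun z => u z - c) := by
  unfold sobolevSeminorm weakDerivLpNorm
  split_ifs with hfr
  · have hfl : ⌊s⌋₊ ≠ 0 := fun h0 => by
      rw [fract_eq_self_of_natFloor_eq_zero hs.le h0] at hfr
      exact hs.ne' hfr
    refine le_iInf₂ fun v hv => ?_
    have := hv.of_sub_const
    simp only [hfl, if_false, add_zero] at this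
    exact iInf₂_le v this
  · refine le_iInf₂ fun v hv => (iInf₂_le _ hv.of_sub_const).trans_eq ?_
    unfold gagliardo
    simp only [add_sub_add_right_eq_sub]

theorem sobolevSemidist_le_sobolevDist {s : ℝ} (hs : 0 < s) (p : ℝ) (f g : Circle → Circle) :
    sobolevSemidist s p f g ≤ sobolevDist s p f g :=
  (sobolevSeminorm_le_sub_const hs _ _).trans (by
    unfold sobolevDist sobolevNorm
    exact le_add_self)

end ConstantShift

/-! ### Classical derivatives as weak derivatives. -/

section SmoothMaps

theorem integral_iteratedDeriv_smul_eq {U : ℝ → ℂ} (hU : ContDiff ℝ ∞ U)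
    (hUp : Function.Periodic U (2 * Real.pi)) (k : ℕ) {φ : ℝ → ℝ} (hφ : ContDiff ℝ ∞ φ)
    (hφp : Function.Periodic φ (2 * Real.pi)) :
    ∫ t in (-Real.pi)..Real.pi, iteratedDeriv k φ t • U t =
      (-1) ^ k * ∫ t in (-Real.pi)..Real.pi, φ t • iteratedDeriv k U t := by
  induction k generalizing φ with
  | zero => simp
  | succ k ih =>
    have hUk := contDiff_infty_iff_deriv.1 (contDiff_iteratedDeriv hU k)
    have hcont : Continuous (deriv (iteratedDeriv k U)) := hUk.2.continuous
    have hprim : ∀ x y, ∫ t in x..y, deriv (iteratedDeriv k U) t =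
        iteratedDeriv k U y - iteratedDeriv k U x := fun x y =>
      intervalIntegral.integral_deriv_eq_sub (fun t _ => hUk.1 t)
        (hcont.intervalIntegrable _ _)
    have hper := periodic_iteratedDeriv hUp k (-Real.pi)
    rw [show -Real.pi + 2 * Real.pi = Real.pi by ring] at hper
    have h1 := integral_deriv_smul_primitive_periodic (V := deriv (iteratedDeriv k U))
      (fun a b => hcont.intervalIntegrable a b) (by rw [hprim, hper, sub_self])
      (iteratedDeriv k U 0) hφ hφp
    simp only [hprim, add_sub_cancel] at h1
    rw [iteratedDeriv_succ', ih (contDiff_infty_iff_deriv.1 hφ).2 (periodic_deriv hφp), h1,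
      iteratedDeriv_succ, pow_succ]
    ring

theorem integrable_arg_of_continuous {P : ℝ → ℂ} (hP : Continuous P) :
    Integrable (fun z : Circle => P (Complex.arg z)) arcLength := by
  have h : IntegrableOn P (Set.Ioc (-Real.pi) Real.pi) volume :=
    (hP.integrableOn_Icc).mono_set Set.Ioc_subset_Icc_self
  exact (measurePreserving_arg_arcLength.integrable_comp h.aestronglyMeasurable).2 h

theorem hasWeakDeriv_of_contDiff {u : Circle → ℂ}
    (hu : ContDiff ℝ ∞ fun t : ℝ => u (Circle.exp t)) (k : ℕ) :
    HasWeakDeriv k u fun z => iteratedDeriv k (fun t : ℝ => u (Circle.exp t)) (Complex.arg z) := by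
  have hp : Function.Periodic (fun t : ℝ => u (Circle.exp t)) (2 * Real.pi) := fun t => by
    simp only [Circle.exp_add_two_pi]
  have hk := contDiff_iteratedDeriv hu k
  refine ⟨?_, integrable_arg_of_continuous hk.continuous, fun φ hφ hφp => ?_⟩
  · have := integrable_arg_of_continuous hu.continuous
    simpa only [Circle.exp_arg] using this
  · simp_rw [(periodic_iteratedDeriv hp k).apply_arg_exp]
    exact integral_iteratedDeriv_smul_eq hu hp k hφ hφp

theorem weakDerivLpNorm_le_of_norm_le {k : ℕ} {p : ℝ} {u v : Circle → ℂ}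
    (h : HasWeakDeriv k u v) {A : ℝ} (hA : ∀ z, ‖v z‖ ≤ A) :
    weakDerivLpNorm k p u ≤
      ENNReal.ofReal (2 * Real.pi) ^ ((ENNReal.ofReal p).toReal⁻¹) * ENNReal.ofReal A := by
  refine (iInf₂_le v h).trans ?_
  have := eLpNorm_le_of_ae_bound (μ := arcLength) (p := ENNReal.ofReal p) (f := v) (C := A)
    (ae_of_all _ hA)
  rwa [arcLength_univ] at this

end SmoothMaps

/-! ### Singular kernels on the line and on the circle. -/

section Kernels

theorem lintegral_comp_abs' (Φ : ℝ → ℝ≥0∞) :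
    ∫⁻ t : ℝ, Φ |t| = 2 * ∫⁻ t in Set.Ioi (0:ℝ), Φ t := by
  have h1 : ∫⁻ t in Set.Ioi (0:ℝ), Φ |t| = ∫⁻ t in Set.Ioi (0:ℝ), Φ t :=
    setLIntegral_congr_fun measurableSet_Ioi fun t ht => by
      simp only [abs_of_pos (Set.mem_Ioi.1 ht)]
  have h2 : ∫⁻ t in Set.Iio (0:ℝ), Φ |t| = ∫⁻ t in Set.Ioi (0:ℝ), Φ |t| := by
    have := (Measure.measurePreserving_neg (volume : Measure ℝ)).setLIntegral_comp_emb
      (MeasurableEquiv.neg ℝ).measurableEmbedding (fun t => Φ |t|) (Set.Iio (0:ℝ))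
    simpa using this
  rw [← setLIntegral_univ, ← Set.Iic_union_Ioi (a := (0:ℝ)), lintegral_union measurableSet_Ioi
    (Set.Iic_disjoint_Ioi le_rfl), setLIntegral_congr Iio_ae_eq_Iic.symm, h2, h1, two_mul]

theorem lintegral_Ioc_rpow {X r : ℝ} (hX : 0 < X) (hr : -1 < r) :
    ∫⁻ t in Set.Ioc 0 X, ENNReal.ofReal (t ^ r) = ENNReal.ofReal (X ^ (r + 1) / (r + 1)) := by
  have hi : IntegrableOn (fun t : ℝ => t ^ r) (Set.Ioc 0 X) volume :=
    (intervalIntegrable_iff_integrableOn_Ioc_of_le hX.le).1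
      (intervalIntegral.intervalIntegrable_rpow' hr)
  rw [← ofReal_integral_eq_lintegral_ofReal hi, ← intervalIntegral.integral_of_le hX.le,
    integral_rpow (Or.inl hr), Real.zero_rpow (by linarith), sub_zero]
  filter_upwards [ae_restrict_mem measurableSet_Ioc] with t ht
  exact Real.rpow_nonneg ht.1.le r

theorem lintegral_Ioi_rpow {X r : ℝ} (hX : 0 < X) (hr : r < -1) :
    ∫⁻ t in Set.Ioi X, ENNReal.ofReal (t ^ r) = ENNReal.ofReal (-X ^ (r + 1) / (r + 1)) := by
  rw [← ofReal_integral_eq_lintegral_ofReal (integrableOn_Ioi_rpow_of_lt hr hX),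
    integral_Ioi_rpow_of_lt hr hX]
  filter_upwards [ae_restrict_mem measurableSet_Ioi] with t ht
  exact Real.rpow_nonneg (hX.trans ht).le r

/-- The integral of a singular kernel against a function that is small near the singularity. -/
theorem lintegral_kernel_le {κ e₁ e₂ X C : ℝ} (hX : 0 < X) (hC : 0 ≤ C) (h1 : κ < e₁) (h2 : e₂ < κ)
    {g : ℝ → ℝ} (hg1 : ∀ t ∈ Set.Ioc 0 X, g t ≤ (t / X) ^ e₁)
    (hg2 : ∀ t ∈ Set.Ioi X, g t ≤ C * (t / X) ^ e₂) :
    ∫⁻ t in Set.Ioi (0:ℝ), ENNReal.ofReal (g t / t ^ (1 + κ)) ≤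
      ENNReal.ofReal (X ^ (-κ) * (1 / (e₁ - κ) + C / (κ - e₂))) := by
  -- Split at the scale `X`: `κ < e₁` makes the integral converge at 0, and `e₂ < κ` at infinity.
  rw [← Set.Ioc_union_Ioi_eq_Ioi hX.le, lintegral_union measurableSet_Ioi
    (Set.Ioc_disjoint_Ioi le_rfl), mul_add, ENNReal.ofReal_add
      (mul_nonneg (by positivity) (one_div_nonneg.2 (by linarith)))
      (mul_nonneg (by positivity) (div_nonneg hC (by linarith)))]
  gcongr
  · calc _ ≤ ∫⁻ t in Set.Ioc 0 X, ENNReal.ofReal (X ^ (-e₁)) *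
          ENNReal.ofReal (t ^ (e₁ - (1 + κ))) := by
          refine setLIntegral_mono' measurableSet_Ioc fun t ht => ?_
          rw [← ENNReal.ofReal_mul (by positivity)]
          refine ENNReal.ofReal_le_ofReal ?_
          rw [Real.rpow_sub ht.1, Real.rpow_neg hX.le, ← mul_div_assoc]
          have := hg1 t ht
          rw [Real.div_rpow ht.1.le hX.le] at this
          have h3 := Real.rpow_nonneg ht.1.le (1 + κ)
          gcongr
          rwa [inv_mul_eq_div]
      _ = _ := by
          rw [lintegral_const_mul' _ _ ENNReal.ofReal_ne_top, lintegral_Ioc_rpow hX (by linarith),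
            ← ENNReal.ofReal_mul (by positivity)]
          congr 1
          rw [show e₁ - (1 + κ) + 1 = e₁ - κ by ring, Real.rpow_neg hX.le, Real.rpow_neg hX.le,
            Real.rpow_sub hX]
          field_simp
  · calc _ ≤ ∫⁻ t in Set.Ioi X, ENNReal.ofReal (C * X ^ (-e₂)) *
          ENNReal.ofReal (t ^ (e₂ - (1 + κ))) := by
          refine setLIntegral_mono' measurableSet_Ioi fun t ht => ?_
          have ht0 : 0 < t := hX.trans ht
          rw [← ENNReal.ofReal_mul (by positivity)]
          refine ENNReal.ofReal_le_ofReal ?_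
          rw [Real.rpow_sub ht0, Real.rpow_neg hX.le, ← mul_div_assoc]
          have := hg2 t ht
          rw [Real.div_rpow ht0.le hX.le] at this
          have h3 := Real.rpow_nonneg ht0.le (1 + κ)
          gcongr
          rwa [mul_assoc, inv_mul_eq_div]
      _ = _ := by
          rw [lintegral_const_mul' _ _ ENNReal.ofReal_ne_top, lintegral_Ioi_rpow hX (by linarith),
            ← ENNReal.ofReal_mul (by positivity)]
          congr 1
          have h4 : κ - e₂ ≠ 0 := by linarith
          have h5 : e₂ - κ ≠ 0 := by linarith
          rw [show e₂ - (1 + κ) + 1 = e₂ - κ by ring, Real.rpow_neg hX.le, Real.rpow_neg hX.le,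
            Real.rpow_sub hX]
          have h6 : e₂ - κ = -(κ - e₂) := by ring
          rw [h6]
          field_simp

theorem mul_abs_le_norm_circle_exp_sub {x y : ℝ} (h : |x - y| ≤ Real.pi) :
    2 / Real.pi * |x - y| ≤ ‖(Circle.exp x : ℂ) - (Circle.exp y : ℂ)‖ := by
  rw [norm_circle_exp_sub]
  have h1 : 2 / Real.pi * (|x - y| / 2) ≤ Real.sin (|x - y| / 2) :=
    Real.mul_le_sin (by positivity) (by linarith)
  have h2 : Real.sin (|x - y| / 2) ≤ |Real.sin ((x - y) / 2)| := by
    rcases abs_cases (x - y) with ⟨h, -⟩ | ⟨h, -⟩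
    · rw [h]; exact le_abs_self _
    · rw [h, neg_div, Real.sin_neg]; exact neg_le_abs _
  linarith

theorem div_enorm_circle_exp_rpow_le {e A x t : ℝ} (he : 0 ≤ e) (hA : 0 ≤ A) (hxt : x ≠ t)
    (h : |x - t| ≤ Real.pi) :
    ENNReal.ofReal A / ‖(Circle.exp x : ℂ) - (Circle.exp t : ℂ)‖ₑ ^ e ≤
      ENNReal.ofReal ((Real.pi / 2) ^ e * (A / |x - t| ^ e)) := by
  have hpos : 0 < |x - t| := abs_pos.2 (sub_ne_zero.2 hxt)
  have h1 := mul_abs_le_norm_circle_exp_sub h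
  have h2 : 0 < 2 / Real.pi * |x - t| := by have := Real.pi_pos; positivity
  have hch : 0 < ‖(Circle.exp x : ℂ) - (Circle.exp t : ℂ)‖ := h2.trans_le h1
  rw [← ofReal_norm, ENNReal.ofReal_rpow_of_pos hch, ← ENNReal.ofReal_div_of_pos (by positivity)]
  refine ENNReal.ofReal_le_ofReal ?_
  calc A / ‖(Circle.exp x : ℂ) - (Circle.exp t : ℂ)‖ ^ e ≤ A / (2 / Real.pi * |x - t|) ^ e := by
        gcongr
    _ = _ := by
        rw [Real.mul_rpow (by positivity) hpos.le, show Real.pi / 2 = (2 / Real.pi)⁻¹ by simp,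
          Real.inv_rpow (by positivity)]
        field_simp

/-- The constant in the estimate of the Gagliardo energy of a Lipschitz map. -/
noncomputable def kernelConst (σ p : ℝ) : ℝ :=
  2 * ((Real.pi / 2) ^ (1 + σ * p) * (1 / (p - σ * p) + 1 / (σ * p)))

/-- Below the scale `X` the linear bound beats the singularity, beyond it boundedness suffices: this
is `lintegral_kernel_le` with `κ = σp`, `e₁ = p`, `e₂ = 0`. Replacing chords by angles costs a power
of `π/2`. -/
theorem lintegral_circle_kernel_le {σ p D X θ : ℝ} (hσ : 0 < σ) (hσ1 : σ < 1) (hp : 0 < p)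
    (hD : 0 ≤ D) (hX : 0 < X) {N : Circle → ℝ≥0∞}
    (hN : ∀ t, |θ - t| ≤ Real.pi → N (Circle.exp t) ≤ ENNReal.ofReal (D * min (|θ - t| / X) 1)) :
    ∫⁻ w, N w ^ p / ‖(Circle.exp θ : ℂ) - (w : ℂ)‖ₑ ^ (1 + σ * p) ∂arcLength ≤
      ENNReal.ofReal (kernelConst σ p * (D * X ^ (-σ)) ^ p) := by
  have hσp : 0 < σ * p := mul_pos hσ hp
  have hσp' : σ * p < p := by nlinarith
  have hπ := Real.pi_pos
  set Φ : ℝ → ℝ≥0∞ := fun τ => ENNReal.ofReal ((Real.pi / 2) ^ (1 + σ * p) * D ^ p) *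
    ENNReal.ofReal ((min (τ / X) 1) ^ p / τ ^ (1 + σ * p)) with hΦ
  rw [lintegral_arcLength (θ - Real.pi)]
  calc _ ≤ ∫⁻ t in Set.Ioc (θ - Real.pi) (θ - Real.pi + 2 * Real.pi), Φ |t - θ| := by
        refine lintegral_mono_ae ?_
        have hne : ∀ᵐ t ∂volume.restrict (Set.Ioc (θ - Real.pi) (θ - Real.pi + 2 * Real.pi)),
          t ≠ θ := ae_restrict_of_ae (Measure.ae_ne volume θ)
        filter_upwards [ae_restrict_mem measurableSet_Ioc, hne] with t ht hne
        have habs : |θ - t| ≤ Real.pi := abs_le.2 ⟨by linarith [ht.2], by linarith [ht.1]⟩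
        have hmin : 0 ≤ min (|θ - t| / X) 1 := by positivity
        calc _ ≤ ENNReal.ofReal ((D * min (|θ - t| / X) 1) ^ p) /
              ‖(Circle.exp θ : ℂ) - (Circle.exp t : ℂ)‖ₑ ^ (1 + σ * p) := by
              gcongr
              rw [← ENNReal.ofReal_rpow_of_nonneg (by positivity) hp.le]
              have := hN t habs
              gcongr
          _ ≤ _ := div_enorm_circle_exp_rpow_le (by positivity) (by positivity) hne.symm habs
          _ = Φ |t - θ| := by
              simp only [hΦ]
              rw [← ENNReal.ofReal_mul (by positivity), Real.mul_rpow hD hmin,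
                abs_sub_comm t θ]
              congr 1; ring
    _ ≤ ∫⁻ t, Φ |t - θ| := setLIntegral_le_lintegral _ _
    _ = ∫⁻ t, Φ |t| := lintegral_sub_right_eq_self (fun t => Φ |t|) θ
    _ = 2 * ∫⁻ t in Set.Ioi (0:ℝ), Φ t := lintegral_comp_abs' Φ
    _ ≤ 2 * (ENNReal.ofReal ((Real.pi / 2) ^ (1 + σ * p) * D ^ p) *
          ENNReal.ofReal (X ^ (-(σ * p)) * (1 / (p - σ * p) + 1 / (σ * p - 0)))) := by
        rw [hΦ, lintegral_const_mul' _ _ ENNReal.ofReal_ne_top]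
        gcongr
        refine lintegral_kernel_le hX zero_le_one hσp' hσp (fun t ht => ?_) fun t ht => ?_
        · have : 0 ≤ t / X := by have := ht.1; positivity
          gcongr
          exact min_le_left _ _
        · have ht' : X < t := ht
          have : 1 ≤ t / X := (one_le_div hX).2 ht'.le
          rw [min_eq_right this]; simp
    _ = _ := by
        rw [← ENNReal.ofReal_mul (by positivity), show (2:ℝ≥0∞) = ENNReal.ofReal 2 by simp,
          ← ENNReal.ofReal_mul (by positivity), kernelConst, Real.mul_rpow hD (by positivity),
          ← Real.rpow_mul hX.le, sub_zero, neg_mul]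
        congr 1; ring

theorem kernelConst_pos {σ p : ℝ} (hσ : 0 < σ) (hσ1 : σ < 1) (hp : 0 < p) :
    0 < kernelConst σ p := by
  have h1 : 0 < p - σ * p := by nlinarith
  have := Real.pi_pos
  unfold kernelConst
  positivity

/-- Interpolation in elementary form: an oscillation of size `D` at scale `X` has semi-norm of order
`D X^(-σ)`. -/
theorem gagliardo_le_of_norm_sub_le {σ p D X : ℝ} (hσ : 0 < σ) (hσ1 : σ < 1) (hp : 0 < p)
    (hD : 0 ≤ D) (hX : 0 < X) {v : Circle → ℂ}
    (hv : ∀ x y : ℝ, ‖v (Circle.exp x) - v (Circle.exp y)‖ ≤ D * min (|x - y| / X) 1) :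
    gagliardo σ p v ≤
      ENNReal.ofReal ((2 * Real.pi * kernelConst σ p) ^ (1 / p) * (D * X ^ (-σ))) := by
  have hk := kernelConst_pos hσ hσ1 hp
  have hπ := Real.pi_pos
  have h1 : gagliardo σ p v ^ p ≤
      ENNReal.ofReal ((2 * Real.pi * kernelConst σ p) * (D * X ^ (-σ)) ^ p) := by
    rw [gagliardo_rpow hp]
    calc _ ≤ ∫⁻ _, ENNReal.ofReal (kernelConst σ p * (D * X ^ (-σ)) ^ p) ∂arcLength := by
          refine lintegral_mono fun x => ?_
          obtain ⟨θ, rfl⟩ := Circle.exp_surjective x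
          refine lintegral_circle_kernel_le hσ hσ1 hp hD hX
            (N := fun w => ‖v (Circle.exp θ) - v w‖ₑ) fun t _ => ?_
          rw [← ofReal_norm]
          exact ENNReal.ofReal_le_ofReal (hv θ t)
      _ = _ := by
          rw [lintegral_const, arcLength_univ, ← ENNReal.ofReal_mul (by positivity)]
          congr 1; ring
  have h2 := ENNReal.rpow_le_rpow h1 (show 0 ≤ 1 / p by positivity)
  rw [← ENNReal.rpow_mul, mul_one_div_cancel hp.ne', ENNReal.rpow_one,
    ENNReal.ofReal_rpow_of_nonneg (by positivity) (by positivity),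
    Real.mul_rpow (by positivity) (by positivity), ← Real.rpow_mul (by positivity),
    mul_one_div_cancel hp.ne', Real.rpow_one] at h2
  exact h2

end Kernels

/-! ### Sobolev norms of smooth maps with geometrically growing derivatives. -/

section SmoothUpperBound

theorem weakDerivLpNorm_le_of_contDiff {p : ℝ} (hp : 0 < p) {s : ℝ} {u : Circle → ℂ}
    (hu : ContDiff ℝ ∞ fun t : ℝ => u (Circle.exp t)) {K N : ℝ} (hK : 0 ≤ K) (hN : 1 ≤ N) {j : ℕ}
    (hj : (j : ℝ) ≤ s)
    (hb : ∀ θ, ‖iteratedDeriv j (fun t : ℝ => u (Circle.exp t)) θ‖ ≤ K * N ^ j) :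
    weakDerivLpNorm j p u ≤ ENNReal.ofReal ((2 * Real.pi) ^ p⁻¹ * (K * N ^ s)) := by
  have hπ := Real.pi_pos
  refine (weakDerivLpNorm_le_of_norm_le (hasWeakDeriv_of_contDiff hu j)
    (A := K * N ^ s) fun z => (hb _).trans ?_).trans_eq ?_
  · rw [← Real.rpow_natCast]
    gcongr
  · rw [ENNReal.toReal_ofReal hp.le, ENNReal.ofReal_rpow_of_pos (by positivity),
      ← ENNReal.ofReal_mul (by positivity)]

theorem norm_sub_le_min_of_contDiff {V : ℝ → ℂ} (hV : Differentiable ℝ V) {A N : ℝ} (hN : 0 < N)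
    (h0 : ∀ θ, ‖V θ‖ ≤ A) (h1 : ∀ θ, ‖deriv V θ‖ ≤ A * N) (x y : ℝ) :
    ‖V x - V y‖ ≤ 2 * A * min (|x - y| / (1 / N)) 1 := by
  have hA : 0 ≤ A := (norm_nonneg _).trans (h0 0)
  rw [mul_min_of_nonneg _ _ (by positivity)]
  refine le_min ?_ ?_
  · have := convex_univ.norm_image_sub_le_of_norm_deriv_le (f := V) (fun z _ => hV z)
      (fun z _ => h1 z) (Set.mem_univ y) (Set.mem_univ x)
    rw [Real.norm_eq_abs] at this
    rw [div_div_eq_mul_div, div_one]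
    nlinarith [mul_nonneg (mul_nonneg hA hN.le) (abs_nonneg (x - y))]
  · have := norm_sub_le (V x) (V y)
    linarith [h0 x, h0 y]

/-- A smooth map whose derivatives grow geometrically has a controlled Sobolev norm. -/
theorem exists_sobolevNorm_le {s p : ℝ} (hs : 0 < s) (hp : 1 ≤ p) :
    ∃ C : ℝ, 0 < C ∧ ∀ (u : Circle → ℂ) (K N : ℝ), 0 ≤ K → 1 ≤ N →
      (ContDiff ℝ ∞ fun t : ℝ => u (Circle.exp t)) →
      (∀ j ≤ ⌊s⌋₊ + 1, ∀ θ, ‖iteratedDeriv j (fun t : ℝ => u (Circle.exp t)) θ‖ ≤ K * N ^ j) →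
      sobolevNorm s p u ≤ ENNReal.ofReal (C * (K * N ^ s)) := by
  have hp0 : 0 < p := by linarith
  have hπ := Real.pi_pos
  have hfl : (⌊s⌋₊ : ℝ) ≤ s := Nat.floor_le hs.le
  have hsum : (⌊s⌋₊ : ℝ) + Int.fract s = s := by
    have h1 := Int.floor_add_fract s
    rw [← Int.natCast_floor_eq_floor hs.le] at h1
    exact_mod_cast h1
  obtain ⟨C₂, hC₂, hsemi⟩ : ∃ C₂ : ℝ, 0 ≤ C₂ ∧ ∀ (u : Circle → ℂ) (K N : ℝ), 0 ≤ K → 1 ≤ N →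
      (ContDiff ℝ ∞ fun t : ℝ => u (Circle.exp t)) →
      (∀ j ≤ ⌊s⌋₊ + 1, ∀ θ, ‖iteratedDeriv j (fun t : ℝ => u (Circle.exp t)) θ‖ ≤ K * N ^ j) →
      sobolevSeminorm s p u ≤ ENNReal.ofReal (C₂ * (K * N ^ s)) := by
    by_cases hfr : Int.fract s = 0
    · refine ⟨(2 * Real.pi) ^ p⁻¹, by positivity, fun u K N hK hN hu hb => ?_⟩
      unfold sobolevSeminorm
      rw [if_pos hfr]
      exact weakDerivLpNorm_le_of_contDiff hp0 hu hK hN hfl (hb _ (by omega))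
    · have hσ : 0 < Int.fract s := lt_of_le_of_ne (Int.fract_nonneg s) (Ne.symm hfr)
      have hσ1 := Int.fract_lt_one s
      have hk := kernelConst_pos hσ hσ1 hp0
      refine ⟨(2 * Real.pi * kernelConst (Int.fract s) p) ^ (1 / p) * 2, by positivity,
        fun u K N hK hN hu hb => ?_⟩
      have hN0 : 0 < N := by linarith
      unfold sobolevSeminorm
      rw [if_neg hfr]
      refine (iInf₂_le _ (hasWeakDeriv_of_contDiff hu ⌊s⌋₊)).trans ?_
      have hper := periodic_iteratedDeriv (k := ⌊s⌋₊) (φ := fun t : ℝ => u (Circle.exp t))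
        (c := 2 * Real.pi) (fun t => by simp only [Circle.exp_add_two_pi])
      -- The derivative of order `⌊s⌋` has size `K N^⌊s⌋` and varies at scale `1/N`, so the
      -- fractional part contributes the missing factor `N^(fract s)`.
      refine (gagliardo_le_of_norm_sub_le hσ hσ1 hp0 (D := 2 * (K * N ^ ⌊s⌋₊)) (X := 1 / N)
        (by positivity) (by positivity) fun x y => ?_).trans_eq ?_
      · rw [hper.apply_arg_exp, hper.apply_arg_exp]
        refine norm_sub_le_min_of_contDiff
          ((contDiff_iteratedDeriv hu _).differentiable (by simp)) hN0 (hb _ (by omega))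
          (fun θ => ?_) x y
        have := hb (⌊s⌋₊ + 1) le_rfl θ
        rwa [iteratedDeriv_succ, pow_succ, ← mul_assoc] at this
      · congr 1
        rw [one_div N, Real.inv_rpow hN0.le, Real.rpow_neg hN0.le, inv_inv]
        have hNs : N ^ s = N ^ ⌊s⌋₊ * N ^ Int.fract s := by
          rw [← Real.rpow_natCast, ← Real.rpow_add hN0, hsum]
        rw [hNs]
        ring
  refine ⟨⌈s⌉₊ * (2 * Real.pi) ^ p⁻¹ + C₂ + 1, by positivity, fun u K N hK hN hu hb => ?_⟩
  have hX : 0 ≤ K * N ^ s := by positivity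
  unfold sobolevNorm
  calc _ ≤ ∑ _j ∈ Finset.range ⌈s⌉₊, ENNReal.ofReal ((2 * Real.pi) ^ p⁻¹ * (K * N ^ s)) +
        ENNReal.ofReal (C₂ * (K * N ^ s)) := by
        gcongr with j hj
        · have hj' : (j : ℝ) < s := Nat.lt_ceil.1 (Finset.mem_range.1 hj)
          exact weakDerivLpNorm_le_of_contDiff hp0 hu hK hN hj'.le
            (hb j ((Nat.le_floor hj'.le).trans (by omega)))
        · exact hsemi u K N hK hN hu hb
    _ = ENNReal.ofReal (⌈s⌉₊ * ((2 * Real.pi) ^ p⁻¹ * (K * N ^ s)) + C₂ * (K * N ^ s)) := by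
        rw [Finset.sum_const, Finset.card_range, nsmul_eq_mul, ENNReal.ofReal_add (by positivity)
          (by positivity), ENNReal.ofReal_mul (p := (⌈s⌉₊ : ℝ)) (by positivity),
          ENNReal.ofReal_natCast]
    _ ≤ _ := ENNReal.ofReal_le_ofReal (by nlinarith)

theorem exists_bound_of_continuous_periodic {P : ℝ → ℂ} (hP : Continuous P)
    (hp : Function.Periodic P (2 * Real.pi)) : ∃ K, 0 ≤ K ∧ ∀ θ, ‖P θ‖ ≤ K := by
  obtain ⟨K, hK⟩ := isCompact_Icc.exists_bound_of_continuousOn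
    (s := Set.Icc (-Real.pi) Real.pi) hP.continuousOn
  refine ⟨max K 0, le_max_right _ _, fun θ => ?_⟩
  rw [← hp.apply_arg_exp θ]
  exact (hK _ ⟨(Complex.neg_pi_lt_arg _).le, Complex.arg_le_pi _⟩).trans (le_max_left _ _)

theorem sobolevNorm_lt_top_of_contDiff {s p : ℝ} (hs : 0 < s) (hp : 1 ≤ p) {u : Circle → ℂ}
    (hu : ContDiff ℝ ∞ fun t : ℝ => u (Circle.exp t)) : sobolevNorm s p u < ⊤ := by
  obtain ⟨C, -, hC⟩ := exists_sobolevNorm_le (p := p) hs hp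
  have hper : ∀ j, Function.Periodic (iteratedDeriv j fun t : ℝ => u (Circle.exp t))
    (2 * Real.pi) := periodic_iteratedDeriv fun t => by simp only [Circle.exp_add_two_pi]
  choose K hK hb using fun j => exists_bound_of_continuous_periodic
    (contDiff_iteratedDeriv hu j).continuous (hper j)
  refine (hC u (∑ j ∈ Finset.range (⌊s⌋₊ + 2), K j) 1 (Finset.sum_nonneg fun j _ => hK j) le_rfl hu
    fun j hj θ => ?_).trans_lt ENNReal.ofReal_lt_top
  rw [one_pow, mul_one]
  exact (hb j θ).trans (Finset.single_le_sum (f := K) (fun j _ => hK j)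
    (Finset.mem_range.2 (by omega)))

end SmoothUpperBound

/-! ### Two phases of degree one that vary on opposite half circles. -/

section Windings

/-- A smooth nonnegative periodic function with mass `2π` supported where `cos ≥ 0`. -/
theorem exists_smooth_bump : ∃ β : ℝ → ℝ, ContDiff ℝ ∞ β ∧ Function.Periodic β (2 * Real.pi) ∧
    (∀ t, 0 ≤ β t) ∧ (∀ t, β (-t) = β t) ∧ (∀ t, Real.cos t ≤ 0 → β t = 0) ∧
    (∀ t, 0 < Real.cos t → 0 < β t) ∧
    ∫ t in (-Real.pi)..Real.pi, β t = 2 * Real.pi := by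
  set b : ℝ → ℝ := fun t => expNegInvGlue (Real.cos t) with hb
  have hc : ContDiff ℝ ∞ b := expNegInvGlue.contDiff.comp Real.contDiff_cos
  have hπ := Real.pi_pos
  have h0 : ∀ t, 0 ≤ b t := fun t => expNegInvGlue.nonneg _
  have hI : 0 < ∫ t in (-Real.pi)..Real.pi, b t :=
    intervalIntegral.integral_pos (by linarith) hc.continuous.continuousOn (fun t _ => h0 t)
      ⟨0, ⟨by linarith, hπ.le⟩, expNegInvGlue.pos_of_pos (by simp)⟩
  set I := ∫ t in (-Real.pi)..Real.pi, b t with hIdef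
  refine ⟨fun t => 2 * Real.pi / I * b t, contDiff_const.mul hc, fun t => ?_, fun t => ?_,
    fun t => ?_, fun t ht => ?_, fun t ht => ?_, ?_⟩
  · simp only [hb, Real.cos_add_two_pi]
  · have := h0 t; positivity
  · simp only [hb, Real.cos_neg]
  · simp only [hb, expNegInvGlue.zero_of_nonpos ht, mul_zero]
  · have := expNegInvGlue.pos_of_pos ht
    positivity
  · rw [intervalIntegral.integral_const_mul, ← hIdef]
    field_simp

/-- A primitive of a periodic function of mass `m` per period increases by `m` over a period. -/
theorem integral_add_period {β : ℝ → ℝ} (hβ : Continuous β)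
    (hp : Function.Periodic β (2 * Real.pi)) (a θ : ℝ) :
    ∫ t in a..(θ + 2 * Real.pi), β t =
      (∫ t in a..θ, β t) + ∫ t in (-Real.pi)..Real.pi, β t := by
  rw [← intervalIntegral.integral_add_adjacent_intervals (hβ.intervalIntegrable a θ)
    (hβ.intervalIntegrable _ _), hp.intervalIntegral_add_eq θ (-Real.pi)]
  congr 2; ring

theorem contDiff_integral {β : ℝ → ℝ} (hβ : ContDiff ℝ ∞ β) (a : ℝ) :
    ContDiff ℝ ∞ fun θ => ∫ t in a..θ, β t := by
  have hd : ∀ x, HasDerivAt (fun θ => ∫ t in a..θ, β t) (β x) x := fun x =>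
    intervalIntegral.integral_hasDerivAt_right (hβ.continuous.intervalIntegrable _ _)
      (hβ.continuous.stronglyMeasurableAtFilter _ _) hβ.continuous.continuousAt
  rw [contDiff_infty_iff_deriv]
  refine ⟨fun x => (hd x).differentiableAt, ?_⟩
  rwa [funext fun x => (hd x).deriv]

theorem apply_exp_arg_of_quasiperiodic {φ : ℝ → ℝ} {d : ℤ}
    (hφ : ∀ θ, φ (θ + 2 * Real.pi) = φ θ + 2 * Real.pi * d) (t : ℝ) :
    Circle.exp (φ (Complex.arg (Circle.exp t))) = Circle.exp (φ t) := by
  have : Function.Periodic (fun t => Circle.exp (φ t)) (2 * Real.pi) := fun t => by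
    simp only [hφ, Circle.exp_add, Circle.exp_two_pi_mul_int, mul_one]
  exact this.apply_arg_exp t

/-- Two smooth phases of degree one, each of which varies only where the other one is trivial. -/
theorem exists_disjoint_windings : ∃ η ζ : ℝ → ℝ, ContDiff ℝ ∞ η ∧ ContDiff ℝ ∞ ζ ∧
    (∀ θ, η (θ + 2 * Real.pi) = η θ + 2 * Real.pi) ∧
    (∀ θ, ζ (θ + 2 * Real.pi) = ζ θ + 2 * Real.pi) ∧
    Function.Periodic (deriv η) (2 * Real.pi) ∧
    ∀ θ, Circle.exp (η θ) = 1 ∨ Circle.exp (ζ θ) = 1 := by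
  obtain ⟨β, hβ, hβp, hβ0, hβe, hβz, hβpos, hβI⟩ := exists_smooth_bump
  have hπ := Real.pi_pos
  -- Half a turn moves the support from `cos ≥ 0` to `cos ≤ 0`.
  set γ : ℝ → ℝ := fun t => β (t + Real.pi) with hγ
  have hγs : ContDiff ℝ ∞ γ := hβ.comp (contDiff_id.add contDiff_const)
  have hγp : Function.Periodic γ (2 * Real.pi) := fun t => by
    simp only [hγ]; rw [← hβp (t + Real.pi)]; congr 1; ring
  have hγI : ∫ t in (-Real.pi)..Real.pi, γ t = 2 * Real.pi := by
    rw [intervalIntegral.integral_comp_add_right, ← hβI, neg_add_cancel,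
      show Real.pi + Real.pi = 0 + 2 * Real.pi by ring, hβp.intervalIntegral_add_eq 0 (-Real.pi)]
    congr 1; ring
  have hη2 : ∀ θ, ∫ t in (-Real.pi)..(θ + 2 * Real.pi), β t =
      (∫ t in (-Real.pi)..θ, β t) + 2 * Real.pi := fun θ => by
    rw [integral_add_period hβ.continuous hβp, hβI]
  have hζ2 : ∀ θ, ∫ t in (0:ℝ)..(θ + 2 * Real.pi), γ t =
      (∫ t in (0:ℝ)..θ, γ t) + 2 * Real.pi := fun θ => by
    rw [integral_add_period hγs.continuous hγp, hγI]
  -- The base points lie where the integrands vanish: `η` is 0 or `2π` for `π/2 ≤ |θ| ≤ π`, and `ζ`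
  -- is 0 for `|θ| ≤ π/2`.
  refine ⟨fun θ => ∫ t in (-Real.pi)..θ, β t, fun θ => ∫ t in (0:ℝ)..θ, γ t,
    contDiff_integral hβ _, contDiff_integral hγs _, hη2, hζ2, ?_, ?_⟩
  · have : deriv (fun θ => ∫ t in (-Real.pi)..θ, β t) = β := by
      funext x
      exact Continuous.deriv_integral β hβ.continuous (-Real.pi) x
    rw [this]; exact hβp
  · intro θ
    rw [← apply_exp_arg_of_quasiperiodic (φ := fun θ => ∫ t in (-Real.pi)..θ, β t) (d := 1)
        (by simpa using hη2) θ,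
      ← apply_exp_arg_of_quasiperiodic (φ := fun θ => ∫ t in (0:ℝ)..θ, γ t) (d := 1)
        (by simpa using hζ2) θ]
    have h1 := Complex.neg_pi_lt_arg (Circle.exp θ : ℂ)
    have h2 := Complex.arg_le_pi (Circle.exp θ : ℂ)
    set a := Complex.arg (Circle.exp θ) with ha
    have hβz' : ∀ t, Real.pi / 2 ≤ |t| → |t| ≤ Real.pi → β t = 0 := fun t ht1 ht2 =>
      hβz t (by
        rw [← Real.cos_abs]
        exact Real.cos_nonpos_of_pi_div_two_le_of_le ht1 (by linarith))
    have hzero : ∀ x y, (∀ t ∈ Set.uIcc x y, β t = 0) → ∫ t in x..y, β t = 0 := fun x y h => by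
      rw [intervalIntegral.integral_congr (g := fun _ => 0) h]; simp
    rcases le_total (Real.pi / 2) |a| with h | h
    · left
      rcases abs_cases a with ⟨ha1, ha2⟩ | ⟨ha1, ha2⟩
      · have h3 : ∫ t in a..Real.pi, β t = 0 := hzero _ _ fun t ht => by
          rw [Set.uIcc_of_le h2] at ht
          have : |t| = t := abs_of_nonneg (ha2.trans ht.1)
          exact hβz' t (by rw [this]; linarith [ht.1]) (by rw [this]; exact ht.2)
        have h4 := intervalIntegral.integral_add_adjacent_intervals
          (hβ.continuous.intervalIntegrable (μ := volume) (-Real.pi) a)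
          (hβ.continuous.intervalIntegrable a Real.pi)
        rw [h3, add_zero, hβI] at h4
        rw [h4, Circle.exp_two_pi]
      · have h3 : ∫ t in (-Real.pi)..a, β t = 0 := hzero _ _ fun t ht => by
          rw [Set.uIcc_of_le h1.le] at ht
          have : |t| = -t := abs_of_nonpos (ht.2.trans ha2.le)
          exact hβz' t (by rw [this]; linarith [ht.2]) (by rw [this]; linarith [ht.1])
        rw [h3, Circle.exp_zero]
    · right
      have h3 : ∫ t in (0:ℝ)..a, γ t = 0 := by
        rw [intervalIntegral.integral_congr (g := fun _ => 0), intervalIntegral.integral_zero]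
        intro t ht
        have hta : |t| ≤ |a| := by
          rcases le_total 0 a with h | h
          · rw [Set.uIcc_of_le h] at ht
            rw [abs_of_nonneg h, abs_of_nonneg ht.1]; exact ht.2
          · rw [Set.uIcc_of_ge h] at ht
            rw [abs_of_nonpos h, abs_of_nonpos ht.2]; linarith [ht.1]
        refine hβz _ ?_
        rw [Real.cos_add_pi, neg_nonpos]
        have := abs_le.1 (hta.trans h)
        exact Real.cos_nonneg_of_neg_pi_div_two_le_of_le (by linarith [this.1]) this.2
      rw [h3, Circle.exp_zero]

end Windings

/-! ### The upper bound `|d₁ - d₂|^s`. -/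

section UpperBound

theorem contDiff_coe_circle_exp : ContDiff ℝ ∞ fun x : ℝ => (Circle.exp x : ℂ) := by
  simp only [Circle.coe_exp]
  exact (Complex.ofRealCLM.contDiff.mul contDiff_const).cexp

theorem hasDerivAt_coe_circle_exp (x : ℝ) :
    HasDerivAt (fun x : ℝ => (Circle.exp x : ℂ)) (Complex.I * (Circle.exp x : ℂ)) x := by
  simp only [Circle.coe_exp]
  have := ((Complex.ofRealCLM.hasDerivAt (x := x)).mul_const Complex.I).cexp
  simpa [mul_comm] using this

theorem norm_iteratedFDeriv_coe_circle_exp (n : ℕ) (x : ℝ) :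
    ‖iteratedFDeriv ℝ n (fun x : ℝ => (Circle.exp x : ℂ)) x‖ = 1 := by
  have h : ∀ n, iteratedDeriv n (fun x : ℝ => (Circle.exp x : ℂ)) =
      fun x => Complex.I ^ n * (Circle.exp x : ℂ) := by
    intro n
    induction n with
    | zero => simp [iteratedDeriv_zero]
    | succ k ih =>
      funext x
      rw [iteratedDeriv_succ, ih, ((hasDerivAt_coe_circle_exp x).const_mul _).deriv]
      ring
  rw [norm_iteratedFDeriv_eq_norm_iteratedDeriv, h]
  simp

theorem norm_average_arcLength_le {h : Circle → ℂ} {A : ℝ} (hA : ∀ z, ‖h z‖ ≤ A) :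
    ‖⨍ w, h w ∂arcLength‖ ≤ A := by
  have h1 := norm_integral_le_of_norm_le_const (μ := arcLength) (f := h) (C := A)
    (Eventually.of_forall hA)
  have h2 : 0 < arcLength.real Set.univ := by
    rw [measureReal_def, arcLength_univ, ENNReal.toReal_ofReal (by positivity)]
    positivity
  rw [average_eq, norm_smul, norm_inv, Real.norm_of_nonneg h2.le, inv_mul_le_iff₀ h2, mul_comm]
  exact h1

theorem norm_coe_sub_coe_le (z w : Circle) : ‖(z : ℂ) - (w : ℂ)‖ ≤ 2 := by
  have := norm_sub_le (z : ℂ) (w : ℂ)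
  simp only [Circle.norm_coe] at this
  linarith

/-- The circle map with a given quasiperiodic phase. -/
noncomputable def circleMapOfPhase (φ : ℝ → ℝ) (z : Circle) : Circle :=
  Circle.exp (φ (Complex.arg z))

theorem circleMapOfPhase_exp {φ : ℝ → ℝ} {d : ℤ}
    (hφ : ∀ θ, φ (θ + 2 * Real.pi) = φ θ + 2 * Real.pi * d) (t : ℝ) :
    circleMapOfPhase φ (Circle.exp t) = Circle.exp (φ t) :=
  apply_exp_arg_of_quasiperiodic hφ t

theorem circleMapOfPhase_mem_degreeClass {s p : ℝ} (hs : 0 < s) (hp : 1 ≤ p) {φ : ℝ → ℝ} {d : ℤ}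
    (hc : ContDiff ℝ ∞ φ) (hφ : ∀ θ, φ (θ + 2 * Real.pi) = φ θ + 2 * Real.pi * d) :
    circleMapOfPhase φ ∈ degreeClass s p d := by
  refine ⟨sobolevNorm_lt_top_of_contDiff hs hp ?_,
    hasDegree_of_lift hc.continuous (circleMapOfPhase_exp hφ) hφ⟩
  simp only [circleMapOfPhase_exp hφ]
  exact contDiff_coe_circle_exp.comp hc

/-- The phase itself is unbounded; only its derivatives are periodic, hence the restriction `1 ≤ i`.
The normalization `1 ≤ K` lets powers of `K` be compared. -/
theorem exists_iteratedDeriv_bound {η : ℝ → ℝ} (hη : ContDiff ℝ ∞ η)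
    (hp : Function.Periodic (deriv η) (2 * Real.pi)) (n : ℕ) :
    ∃ K : ℝ, 1 ≤ K ∧ ∀ i, 1 ≤ i → i ≤ n → ∀ x, ‖iteratedDeriv i η x‖ ≤ K := by
  have hd : ContDiff ℝ ∞ (deriv η) := (contDiff_infty_iff_deriv.1 hη).2
  have hb : ∀ j, ∃ K : ℝ, 0 ≤ K ∧ ∀ x, ‖iteratedDeriv j (deriv η) x‖ ≤ K := fun j => by
    have := exists_bound_of_continuous_periodic
      (P := fun x => ((iteratedDeriv j (deriv η) x : ℝ) : ℂ))
      (Complex.continuous_ofReal.comp (contDiff_iteratedDeriv hd j).continuous)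
      (fun x => by simp only [periodic_iteratedDeriv (k := j) hp x])
    simpa only [Complex.norm_real] using this
  choose K hK hKb using hb
  refine ⟨1 + ∑ j ∈ Finset.range n, K j, by
    have := Finset.sum_nonneg (s := Finset.range n) fun j _ => hK j
    linarith, fun i hi hin x => ?_⟩
  obtain ⟨j, rfl⟩ : ∃ j, i = j + 1 := ⟨i - 1, by omega⟩
  rw [iteratedDeriv_succ']
  have := Finset.single_le_sum (f := K) (fun j _ => hK j) (Finset.mem_range.2 hin)
  linarith [hKb j x]

/-- Two maps of prescribed degrees whose distance is of the order of the difference of the degrees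
to the power `s`. -/
theorem exists_sobolevDist_le {s p : ℝ} (hs : 0 < s) (hp : 1 ≤ p) :
    ∃ C : ℝ, 0 < C ∧ ∀ d₁ d₂ : ℤ, ∃ f ∈ degreeClass s p d₁, ∃ g ∈ degreeClass s p d₂,
      sobolevDist s p f g ≤ ENNReal.ofReal (C * |(d₁ : ℝ) - d₂| ^ s) := by
  obtain ⟨C, hC, hCb⟩ := exists_sobolevNorm_le (p := p) hs hp
  obtain ⟨η, ζ, hη, hζ, hη2, hζ2, hηp, hηζ⟩ := exists_disjoint_windings
  obtain ⟨K, hK1, hKb⟩ := exists_iteratedDeriv_bound hη hηp (⌊s⌋₊ + 1)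
  -- The summand 4 bounds the undifferentiated function, `1 + 1 + |m|` with `|m| ≤ 2`; the other
  -- summand comes from the bound for derivatives of a composition.
  set M : ℝ := 4 + (⌊s⌋₊ + 1).factorial * K ^ (⌊s⌋₊ + 1) with hM
  have hM0 : 0 < M := by positivity
  refine ⟨C * M, by positivity, fun d₁ d₂ => ?_⟩
  set φ₁ : ℝ → ℝ := fun θ => d₂ * ζ θ + ((d₁ : ℝ) - d₂) * η θ with hφ₁
  set φ₂ : ℝ → ℝ := fun θ => d₂ * ζ θ with hφ₂
  have h2 : ∀ θ, φ₂ (θ + 2 * Real.pi) = φ₂ θ + 2 * Real.pi * d₂ := fun θ => by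
    simp only [hφ₂, hζ2]; ring
  have h1 : ∀ θ, φ₁ (θ + 2 * Real.pi) = φ₁ θ + 2 * Real.pi * d₁ := fun θ => by
    simp only [hφ₁, hζ2, hη2]; ring
  have hc2 : ContDiff ℝ ∞ φ₂ := contDiff_const.mul hζ
  have hc1 : ContDiff ℝ ∞ φ₁ := hc2.add (contDiff_const.mul hη)
  set f := circleMapOfPhase φ₁ with hf
  set g := circleMapOfPhase φ₂ with hg
  refine ⟨f, circleMapOfPhase_mem_degreeClass hs hp hc1 h1, g,
    circleMapOfPhase_mem_degreeClass hs hp hc2 h2, ?_⟩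
  set m : ℂ := ⨍ w, ((f w : ℂ) - (g w : ℂ)) ∂arcLength with hm
  have hmn : ‖m‖ ≤ 2 := norm_average_arcLength_le fun z => norm_coe_sub_coe_le _ _
  have hmul : ∀ x y : ℝ, ∀ k : ℤ, Circle.exp (k * x) = Circle.exp x ^ k := fun x _ k => by
    rw [← Circle.exp_zsmul, zsmul_eq_mul]
  change sobolevNorm s p (fun z => ((f z : ℂ) - (g z : ℂ)) - m) ≤ _
  set u : Circle → ℂ := fun z => ((f z : ℂ) - (g z : ℂ)) - m with hu
  -- Where `exp(iζ) = 1` the common factor is absent; elsewhere `exp(iη) = 1` and both sides of the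
  -- difference vanish. So the difference depends on `d₁ - d₂` only.
  have hfg : ∀ θ, u (Circle.exp θ) =
      (Circle.exp (((d₁ : ℝ) - d₂) * η θ) : ℂ) - (1 + m) := fun θ => by
    simp only [hu]
    rw [hf, hg, circleMapOfPhase_exp h1, circleMapOfPhase_exp h2, hφ₁, hφ₂]
    simp only [Circle.exp_add]
    have e1 : Circle.exp (d₂ * ζ θ) = Circle.exp (ζ θ) ^ d₂ := hmul _ 0 _
    have e2 : Circle.exp (((d₁ : ℝ) - d₂) * η θ) = Circle.exp (η θ) ^ (d₁ - d₂) := by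
      rw [← hmul _ 0]; push_cast; rfl
    rw [e1, e2]
    rcases hηζ θ with h | h
    · rw [h]; simp
    · rw [h]; simp; ring
  -- For equal degrees the difference is zero and the growth rate `|d₁ - d₂|` would fail `1 ≤ N`, so
  -- the bound is applied with `K = 0`, `N = 1`.
  rcases eq_or_ne d₁ d₂ with rfl | hd
  · refine (hCb _ 0 1 le_rfl le_rfl ?_ ?_).trans ?_
    · simp only [hfg]
      simpa using contDiff_const
    · have hm0 : m = 0 := by simp [hm, hf, hg, hφ₁, hφ₂]
      intro j _ θ
      simp only [hfg]
      simp [hm0]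
    · simp
  · have hN : (1 : ℝ) ≤ |(d₁ : ℝ) - d₂| := by
      have : (1 : ℤ) ≤ |d₁ - d₂| := Int.one_le_abs (sub_ne_zero.2 hd)
      exact_mod_cast this
    set D : ℝ := (d₁ : ℝ) - d₂ with hD
    have hcomp : ContDiff ℝ ∞ fun θ => (Circle.exp (D * η θ) : ℂ) :=
      contDiff_coe_circle_exp.comp (contDiff_const.mul hη)
    refine (hCb _ M |D| hM0.le hN ?_ ?_).trans_eq (by rw [mul_assoc])
    · simp only [hfg]
      exact hcomp.sub contDiff_const
    · intro j hj θ
      simp only [hfg]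
      rcases Nat.eq_zero_or_pos j with rfl | hj0
      · rw [iteratedDeriv_zero, pow_zero, mul_one]
        have a1 := norm_sub_le (Circle.exp (D * η θ) : ℂ) (1 + m)
        have a2 := norm_add_le (1 : ℂ) m
        simp only [Circle.norm_coe, norm_one] at a1 a2
        have : 0 ≤ ((⌊s⌋₊ + 1).factorial : ℝ) * K ^ (⌊s⌋₊ + 1) := by positivity
        linarith
      · have e : iteratedDeriv j (fun t => (Circle.exp (D * η t) : ℂ) - (1 + m)) =
            iteratedDeriv j (fun t => (Circle.exp (D * η t) : ℂ)) := by
          funext t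
          obtain ⟨i, rfl⟩ : ∃ i, j = i + 1 := ⟨j - 1, by omega⟩
          rw [iteratedDeriv_succ', iteratedDeriv_succ']
          congr 1
          funext t
          exact deriv_sub_const _
        rw [e, ← norm_iteratedFDeriv_eq_norm_iteratedDeriv]
        refine (norm_iteratedFDeriv_comp_le (g := fun x : ℝ => (Circle.exp x : ℂ))
          (f := fun t => D * η t) (N := ∞) contDiff_coe_circle_exp (contDiff_const.mul hη)
          (by exact_mod_cast le_top) θ (C := 1) (D := K * |D|)
          (fun i _ => (norm_iteratedFDeriv_coe_circle_exp i _).le) fun i hi hij => ?_).trans ?_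
        · rw [norm_iteratedFDeriv_eq_norm_iteratedDeriv, iteratedDeriv_const_mul_field, norm_mul,
            mul_pow, mul_comm]
          refine mul_le_mul ((hKb i hi (hij.trans hj) θ).trans (le_self_pow₀ hK1 (by omega)))
            (le_self_pow₀ hN (by omega)) (norm_nonneg _) (by positivity)
        · rw [mul_one, mul_pow, ← mul_assoc]
          gcongr
          have b1 : (j.factorial : ℝ) ≤ (⌊s⌋₊ + 1).factorial := by
            exact_mod_cast Nat.factorial_le hj
          have b2 : K ^ j ≤ K ^ (⌊s⌋₊ + 1) := pow_le_pow_right₀ hK1 hj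
          have : (j.factorial : ℝ) * K ^ j ≤ (⌊s⌋₊ + 1).factorial * K ^ (⌊s⌋₊ + 1) :=
            mul_le_mul b1 b2 (by positivity) (by positivity)
          linarith

end UpperBound

/-! ### Lipschitz circle maps built from a phase on one period. -/

section LipschitzMaps

theorem norm_circle_exp_sub_le (x y : ℝ) :
    ‖(Circle.exp x : ℂ) - (Circle.exp y : ℂ)‖ ≤ |x - y| := by
  rw [norm_circle_exp_sub]
  have h := Real.abs_sin_le_abs (x := (x - y) / 2)
  rw [abs_div, abs_two] at h
  linarith

theorem norm_zpow_sub_zpow_le (z w : Circle) (k : ℤ) :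
    ‖((z ^ k : Circle) : ℂ) - ((w ^ k : Circle) : ℂ)‖ ≤ |(k : ℝ)| * ‖(z : ℂ) - (w : ℂ)‖ := by
  have hnat : ∀ n : ℕ, ‖((z ^ n : Circle) : ℂ) - ((w ^ n : Circle) : ℂ)‖ ≤
      n * ‖(z : ℂ) - (w : ℂ)‖ := by
    intro n
    induction n with
    | zero => simp
    | succ n ih =>
      have e : ((z ^ (n + 1) : Circle) : ℂ) - ((w ^ (n + 1) : Circle) : ℂ) =
          ((z ^ n : Circle) : ℂ) * ((z : ℂ) - w) +
            (((z ^ n : Circle) : ℂ) - ((w ^ n : Circle) : ℂ)) * w := by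
        rw [pow_succ, pow_succ, Circle.coe_mul, Circle.coe_mul]; ring
      rw [e]
      refine (norm_add_le _ _).trans ?_
      rw [norm_mul, norm_mul, Circle.norm_coe, Circle.norm_coe]
      rw [Nat.cast_succ]
      linarith
  have hinv : ∀ a b : Circle, ‖((a⁻¹ : Circle) : ℂ) - ((b⁻¹ : Circle) : ℂ)‖ =
      ‖(a : ℂ) - (b : ℂ)‖ := fun a b => by
    rw [Circle.coe_inv_eq_conj, Circle.coe_inv_eq_conj, ← map_sub, RCLike.norm_conj]
  obtain ⟨n, rfl | rfl⟩ := k.eq_nat_or_neg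
  · simpa using hnat n
  · rw [zpow_neg, zpow_neg, hinv]
    simpa using hnat n

theorem continuous_of_norm_sub_le {v : Circle → ℂ} {K : ℝ}
    (hv : ∀ z w, ‖v z - v w‖ ≤ K * ‖(z : ℂ) - (w : ℂ)‖) : Continuous v := by
  have : LipschitzWith K.toNNReal v := LipschitzWith.of_dist_le_mul fun z w => by
    rw [dist_eq_norm]
    change _ ≤ _ * dist (z : ℂ) (w : ℂ)
    rw [dist_eq_norm]
    exact (hv z w).trans (mul_le_mul_of_nonneg_right (Real.le_coe_toNNReal K) (norm_nonneg _))
  exact this.continuous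

theorem integrable_arcLength_of_continuous {v : Circle → ℂ} (hv : Continuous v) :
    Integrable v arcLength :=
  hv.integrable_of_hasCompactSupport (HasCompactSupport.of_compactSpace v)

theorem sobolevNorm_one_div_le {p : ℝ} (hp : 1 < p) {u : Circle → ℂ}
    (hu : Integrable u arcLength) :
    sobolevNorm (1 / p) p u ≤ eLpNorm u (ENNReal.ofReal p) arcLength + gagliardo (1 / p) p u := by
  have h0 : 0 < 1 / p := by positivity
  have h1 : 1 / p < 1 := by rw [div_lt_one (by linarith)]; exact hp
  have hfr : Int.fract (1 / p) = 1 / p := Int.fract_eq_self.2 ⟨h0.le, h1⟩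
  have hfl : ⌊1 / p⌋₊ = 0 := Nat.floor_eq_zero.2 h1
  have hce : ⌈1 / p⌉₊ = 1 := by
    rw [Nat.ceil_eq_iff one_ne_zero]
    exact ⟨by simpa using h0, by simpa using h1.le⟩
  have hw : HasWeakDeriv 0 u u := ⟨hu, hu, fun φ _ _ => by simp [iteratedDeriv_zero]⟩
  unfold sobolevNorm sobolevSeminorm
  rw [hfr, if_neg h0.ne', hfl, hce, Finset.sum_range_one]
  exact add_le_add (iInf₂_le u hw) (iInf₂_le u hw)

theorem sobolevNorm_one_div_lt_top {p : ℝ} (hp : 1 < p) {v : Circle → ℂ} {K : ℝ}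
    (hv : ∀ z w, ‖v z - v w‖ ≤ K * ‖(z : ℂ) - (w : ℂ)‖) : sobolevNorm (1 / p) p v < ⊤ := by
  have hp0 : 0 < p := by linarith
  have hc := continuous_of_norm_sub_le hv
  have hK : 0 ≤ K := by
    have h := (norm_nonneg _).trans (hv 1 (-1))
    have h2 : ‖((1 : Circle) : ℂ) - ((-1 : Circle) : ℂ)‖ = 2 := by norm_num
    rw [h2] at h
    linarith
  refine (sobolevNorm_one_div_le hp (integrable_arcLength_of_continuous hc)).trans_lt
    (ENNReal.add_lt_top.2 ⟨?_, ?_⟩)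
  · obtain ⟨C, hC⟩ := isCompact_univ.exists_bound_of_continuousOn hc.continuousOn
    exact (MemLp.of_bound hc.aestronglyMeasurable C
      (Eventually.of_forall fun z => hC z (Set.mem_univ z))).2
  · refine (gagliardo_le_of_norm_sub_le (D := 2 * (K + 1)) (X := 1) (by positivity)
      (by rw [div_lt_one hp0]; exact hp) hp0 (by positivity) one_pos fun x y => ?_).trans_lt
      ENNReal.ofReal_lt_top
    rw [mul_min_of_nonneg _ _ (by positivity), div_one]
    refine (hv _ _).trans (le_min ?_ ?_)
    · have := norm_circle_exp_sub_le x y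
      nlinarith [abs_nonneg (x - y)]
    · have := norm_coe_sub_coe_le (Circle.exp x) (Circle.exp y)
      nlinarith

/-- A phase given on one period extends to a quasiperiodic one. -/
theorem exists_quasiperiodic_extension {φ : ℝ → ℝ} (hc : Continuous φ) {d : ℤ}
    (hφ : φ Real.pi = φ (-Real.pi) + 2 * Real.pi * d) :
    ∃ ψ : ℝ → ℝ, Continuous ψ ∧ (∀ θ, ψ (θ + 2 * Real.pi) = ψ θ + 2 * Real.pi * d) ∧
      ∀ θ, circleMapOfPhase φ (Circle.exp θ) = Circle.exp (ψ θ) := by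
  have : Fact (0 < 2 * Real.pi) := ⟨Real.two_pi_pos⟩
  have hπ := Real.pi_pos
  -- Subtracting the linear phase `d x` equalizes the end values, so the remainder closes up to a
  -- continuous function on the circle.
  set χ : ℝ → ℝ := fun x => φ x - d * x with hχ
  have hχπ : χ (-Real.pi) = χ (-Real.pi + 2 * Real.pi) := by
    have e : -Real.pi + 2 * Real.pi = Real.pi := by ring
    rw [e]; simp only [hχ, hφ]; ring
  have hχc : Continuous χ := hc.sub (continuous_const.mul continuous_id)
  have hlc := AddCircle.liftIco_continuous hχπ hχc.continuousOn
  set ψ : ℝ → ℝ := fun θ =>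
    d * θ + AddCircle.liftIco (2 * Real.pi) (-Real.pi) χ (θ : AddCircle (2 * Real.pi)) with hψ
  have hq : ∀ θ, ψ (θ + 2 * Real.pi) = ψ θ + 2 * Real.pi * d := fun θ => by
    simp only [hψ, AddCircle.coe_add_period]; ring
  refine ⟨ψ, (continuous_const.mul continuous_id).add
    (hlc.comp (AddCircle.continuous_mk' _)), hq, fun θ => ?_⟩
  rw [← apply_exp_arg_of_quasiperiodic hq θ, circleMapOfPhase]
  congr 1
  have h1 := Complex.neg_pi_lt_arg (Circle.exp θ : ℂ)
  have h2 := Complex.arg_le_pi (Circle.exp θ : ℂ)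
  set a := Complex.arg (Circle.exp θ)
  rcases h2.eq_or_lt with h | h
  · have e : Real.pi = -Real.pi + 2 * Real.pi := by ring
    have e2 : ψ (-Real.pi) = φ (-Real.pi) := by
      simp only [hψ]
      rw [AddCircle.liftIco_coe_apply ⟨le_rfl, by linarith⟩]
      simp only [hχ]; ring
    rw [h, hφ, ← e2, ← hq, ← e]
  · simp only [hψ]
    rw [AddCircle.liftIco_coe_apply ⟨h1.le, by linarith⟩]
    simp only [hχ]; ring

/-- When the short arc between two points crosses the cut at `-1`, the comparison goes through both
ends `±π`; the jump `2πd` of the phase is invisible to the exponential. The factor `π/2` compares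
angle and chord. -/
theorem norm_circleMapOfPhase_sub_le {φ : ℝ → ℝ} {K : ℝ} (hK : ∀ x y, |φ x - φ y| ≤ K * |x - y|)
    {d : ℤ} (hφ : φ Real.pi = φ (-Real.pi) + 2 * Real.pi * d) (z w : Circle) :
    ‖(circleMapOfPhase φ z : ℂ) - (circleMapOfPhase φ w : ℂ)‖ ≤
      K * (Real.pi / 2) * ‖(z : ℂ) - (w : ℂ)‖ := by
  have hπ := Real.pi_pos
  have hK0 : 0 ≤ K := by
    have := (abs_nonneg _).trans (hK 1 0)
    simpa using this
  have key : ∀ x y : ℝ, -Real.pi ≤ x → x ≤ y → y ≤ Real.pi →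
      ‖(Circle.exp (φ x) : ℂ) - (Circle.exp (φ y) : ℂ)‖ ≤
        K * (Real.pi / 2) * ‖(Circle.exp x : ℂ) - (Circle.exp y : ℂ)‖ := by
    intro x y hx hxy hy
    have hxy' : |x - y| = y - x := by rw [abs_sub_comm, abs_of_nonneg (by linarith)]
    rcases le_total (y - x) Real.pi with h | h
    · have h1 := mul_abs_le_norm_circle_exp_sub (x := x) (y := y) (by rw [hxy']; exact h)
      calc _ ≤ |φ x - φ y| := norm_circle_exp_sub_le _ _
        _ ≤ K * |x - y| := hK x y
        _ = K * (Real.pi / 2) * (2 / Real.pi * |x - y|) := by field_simp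
        _ ≤ _ := mul_le_mul_of_nonneg_left h1 (by positivity)
    · have e : |x + 2 * Real.pi - y| = (x + Real.pi) + (Real.pi - y) := by
        rw [abs_of_nonneg (by linarith)]; ring
      have h1 := mul_abs_le_norm_circle_exp_sub (x := x + 2 * Real.pi) (y := y)
        (by rw [e]; linarith)
      rw [Circle.exp_add_two_pi] at h1
      have e2 : Circle.exp (φ x) = Circle.exp (φ x + 2 * Real.pi * d) := by
        rw [Circle.exp_add, Circle.exp_two_pi_mul_int, mul_one]
      have h3 := hK x (-Real.pi)
      have h4 := hK Real.pi y
      rw [abs_of_nonneg (show 0 ≤ x - -Real.pi by linarith)] at h3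
      rw [abs_of_nonneg (show 0 ≤ Real.pi - y by linarith)] at h4
      calc _ ≤ |φ x + 2 * Real.pi * d - φ y| := by
            rw [e2]; exact norm_circle_exp_sub_le _ _
        _ = |(φ x - φ (-Real.pi)) + (φ Real.pi - φ y)| := by rw [hφ]; congr 1; ring
        _ ≤ K * |x + 2 * Real.pi - y| := by
            refine (abs_add_le _ _).trans ?_
            rw [e]; linarith
        _ = K * (Real.pi / 2) * (2 / Real.pi * |x + 2 * Real.pi - y|) := by field_simp
        _ ≤ _ := mul_le_mul_of_nonneg_left h1 (by positivity)
  conv_rhs => rw [← Circle.exp_arg z, ← Circle.exp_arg w]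
  unfold circleMapOfPhase
  rcases le_total (Complex.arg z) (Complex.arg w) with h | h
  · exact key _ _ (Complex.neg_pi_lt_arg _).le h (Complex.arg_le_pi _)
  · rw [norm_sub_rev, norm_sub_rev (Circle.exp (Complex.arg z) : ℂ)]
    exact key _ _ (Complex.neg_pi_lt_arg _).le h (Complex.arg_le_pi _)

end LipschitzMaps

/-! ### Critical energy of logarithmic profiles. -/

section LogKernel

/-- By homogeneity the integral is of order `1/X`. Near 0, `log(1 + t/X) ≤ t/X` and `p > 1` gives
convergence; far away the logarithm is below a power `1/(2p)`, whose `p`-th power has exponent `1/2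
< 1`. -/
theorem exists_lintegral_log_kernel_le {p : ℝ} (hp : 1 < p) :
    ∃ C : ℝ, 0 < C ∧ ∀ X : ℝ, 0 < X →
      ∫⁻ t in Set.Ioi (0 : ℝ), ENNReal.ofReal (Real.log (1 + t / X) ^ p / t ^ (1 + (1 : ℝ))) ≤
        ENNReal.ofReal (C / X) := by
  have hp0 : 0 < p := by linarith
  set C : ℝ := (2 : ℝ) ^ (1 / 2 : ℝ) * (2 * p) ^ p with hC
  have hC0 : 0 < C := by positivity
  have hp1 : 0 < p - 1 := by linarith
  refine ⟨1 / (p - 1) + C / (1 - 1 / 2), by positivity, fun X hX => ?_⟩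
  refine (lintegral_kernel_le (g := fun t => Real.log (1 + t / X) ^ p) hX hC0.le hp
    (by norm_num : (1 / 2 : ℝ) < 1) (fun t ht => ?_) fun t ht => ?_).trans_eq ?_
  · have h : 0 < t / X := div_pos ht.1 hX
    have h1 := Real.log_le_sub_one_of_pos (show 0 < 1 + t / X by linarith)
    have h2 : 0 ≤ Real.log (1 + t / X) := Real.log_nonneg (by linarith)
    exact Real.rpow_le_rpow h2 (by linarith) hp0.le
  · have h : 1 ≤ t / X := (one_le_div hX).2 (le_of_lt ht)
    have h2 : 0 ≤ Real.log (1 + t / X) := Real.log_nonneg (by linarith)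
    have hε : 0 < 1 / (2 * p) := by positivity
    have h1 : Real.log (1 + t / X) ≤ (2 * (t / X)) ^ (1 / (2 * p)) / (1 / (2 * p)) := by
      refine (Real.log_le_rpow_div (by linarith) hε).trans ?_
      gcongr
      linarith
    refine (Real.rpow_le_rpow h2 h1 hp0.le).trans_eq ?_
    rw [div_div_eq_mul_div, div_one, Real.mul_rpow (by positivity) (by positivity),
      ← Real.rpow_mul (by positivity), show 1 / (2 * p) * p = 1 / 2 by field_simp,
      Real.mul_rpow (by norm_num) (by positivity), hC]
    ring
  · rw [Real.rpow_neg_one]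
    congr 1
    ring

/-- The logarithmic kernel restricted to `x < y`. -/
noncomputable def logKernel (δ p x y : ℝ) : ℝ≥0∞ :=
  if x < y then ENNReal.ofReal (Real.log ((y + δ) / (x + δ)) ^ p / (y - x) ^ (1 + (1 : ℝ))) else 0

theorem measurable_logKernel (δ p : ℝ) : Measurable (Function.uncurry (logKernel δ p)) := by
  unfold logKernel Function.uncurry
  refine Measurable.ite (measurableSet_lt measurable_fst measurable_snd) ?_ measurable_const
  fun_prop

theorem lintegral_logKernel {δ p x : ℝ} (hx : 0 < x + δ) :
    ∫⁻ y, logKernel δ p x y =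
      ∫⁻ t in Set.Ioi (0 : ℝ),
        ENNReal.ofReal (Real.log (1 + t / (x + δ)) ^ p / t ^ (1 + (1 : ℝ))) := by
  rw [← lintegral_add_left_eq_self _ x, ← lintegral_indicator measurableSet_Ioi]
  congr 1
  funext t
  unfold logKernel Set.indicator
  simp only [lt_add_iff_pos_right, Set.mem_Ioi, add_sub_cancel_left]
  congr 4
  congr 1
  field_simp
  ring

theorem lintegral_const_div_add {C δ R : ℝ} (hC : 0 ≤ C) (hδ : 0 < δ) (hR : 0 ≤ R) :
    ∫⁻ x in Set.Ioc 0 R, ENNReal.ofReal (C / (x + δ)) =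
      ENNReal.ofReal (C * Real.log (1 + R / δ)) := by
  have hc : ContinuousOn (fun x : ℝ => C / (x + δ)) (Set.Icc 0 R) := by
    refine continuousOn_const.div (by fun_prop) fun x hx => ?_
    have := hx.1
    positivity
  rw [← ofReal_integral_eq_lintegral_ofReal, ← intervalIntegral.integral_of_le hR]
  · congr 1
    simp only [div_eq_mul_one_div C]
    rw [intervalIntegral.integral_const_mul,
      intervalIntegral.integral_comp_add_right (fun x => 1 / x),
      integral_one_div_of_pos (by linarith) (by linarith)]
    congr 2
    field_simp
    ring
  · exact (hc.integrableOn_Icc).mono_set Set.Ioc_subset_Icc_self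
  · refine (ae_restrict_iff' measurableSet_Ioc).2 (Eventually.of_forall fun x hx => ?_)
    have := hx.1
    exact div_nonneg hC (by positivity)

/-- The half `x < y` suffices by symmetry. There the integral in `y` is at most `C/(x + δ)`, and
integrating this in `x` leaves a single logarithm. -/
theorem exists_double_lintegral_log_le {p : ℝ} (hp : 1 < p) :
    ∃ C : ℝ, 0 < C ∧ ∀ δ R : ℝ, 0 < δ → 0 ≤ R →
      ∫⁻ x in Set.Ioc 0 R, ∫⁻ y in Set.Ioc 0 R,
        ENNReal.ofReal (|Real.log ((y + δ) / (x + δ))| ^ p / |x - y| ^ (1 + (1 : ℝ))) ≤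
      ENNReal.ofReal (C * Real.log (1 + R / δ)) := by
  obtain ⟨C, hC, hCb⟩ := exists_lintegral_log_kernel_le hp
  have hp0 : 0 < p := by linarith
  refine ⟨2 * C, by positivity, fun δ R hδ hR => ?_⟩
  have hm := measurable_logKernel δ p
  have hm2 : Measurable fun z : ℝ × ℝ => logKernel δ p z.2 z.1 := hm.comp measurable_swap
  have hpt : ∀ x ∈ Set.Ioc 0 R, ∀ y ∈ Set.Ioc 0 R,
      ENNReal.ofReal (|Real.log ((y + δ) / (x + δ))| ^ p / |x - y| ^ (1 + (1 : ℝ))) ≤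
        logKernel δ p x y + logKernel δ p y x := by
    intro x hx y hy
    have hx' : 0 < x + δ := by linarith [hx.1]
    have hy' : 0 < y + δ := by linarith [hy.1]
    unfold logKernel
    rcases lt_trichotomy x y with h | h | h
    · rw [if_pos h, if_neg (not_lt.2 h.le), add_zero,
        abs_of_nonneg (Real.log_nonneg ((one_le_div hx').2 (by linarith))), abs_sub_comm,
        abs_of_pos (sub_pos.2 h)]
    · subst h
      rw [div_self hx'.ne', Real.log_one, abs_zero, Real.zero_rpow hp0.ne', zero_div,
        ENNReal.ofReal_zero]
      exact zero_le
    · rw [if_neg (not_lt.2 h.le), if_pos h, zero_add, ← abs_neg, ← Real.log_inv, inv_div,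
        abs_of_nonneg (Real.log_nonneg ((one_le_div hy').2 (by linarith))),
        abs_of_pos (sub_pos.2 h)]
  have hone : ∫⁻ x in Set.Ioc 0 R, ∫⁻ y in Set.Ioc 0 R, logKernel δ p x y ≤
      ENNReal.ofReal (C * Real.log (1 + R / δ)) := by
    rw [← lintegral_const_div_add hC.le hδ hR]
    refine setLIntegral_mono' measurableSet_Ioc fun x hx => ?_
    have hx' : 0 < x + δ := by linarith [hx.1]
    refine (setLIntegral_le_lintegral _ _).trans ?_
    rw [lintegral_logKernel hx']
    exact hCb _ hx'
  calc _ ≤ ∫⁻ x in Set.Ioc 0 R, ∫⁻ y in Set.Ioc 0 R, (logKernel δ p x y + logKernel δ p y x) :=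
        setLIntegral_mono' measurableSet_Ioc fun x hx =>
          setLIntegral_mono' measurableSet_Ioc fun y hy => hpt x hx y hy
    _ = (∫⁻ x in Set.Ioc 0 R, ∫⁻ y in Set.Ioc 0 R, logKernel δ p x y) +
        ∫⁻ x in Set.Ioc 0 R, ∫⁻ y in Set.Ioc 0 R, logKernel δ p y x := by
        rw [← lintegral_add_left (Measurable.lintegral_prod_right hm)]
        refine lintegral_congr fun x => ?_
        exact lintegral_add_left (hm.comp measurable_prodMk_left) _
    _ = 2 * ∫⁻ x in Set.Ioc 0 R, ∫⁻ y in Set.Ioc 0 R, logKernel δ p x y := by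
        rw [two_mul]
        congr 1
        exact lintegral_lintegral_swap hm2.aemeasurable
    _ ≤ 2 * ENNReal.ofReal (C * Real.log (1 + R / δ)) := by gcongr
    _ = _ := by
        rw [← ENNReal.ofReal_ofNat 2, ← ENNReal.ofReal_mul (by norm_num), mul_assoc]

/-- Reflecting one point to the side of the other does not lengthen the arc between them; this
allows the energy of an even profile to be folded onto `[0, π]`. -/
theorem mul_abs_sub_abs_le_norm_circle_exp_sub {x y : ℝ} (hx : |x| ≤ Real.pi)
    (hy : |y| ≤ Real.pi) :
    2 / Real.pi * |(|x| - |y|)| ≤ ‖(Circle.exp x : ℂ) - (Circle.exp y : ℂ)‖ := by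
  have hπ := Real.pi_pos
  have hc : 0 ≤ 2 / Real.pi := by positivity
  rcases le_total |x - y| Real.pi with h | h
  · exact (mul_le_mul_of_nonneg_left (abs_abs_sub_abs_le x y) hc).trans
      (mul_abs_le_norm_circle_exp_sub h)
  · have key : ∀ x y : ℝ, |x| ≤ Real.pi → |y| ≤ Real.pi → Real.pi ≤ y - x →
        2 / Real.pi * |(|x| - |y|)| ≤ ‖(Circle.exp x : ℂ) - (Circle.exp y : ℂ)‖ := by
      intro x y hx hy h
      obtain ⟨hx1, hx2⟩ := abs_le.1 hx
      obtain ⟨hy1, hy2⟩ := abs_le.1 hy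
      have e : |x + 2 * Real.pi - y| = x + 2 * Real.pi - y := abs_of_nonneg (by linarith)
      have h1 := mul_abs_le_norm_circle_exp_sub (x := x + 2 * Real.pi) (y := y)
        (by rw [e]; linarith)
      rw [Circle.exp_add_two_pi] at h1
      refine (mul_le_mul_of_nonneg_left ?_ hc).trans h1
      rw [e, abs_of_nonpos (show x ≤ 0 by linarith), abs_of_nonneg (show 0 ≤ y by linarith)]
      exact abs_le.2 ⟨by linarith, by linarith⟩
    rcases abs_cases (x - y) with ⟨h1, _⟩ | ⟨h1, _⟩
    · rw [norm_sub_rev, abs_sub_comm]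
      exact key y x hy hx (by linarith)
    · exact key x y hx hy (by linarith)

/-- An even profile with logarithmic modulus of continuity has small critical energy. -/
theorem exists_gagliardo_rpow_le_of_log {p : ℝ} (hp : 1 < p) :
    ∃ C : ℝ, 0 < C ∧ ∀ (H : Circle → ℂ) (c δ : ℝ), 0 ≤ c → 0 < δ →
      (∀ x y : ℝ, |x| ≤ Real.pi → |y| ≤ Real.pi → ‖H (Circle.exp x) - H (Circle.exp y)‖ ≤
        c * |Real.log ((|y| + δ) / (|x| + δ))|) →
      gagliardo (1 / p) p H ^ p ≤ ENNReal.ofReal (C * (c ^ p * Real.log (1 + Real.pi / δ))) := by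
  obtain ⟨C, hC, hCb⟩ := exists_double_lintegral_log_le hp
  have hp0 : 0 < p := by linarith
  have hπ := Real.pi_pos
  refine ⟨4 * (Real.pi / 2) ^ (1 + (1 : ℝ)) * C, by positivity, fun H c δ hc hδ hH => ?_⟩
  set B : ℝ := (Real.pi / 2) ^ (1 + (1 : ℝ)) * c ^ p with hB
  have hB0 : 0 ≤ B := by positivity
  set Φ : ℝ → ℝ → ℝ≥0∞ := fun x y => ENNReal.ofReal
    (|Real.log ((y + δ) / (x + δ))| ^ p / |x - y| ^ (1 + (1 : ℝ))) with hΦ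
  have hpt : ∀ x y : ℝ, |x| ≤ Real.pi → |y| ≤ Real.pi →
      ‖H (Circle.exp x) - H (Circle.exp y)‖ₑ ^ p /
        ‖(Circle.exp x : ℂ) - (Circle.exp y : ℂ)‖ₑ ^ (1 + 1 / p * p) ≤
      ENNReal.ofReal B * Φ |x| |y| := by
    intro x y hx hy
    have h1 := hH x y hx hy
    have h2 := mul_abs_sub_abs_le_norm_circle_exp_sub hx hy
    rcases (abs_nonneg (|x| - |y|)).eq_or_lt with h0 | h0
    · have hxy : |x| = |y| := by rw [← sub_eq_zero, ← abs_eq_zero]; exact h0.symm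
      have hx0 : |x| + δ ≠ 0 := by positivity
      rw [← hxy, div_self hx0, Real.log_one, abs_zero, mul_zero] at h1
      have h3 : ‖H (Circle.exp x) - H (Circle.exp y)‖ₑ = 0 := by
        rw [← ofReal_norm]; exact ENNReal.ofReal_eq_zero.2 h1
      rw [h3, ENNReal.zero_rpow_of_pos hp0, ENNReal.zero_div]
      exact zero_le
    · rw [one_div_mul_cancel hp0.ne', ← ofReal_norm, ← ofReal_norm,
        ENNReal.ofReal_rpow_of_nonneg (norm_nonneg _) hp0.le,
        ENNReal.ofReal_rpow_of_nonneg (norm_nonneg _) (by norm_num), hΦ,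
        ← ENNReal.ofReal_mul hB0]
      have h4 : 0 < ‖(Circle.exp x : ℂ) - (Circle.exp y : ℂ)‖ := lt_of_lt_of_le (by positivity) h2
      rw [← ENNReal.ofReal_div_of_pos (by positivity)]
      refine ENNReal.ofReal_le_ofReal ?_
      calc _ ≤ (c * |Real.log ((|y| + δ) / (|x| + δ))|) ^ p /
            (2 / Real.pi * |(|x| - |y|)|) ^ (1 + (1 : ℝ)) := by gcongr
        _ = _ := by
            rw [Real.mul_rpow hc (abs_nonneg _), Real.mul_rpow (by positivity) (abs_nonneg _),
              ← inv_div Real.pi 2, Real.inv_rpow (by positivity), hB]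
            field_simp
  -- Folding costs a factor 2 for each variable, hence the 4 in the constant.
  have habs : ∀ Ψ : ℝ → ℝ≥0∞, ∫⁻ x in Set.Ioc (-Real.pi) (-Real.pi + 2 * Real.pi), Ψ |x| ≤
      2 * ∫⁻ x in Set.Ioc 0 Real.pi, Ψ x := by
    intro Ψ
    calc _ ≤ ∫⁻ x : ℝ, (Set.Iic Real.pi).indicator Ψ |x| := by
          rw [← lintegral_indicator measurableSet_Ioc]
          refine lintegral_mono fun x => ?_
          by_cases hx : x ∈ Set.Ioc (-Real.pi) (-Real.pi + 2 * Real.pi)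
          · rw [Set.indicator_of_mem hx, Set.indicator_of_mem]
            exact Set.mem_Iic.2 (abs_le.2 ⟨hx.1.le, by linarith [hx.2]⟩)
          · rw [Set.indicator_of_notMem hx]
            exact bot_le
      _ = _ := by
          rw [lintegral_comp_abs', lintegral_indicator measurableSet_Iic,
            Measure.restrict_restrict measurableSet_Iic, Set.Iic_inter_Ioi]
  have hmem : ∀ x ∈ Set.Ioc (-Real.pi) (-Real.pi + 2 * Real.pi), |x| ≤ Real.pi := fun x hx =>
    abs_le.2 ⟨hx.1.le, by linarith [hx.2]⟩
  rw [gagliardo_rpow hp0, lintegral_arcLength (-Real.pi)]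
  calc _ ≤ ∫⁻ x in Set.Ioc (-Real.pi) (-Real.pi + 2 * Real.pi),
        2 * ∫⁻ y in Set.Ioc 0 Real.pi, ENNReal.ofReal B * Φ |x| y := by
        refine setLIntegral_mono' measurableSet_Ioc fun x hx => ?_
        rw [lintegral_arcLength (-Real.pi)]
        exact (setLIntegral_mono' measurableSet_Ioc fun y hy =>
          hpt x y (hmem x hx) (hmem y hy)).trans (habs fun y => ENNReal.ofReal B * Φ |x| y)
    _ ≤ 2 * ∫⁻ x in Set.Ioc 0 Real.pi, 2 * ∫⁻ y in Set.Ioc 0 Real.pi, ENNReal.ofReal B * Φ x y :=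
        habs fun x => 2 * ∫⁻ y in Set.Ioc 0 Real.pi, ENNReal.ofReal B * Φ x y
    _ = 4 * ENNReal.ofReal B * ∫⁻ x in Set.Ioc 0 Real.pi, ∫⁻ y in Set.Ioc 0 Real.pi, Φ x y := by
        simp only [lintegral_const_mul' _ _ ENNReal.ofReal_ne_top,
          lintegral_const_mul' _ _ ENNReal.ofNat_ne_top]
        rw [← mul_assoc, ← mul_assoc]
        norm_num
    _ ≤ 4 * ENNReal.ofReal B * ENNReal.ofReal (C * Real.log (1 + Real.pi / δ)) := by
        gcongr
        exact hCb δ Real.pi hδ hπ.le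
    _ = _ := by
        rw [← ENNReal.ofReal_ofNat 4, ← ENNReal.ofReal_mul (by norm_num),
          ← ENNReal.ofReal_mul (by positivity), hB]
        congr 1
        ring

end LogKernel

/-! ### Composition with powers and multiplication by powers. -/

section Transport

theorem measurable_gagliardo_kernel {H : Circle → ℂ} (hH : Measurable H) (p e : ℝ) :
    Measurable fun q : Circle × Circle =>
      ‖H q.1 - H q.2‖ₑ ^ p / ‖(q.1 : ℂ) - (q.2 : ℂ)‖ₑ ^ e := by
  have hcc : Continuous fun z : Circle => (z : ℂ) := by fun_prop
  have hc : Measurable fun z : Circle => (z : ℂ) := hcc.measurable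
  have h1 : Measurable fun q : Circle × Circle => ‖H q.1 - H q.2‖ₑ ^ p :=
    (((hH.comp measurable_fst).sub (hH.comp measurable_snd)).enorm).pow_const p
  have h2 : Measurable fun q : Circle × Circle => ‖(q.1 : ℂ) - (q.2 : ℂ)‖ₑ ^ e :=
    (((hc.comp measurable_fst).sub (hc.comp measurable_snd)).enorm).pow_const e
  exact h1.div h2

theorem enorm_zpow_sub_zpow_le (z w : Circle) (k : ℤ) :
    ‖((z ^ k : Circle) : ℂ) - ((w ^ k : Circle) : ℂ)‖ₑ ≤
      ENNReal.ofReal |(k : ℝ)| * ‖(z : ℂ) - (w : ℂ)‖ₑ := by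
  rw [← ofReal_norm, ← ofReal_norm, ← ENNReal.ofReal_mul (abs_nonneg _)]
  exact ENNReal.ofReal_le_ofReal (norm_zpow_sub_zpow_le z w k)

/-- The power map stretches chords by at most `|n|`, which costs `|n|^(1 + σp)` in the kernel, and
it preserves arc length. -/
theorem gagliardo_rpow_comp_zpow_le {σ p : ℝ} (hσ : 0 < σ) (hp : 0 < p) {H : Circle → ℂ}
    (hH : Measurable H) {n : ℤ} (hn : n ≠ 0) :
    gagliardo σ p (fun z => H (z ^ n)) ^ p ≤
      ENNReal.ofReal |(n : ℝ)| ^ (1 + σ * p) * gagliardo σ p H ^ p := by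
  set e : ℝ := 1 + σ * p with he
  have he0 : 0 ≤ e := by positivity
  set Λ : ℝ≥0∞ := ENNReal.ofReal |(n : ℝ)| ^ e with hΛ
  have hn0 : 0 < |(n : ℝ)| := abs_pos.2 (Int.cast_ne_zero.2 hn)
  have hΛ0 : Λ ≠ 0 := by
    rw [hΛ, ENNReal.ofReal_rpow_of_pos hn0]
    exact (ENNReal.ofReal_pos.2 (by positivity)).ne'
  have hΛt : Λ ≠ ⊤ := ENNReal.rpow_ne_top_of_nonneg he0 ENNReal.ofReal_ne_top
  set Φ : Circle → Circle → ℝ≥0∞ := fun x y =>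
    ‖H x - H y‖ₑ ^ p / ‖(x : ℂ) - (y : ℂ)‖ₑ ^ e with hΦ
  have hm : Measurable (Function.uncurry Φ) := measurable_gagliardo_kernel hH p e
  have hpt : ∀ x y : Circle, ‖H (x ^ n) - H (y ^ n)‖ₑ ^ p / ‖(x : ℂ) - (y : ℂ)‖ₑ ^ e ≤
      Λ * Φ (x ^ n) (y ^ n) := by
    intro x y
    have h1 : ‖((x ^ n : Circle) : ℂ) - ((y ^ n : Circle) : ℂ)‖ₑ ^ e ≤
        Λ * ‖(x : ℂ) - (y : ℂ)‖ₑ ^ e := by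
      rw [hΛ, ← ENNReal.mul_rpow_of_nonneg _ _ he0]
      exact ENNReal.rpow_le_rpow (enorm_zpow_sub_zpow_le x y n) he0
    have h2 := ENNReal.inv_le_inv.2 h1
    rw [ENNReal.mul_inv (Or.inl hΛ0) (Or.inl hΛt)] at h2
    simp only [hΦ, div_eq_mul_inv]
    calc _ = Λ * (‖H (x ^ n) - H (y ^ n)‖ₑ ^ p * (Λ⁻¹ * (‖(x : ℂ) - (y : ℂ)‖ₑ ^ e)⁻¹)) := by
          rw [mul_left_comm _ Λ⁻¹, ← mul_assoc Λ, ENNReal.mul_inv_cancel hΛ0 hΛt, one_mul]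
      _ ≤ _ := by gcongr
  have hmp := measurePreserving_zpow_arcLength hn
  rw [gagliardo_rpow hp, gagliardo_rpow hp]
  calc _ ≤ ∫⁻ x, ∫⁻ y, Λ * Φ (x ^ n) (y ^ n) ∂arcLength ∂arcLength :=
        lintegral_mono fun x => lintegral_mono fun y => hpt x y
    _ = ∫⁻ x, Λ * ∫⁻ y, Φ (x ^ n) y ∂arcLength ∂arcLength := by
        refine lintegral_congr fun x => ?_
        rw [lintegral_const_mul' _ _ hΛt,
          hmp.lintegral_comp (f := Φ (x ^ n)) (hm.of_uncurry_left (x := x ^ n))]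
    _ = _ := by
        rw [lintegral_const_mul' _ _ hΛt,
          hmp.lintegral_comp (f := fun x => ∫⁻ y, Φ x y ∂arcLength) hm.lintegral_prod_right]

/-- Multiplication by a power of the variable, in terms of the energy and of the `Lᵖ` norm. -/
theorem exists_gagliardo_rpow_zpow_mul_le {σ p : ℝ} (hσ : 0 < σ) (hσ1 : σ < 1) (hp : 1 ≤ p) (k : ℤ) :
    ∃ Q : ℝ≥0∞, Q ≠ ⊤ ∧ ∀ H : Circle → ℂ, Measurable H →
      gagliardo σ p (fun z => ((z ^ k : Circle) : ℂ) * H z) ^ p ≤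
        Q * (gagliardo σ p H ^ p + ∫⁻ z, ‖H z‖ₑ ^ p ∂arcLength) := by
  have hp0 : 0 < p := by linarith
  have hπ := Real.pi_pos
  -- Bounds, uniformly in `x`, the energy density at `x` of the Lipschitz factor `z ^ k`. With scale
  -- `X = π` and `D = π` the truncated linear bound is just the angle.
  set κ : ℝ≥0∞ := ENNReal.ofReal |(k : ℝ)| ^ p *
    ENNReal.ofReal (kernelConst σ p * (Real.pi * Real.pi ^ (-σ)) ^ p) with hκ
  have hκt : κ ≠ ⊤ := ENNReal.mul_ne_top
    (ENNReal.rpow_ne_top_of_nonneg hp0.le ENNReal.ofReal_ne_top) ENNReal.ofReal_ne_top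
  have h2t : (2 : ℝ≥0∞) ^ (p - 1) ≠ ⊤ :=
    ENNReal.rpow_ne_top_of_nonneg (by linarith) ENNReal.ofNat_ne_top
  refine ⟨2 ^ (p - 1) * (1 + κ), ENNReal.mul_ne_top h2t (by simp [hκt]), fun H hH => ?_⟩
  set e : ℝ := 1 + σ * p with he
  set Φ : Circle → Circle → ℝ≥0∞ := fun x y =>
    ‖H x - H y‖ₑ ^ p / ‖(x : ℂ) - (y : ℂ)‖ₑ ^ e with hΦ
  have hm : Measurable (Function.uncurry Φ) := measurable_gagliardo_kernel hH p e
  set Ψ : Circle → Circle → ℝ≥0∞ := fun x y =>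
    ‖H x‖ₑ ^ p * ((ENNReal.ofReal |(k : ℝ)| * ‖(x : ℂ) - (y : ℂ)‖ₑ) ^ p /
      ‖(x : ℂ) - (y : ℂ)‖ₑ ^ e) with hΨ
  have hpt : ∀ x y : Circle,
      ‖((x ^ k : Circle) : ℂ) * H x - ((y ^ k : Circle) : ℂ) * H y‖ₑ ^ p /
        ‖(x : ℂ) - (y : ℂ)‖ₑ ^ e ≤ 2 ^ (p - 1) * (Φ x y + Ψ x y) := by
    intro x y
    have e1 : ((x ^ k : Circle) : ℂ) * H x - ((y ^ k : Circle) : ℂ) * H y =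
        ((y ^ k : Circle) : ℂ) * (H x - H y) +
          (((x ^ k : Circle) : ℂ) - ((y ^ k : Circle) : ℂ)) * H x := by ring
    have h1 : ‖((x ^ k : Circle) : ℂ) * H x - ((y ^ k : Circle) : ℂ) * H y‖ₑ ≤
        ‖H x - H y‖ₑ + ‖H x‖ₑ * (ENNReal.ofReal |(k : ℝ)| * ‖(x : ℂ) - (y : ℂ)‖ₑ) := by
      rw [e1]
      refine (enorm_add_le _ _).trans ?_
      rw [enorm_mul, enorm_mul, mul_comm _ ‖H x‖ₑ]
      have h0 : ‖((y ^ k : Circle) : ℂ)‖ₑ = 1 := by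
        rw [← ofReal_norm, Circle.norm_coe, ENNReal.ofReal_one]
      rw [h0, one_mul]
      gcongr
      exact enorm_zpow_sub_zpow_le x y k
    have h2 := (ENNReal.rpow_le_rpow h1 hp0.le).trans (ENNReal.rpow_add_le_mul_rpow_add_rpow _ _ hp)
    refine (ENNReal.div_le_div_right h2 _).trans_eq ?_
    rw [ENNReal.mul_rpow_of_nonneg ‖H x‖ₑ _ hp0.le]
    simp only [hΦ, hΨ, div_eq_mul_inv]
    ring
  have hin : ∀ x : Circle, ∫⁻ y, Ψ x y ∂arcLength ≤ ‖H x‖ₑ ^ p * κ := by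
    intro x
    have hxt : ‖H x‖ₑ ^ p ≠ ⊤ := ENNReal.rpow_ne_top_of_nonneg hp0.le enorm_ne_top
    have hkt : ENNReal.ofReal |(k : ℝ)| ^ p ≠ ⊤ :=
      ENNReal.rpow_ne_top_of_nonneg hp0.le ENNReal.ofReal_ne_top
    simp only [hΨ]
    rw [lintegral_const_mul' _ _ hxt]
    gcongr
    simp only [ENNReal.mul_rpow_of_nonneg _ _ hp0.le, mul_div_assoc]
    rw [lintegral_const_mul' _ _ hkt, hκ]
    gcongr
    rw [← Circle.exp_arg x]
    refine lintegral_circle_kernel_le hσ hσ1 hp0 hπ.le hπ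
      (N := fun y => ‖(Circle.exp (Complex.arg x) : ℂ) - (y : ℂ)‖ₑ) fun t ht => ?_
    rw [min_eq_left ((div_le_one hπ).2 ht), mul_div_cancel₀ _ hπ.ne', ← Real.enorm_eq_ofReal_abs]
    exact enorm_circle_exp_sub_le _ _
  rw [gagliardo_rpow hp0, gagliardo_rpow hp0]
  calc _ ≤ ∫⁻ x, ∫⁻ y, 2 ^ (p - 1) * (Φ x y + Ψ x y) ∂arcLength ∂arcLength :=
        lintegral_mono fun x => lintegral_mono fun y => hpt x y
    _ ≤ ∫⁻ x, 2 ^ (p - 1) * ((∫⁻ y, Φ x y ∂arcLength) + ‖H x‖ₑ ^ p * κ) ∂arcLength := by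
        refine lintegral_mono fun x => ?_
        simp only
        rw [lintegral_const_mul' _ _ h2t,
          lintegral_add_left (hm.of_uncurry_left (x := x))]
        gcongr
        exact hin x
    _ = 2 ^ (p - 1) * ((∫⁻ x, ∫⁻ y, Φ x y ∂arcLength ∂arcLength) +
          (∫⁻ x, ‖H x‖ₑ ^ p ∂arcLength) * κ) := by
        rw [lintegral_const_mul' _ _ h2t, lintegral_add_left hm.lintegral_prod_right,
          lintegral_mul_const' _ _ hκt]
    _ ≤ _ := by
        rw [mul_assoc]
        refine mul_le_mul_right ?_ _
        rw [mul_comm _ κ, add_mul, one_mul, mul_add]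
        calc _ ≤ (∫⁻ x, ∫⁻ y, Φ x y ∂arcLength ∂arcLength) +
              (∫⁻ x, ‖H x‖ₑ ^ p ∂arcLength) + (κ * (∫⁻ x, ∫⁻ y, Φ x y ∂arcLength ∂arcLength) +
              κ * ∫⁻ x, ‖H x‖ₑ ^ p ∂arcLength) :=
            add_le_add le_self_add le_add_self

/-- A map vanishing on a large arc is controlled in `Lᵖ` by its energy. -/
theorem lintegral_rpow_le_gagliardo {σ p : ℝ} (hσ : 0 < σ) (hp : 0 < p) {H : Circle → ℂ}
    (hH : ∀ x, 1 ≤ |x| → |x| ≤ Real.pi → H (Circle.exp x) = 0) :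
    ∫⁻ z, ‖H z‖ₑ ^ p ∂arcLength ≤ 2 ^ (1 + σ * p) * gagliardo σ p H ^ p := by
  set e : ℝ := 1 + σ * p with he
  have he0 : 0 ≤ e := by positivity
  have hπ := Real.pi_gt_three
  have h20 : (2 : ℝ≥0∞) ^ e ≠ 0 := by simp
  have h2t : (2 : ℝ≥0∞) ^ e ≠ ⊤ := ENNReal.rpow_ne_top_of_nonneg he0 ENNReal.ofNat_ne_top
  rw [gagliardo_rpow hp, ← lintegral_const_mul' _ _ h2t]
  refine lintegral_mono fun z => ?_
  rw [lintegral_arcLength (-Real.pi)]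
  have h1 : ‖H z‖ₑ ^ p / 2 ^ e ≤ ∫⁻ t in Set.Ioc (-Real.pi) (-Real.pi + 2 * Real.pi),
      ‖H z - H (Circle.exp t)‖ₑ ^ p / ‖(z : ℂ) - (Circle.exp t : ℂ)‖ₑ ^ e := by
    -- Restrict the inner integral to the arc `(1, π]`, longer than 1, where `H` vanishes; chords
    -- are at most 2.
    calc ‖H z‖ₑ ^ p / 2 ^ e ≤ ‖H z‖ₑ ^ p / 2 ^ e * volume (Set.Ioc 1 Real.pi) := by
          refine le_mul_of_one_le_right' ?_
          rw [Real.volume_Ioc]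
          exact ENNReal.one_le_ofReal.2 (by linarith)
      _ = ∫⁻ _t in Set.Ioc 1 Real.pi, ‖H z‖ₑ ^ p / 2 ^ e := by rw [setLIntegral_const]
      _ ≤ ∫⁻ t in Set.Ioc 1 Real.pi,
          ‖H z - H (Circle.exp t)‖ₑ ^ p / ‖(z : ℂ) - (Circle.exp t : ℂ)‖ₑ ^ e := by
          refine setLIntegral_mono' measurableSet_Ioc fun t ht => ?_
          have ht0 : |t| = t := abs_of_pos (by linarith [ht.1])
          rw [hH t (by rw [ht0]; exact ht.1.le) (by rw [ht0]; exact ht.2), sub_zero]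
          gcongr
          rw [← ofReal_norm, ← ENNReal.ofReal_ofNat 2]
          exact ENNReal.ofReal_le_ofReal (norm_coe_sub_coe_le _ _)
      _ ≤ _ := lintegral_mono_set (Set.Ioc_subset_Ioc (by linarith) (by linarith))
  calc ‖H z‖ₑ ^ p = 2 ^ e * (‖H z‖ₑ ^ p / 2 ^ e) := (ENNReal.mul_div_cancel h20 h2t).symm
    _ ≤ _ := by gcongr

end Transport

/-! ### The logarithmic bubble between degrees one and zero. -/

section Bubble

theorem circleMapOfPhase_exp_of_abs_le {φ : ℝ → ℝ} {d : ℤ}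
    (hφ : φ Real.pi = φ (-Real.pi) + 2 * Real.pi * d) {x : ℝ} (hx : |x| ≤ Real.pi) :
    circleMapOfPhase φ (Circle.exp x) = Circle.exp (φ x) := by
  obtain ⟨h1, h2⟩ := abs_le.1 hx
  unfold circleMapOfPhase
  rcases h1.eq_or_lt with h | h
  -- At `x = -π` the argument is `π`, not `-π`; the condition on the end values absorbs the
  -- difference.
  · rw [← h, ← Circle.exp_add_two_pi (-Real.pi), show -Real.pi + 2 * Real.pi = Real.pi by ring,
      Circle.arg_exp (by linarith [Real.pi_pos]) le_rfl, hφ, Circle.exp_add,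
      Circle.exp_two_pi_mul_int, mul_one]
  · rw [Circle.arg_exp h h2]

/-- Two phases symmetric about `b` differ by a quantity even in `t`. An odd `t` can thus change the
degree while the difference of the maps stays even. -/
theorem coe_circle_exp_sub_coe_circle_exp (b t : ℝ) :
    (Circle.exp (b + (Real.pi / 2 + t)) : ℂ) - (Circle.exp (b - (Real.pi / 2 + t)) : ℂ) =
      (Circle.exp b : ℂ) * (2 * Complex.I * (Real.cos t : ℂ)) := by
  rw [sub_eq_add_neg b, Circle.exp_add b, Circle.exp_add b, Circle.coe_mul, Circle.coe_mul, ← mul_sub]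
  congr 1
  have h1 : (Real.sin (Real.pi / 2 + t) : ℂ) = (Real.cos t : ℂ) := by
    rw [Real.sin_add, Real.sin_pi_div_two, Real.cos_pi_div_two]; simp
  rw [Circle.coe_exp, Circle.coe_exp, Complex.exp_mul_I, Complex.exp_mul_I,
    ← Complex.ofReal_cos, ← Complex.ofReal_sin, ← Complex.ofReal_cos, ← Complex.ofReal_sin,
    Real.cos_neg, Real.sin_neg, Complex.ofReal_neg, h1]
  ring

theorem abs_log_one_add_div_sub_le {δ r r' : ℝ} (hδ : 0 < δ) (hr : 0 ≤ r) (hr' : 0 ≤ r') :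
    |Real.log (1 + r / δ) - Real.log (1 + r' / δ)| ≤ 1 / δ * |r - r'| := by
  have key : ∀ r r' : ℝ, 0 ≤ r' → r' ≤ r →
      |Real.log (1 + r / δ) - Real.log (1 + r' / δ)| ≤ 1 / δ * |r - r'| := by
    intro r r' hr' h
    have hr : 0 ≤ r := hr'.trans h
    have h1 : 0 < 1 + r / δ := by positivity
    have h2 : 0 < 1 + r' / δ := by positivity
    have h3 : r' / δ ≤ r / δ := by gcongr
    rw [← Real.log_div h1.ne' h2.ne', abs_of_nonneg (sub_nonneg.2 h),
      abs_of_nonneg (Real.log_nonneg ((one_le_div h2).2 (by linarith)))]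
    refine (Real.log_le_sub_one_of_pos (by positivity)).trans ?_
    rw [div_sub_one h2.ne', div_le_iff₀ h2]
    have h4 : 0 ≤ 1 / δ * (r - r') * (r' / δ) := by
      have := sub_nonneg.2 h
      positivity
    have h5 : 1 + r / δ - (1 + r' / δ) = 1 / δ * (r - r') := by ring
    linarith
  rcases le_total r' r with h | h
  · exact key r r' hr' h
  · rw [abs_sub_comm, abs_sub_comm r]
    exact key r' r hr h

/-- The logarithmic profile, truncated at a quarter turn. -/
noncomputable def logProfile (c δ r : ℝ) : ℝ :=
  min (Real.pi / 2) (c * Real.log (1 + r / δ))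

theorem logProfile_zero (c δ : ℝ) : logProfile c δ 0 = 0 := by
  have := Real.pi_pos.le
  simp only [logProfile, zero_div, add_zero, Real.log_one, mul_zero]
  exact min_eq_right (by positivity)

theorem logProfile_of_one_le {c δ r : ℝ} (hc : 0 ≤ c) (hδ : 0 < δ)
    (h : c * Real.log (1 + 1 / δ) = Real.pi / 2) (hr : 1 ≤ r) : logProfile c δ r = Real.pi / 2 := by
  refine min_eq_left ?_
  rw [← h]
  gcongr

theorem abs_logProfile_sub_le_log {c δ : ℝ} (hc : 0 ≤ c) (r r' : ℝ) :
    |logProfile c δ r - logProfile c δ r'| ≤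
      c * |Real.log (1 + r / δ) - Real.log (1 + r' / δ)| := by
  unfold logProfile
  refine (abs_min_sub_min_le_max _ _ _ _).trans ?_
  rw [sub_self, abs_zero, max_eq_right (abs_nonneg _), ← mul_sub, abs_mul, abs_of_nonneg hc]

theorem abs_logProfile_sub_le {c δ r r' : ℝ} (hc : 0 ≤ c) (hδ : 0 < δ) (hr : 0 ≤ r)
    (hr' : 0 ≤ r') : |logProfile c δ r - logProfile c δ r'| ≤ c / δ * |r - r'| := by
  refine (abs_logProfile_sub_le_log hc r r').trans ?_
  have := mul_le_mul_of_nonneg_left (abs_log_one_add_div_sub_le hδ hr hr') hc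
  calc _ ≤ _ := this
    _ = _ := by ring

/-- The odd extension of the logarithmic profile. -/
noncomputable def oddLogProfile (c δ x : ℝ) : ℝ :=
  logProfile c δ (max x 0) - logProfile c δ (max (-x) 0)

theorem oddLogProfile_of_nonneg {c δ x : ℝ} (hx : 0 ≤ x) :
    oddLogProfile c δ x = logProfile c δ |x| := by
  rw [oddLogProfile, max_eq_left hx, max_eq_right (by linarith), logProfile_zero, sub_zero,
    abs_of_nonneg hx]

theorem oddLogProfile_of_nonpos {c δ x : ℝ} (hx : x ≤ 0) :
    oddLogProfile c δ x = -logProfile c δ |x| := by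
  rw [oddLogProfile, max_eq_right hx, max_eq_left (by linarith), logProfile_zero, zero_sub,
    abs_of_nonpos hx]

theorem cos_oddLogProfile (c δ x : ℝ) :
    Real.cos (oddLogProfile c δ x) = Real.cos (logProfile c δ |x|) := by
  rcases le_total 0 x with h | h
  · rw [oddLogProfile_of_nonneg h]
  · rw [oddLogProfile_of_nonpos h, Real.cos_neg]

theorem abs_oddLogProfile_sub_le {c δ : ℝ} (hc : 0 ≤ c) (hδ : 0 < δ) (x y : ℝ) :
    |oddLogProfile c δ x - oddLogProfile c δ y| ≤ 2 * (c / δ) * |x - y| := by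
  have hcδ : 0 ≤ c / δ := by positivity
  have hmax : ∀ a b : ℝ, |max a 0 - max b 0| ≤ |a - b| := fun a b =>
    abs_max_sub_max_le_abs a b 0
  have h1 := (abs_logProfile_sub_le hc hδ (le_max_right x 0) (le_max_right y 0)).trans
    (mul_le_mul_of_nonneg_left (hmax x y) hcδ)
  have h2 := (abs_logProfile_sub_le hc hδ (le_max_right (-x) 0) (le_max_right (-y) 0)).trans
    (mul_le_mul_of_nonneg_left (hmax (-x) (-y)) hcδ)
  rw [show -x - -y = -(x - y) by ring, abs_neg] at h2
  unfold oddLogProfile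
  rw [sub_sub_sub_comm]
  refine (abs_sub _ _).trans ?_
  linarith

/-- The excess of `x` over the interval `[-π/2, π/2]`. -/
noncomputable def quarterExcess (x : ℝ) : ℝ :=
  x - max (-(Real.pi / 2)) (min (Real.pi / 2) x)

theorem quarterExcess_of_abs_le {x : ℝ} (hx : |x| ≤ Real.pi / 2) : quarterExcess x = 0 := by
  obtain ⟨h1, h2⟩ := abs_le.1 hx
  rw [quarterExcess, min_eq_right h2, max_eq_right h1, sub_self]

theorem abs_quarterExcess_sub_le (x y : ℝ) :
    |quarterExcess x - quarterExcess y| ≤ 2 * |x - y| := by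
  unfold quarterExcess
  rw [sub_sub_sub_comm]
  have h1 := abs_max_sub_max_le_max (-(Real.pi / 2)) (min (Real.pi / 2) x) (-(Real.pi / 2))
    (min (Real.pi / 2) y)
  have h2 := abs_min_sub_min_le_max (Real.pi / 2) x (Real.pi / 2) y
  rw [sub_self, abs_zero, max_eq_right (abs_nonneg (min (Real.pi / 2) x - min (Real.pi / 2) y))]
    at h1
  rw [sub_self, abs_zero, max_eq_right (abs_nonneg (x - y))] at h2
  have h3 := abs_sub (x - y) (max (-(Real.pi / 2)) (min (Real.pi / 2) x) -
    max (-(Real.pi / 2)) (min (Real.pi / 2) y))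
  linarith

theorem quarterExcess_pi : quarterExcess Real.pi = Real.pi / 2 := by
  have := Real.pi_pos
  rw [quarterExcess, min_eq_left (by linarith), max_eq_right (by linarith)]
  ring

theorem quarterExcess_neg_pi : quarterExcess (-Real.pi) = -(Real.pi / 2) := by
  have := Real.pi_pos
  rw [quarterExcess, min_eq_right (by linarith), max_eq_left (by linarith)]
  ring

/-- Two Lipschitz maps of degrees one and zero that differ by an even bubble of logarithmic type. -/
theorem exists_bubble {c : ℝ} (hc : 0 < c) :
    ∃ (δ K : ℝ) (φ₀ φ₁ : ℝ → ℝ), 0 < δ ∧ c * Real.log (1 + 1 / δ) = Real.pi / 2 ∧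
      (∀ x y, |φ₀ x - φ₀ y| ≤ K * |x - y|) ∧ (∀ x y, |φ₁ x - φ₁ y| ≤ K * |x - y|) ∧
      φ₀ Real.pi = φ₀ (-Real.pi) + 2 * Real.pi * (1 : ℤ) ∧
      φ₁ Real.pi = φ₁ (-Real.pi) + 2 * Real.pi * (0 : ℤ) ∧
      ∀ x, |x| ≤ Real.pi → (Circle.exp (φ₀ x) : ℂ) - (Circle.exp (φ₁ x) : ℂ) =
        2 * Complex.I * (Real.cos (logProfile c δ |x|) : ℂ) := by
  have hπ := Real.pi_gt_three
  have he : 1 < Real.exp (Real.pi / (2 * c)) := Real.one_lt_exp_iff.2 (by positivity)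
  -- Chosen so that the untruncated profile reaches `π/2` exactly at radius 1.
  set δ : ℝ := 1 / (Real.exp (Real.pi / (2 * c)) - 1) with hδ
  have hδ0 : 0 < δ := one_div_pos.2 (by linarith)
  have hlog : c * Real.log (1 + 1 / δ) = Real.pi / 2 := by
    rw [hδ, one_div_one_div, add_sub_cancel, Real.log_exp]
    field_simp
  have hpos : oddLogProfile c δ Real.pi = Real.pi / 2 := by
    rw [oddLogProfile_of_nonneg (by linarith), abs_of_pos (by linarith),
      logProfile_of_one_le hc.le hδ0 hlog (by linarith)]
  have hneg : oddLogProfile c δ (-Real.pi) = -(Real.pi / 2) := by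
    rw [oddLogProfile_of_nonpos (by linarith), abs_neg, abs_of_pos (by linarith),
      logProfile_of_one_le hc.le hδ0 hlog (by linarith)]
  -- From `-π` to `π` both `quarterExcess` and `oddLogProfile` gain `π`: the sum gains `2π`, the
  -- difference 0. The excess is nonzero only beyond `π/2 > 1`, where the cosine is already 0, so it
  -- does not enter the difference of the maps.
  refine ⟨δ, 2 + 2 * (c / δ), fun x => quarterExcess x + (Real.pi / 2 + oddLogProfile c δ x),
    fun x => quarterExcess x - (Real.pi / 2 + oddLogProfile c δ x), hδ0, hlog, fun x y => ?_,
    fun x y => ?_, ?_, ?_, fun x hx => ?_⟩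
  · have h1 := abs_quarterExcess_sub_le x y
    have h2 := abs_oddLogProfile_sub_le hc.le hδ0 x y
    have h3 := abs_add_le (quarterExcess x - quarterExcess y)
      (oddLogProfile c δ x - oddLogProfile c δ y)
    rw [show quarterExcess x + (Real.pi / 2 + oddLogProfile c δ x) -
      (quarterExcess y + (Real.pi / 2 + oddLogProfile c δ y)) = quarterExcess x - quarterExcess y +
      (oddLogProfile c δ x - oddLogProfile c δ y) by ring]
    linarith
  · have h1 := abs_quarterExcess_sub_le x y
    have h2 := abs_oddLogProfile_sub_le hc.le hδ0 x y
    have h3 := abs_sub (quarterExcess x - quarterExcess y)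
      (oddLogProfile c δ x - oddLogProfile c δ y)
    rw [show quarterExcess x - (Real.pi / 2 + oddLogProfile c δ x) -
      (quarterExcess y - (Real.pi / 2 + oddLogProfile c δ y)) = quarterExcess x - quarterExcess y -
      (oddLogProfile c δ x - oddLogProfile c δ y) by ring]
    linarith
  · simp only [quarterExcess_pi, quarterExcess_neg_pi, hpos, hneg, Int.cast_one]; ring
  · simp only [quarterExcess_pi, quarterExcess_neg_pi, hpos, hneg, Int.cast_zero]; ring
  · rw [coe_circle_exp_sub_coe_circle_exp, cos_oddLogProfile]
    rcases le_total |x| 1 with h | h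
    · rw [quarterExcess_of_abs_le (by linarith)]
      simp
    · rw [logProfile_of_one_le hc.le hδ0 hlog h, Real.cos_pi_div_two]
      simp

end Bubble

/-! ### Vanishing of the distance at `s = 1/p`. -/

section CriticalCase

theorem gagliardo_sub_const (σ p : ℝ) (v : Circle → ℂ) (m : ℂ) :
    gagliardo σ p (fun z => v z - m) = gagliardo σ p v := by
  simp only [gagliardo, sub_sub_sub_cancel_right]

theorem exists_eLpNorm_sub_average_le {p : ℝ} (hp : 1 ≤ p) :
    ∃ Q : ℝ≥0∞, Q ≠ ⊤ ∧ ∀ h : Circle → ℂ, Integrable h arcLength →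
      eLpNorm (fun z => h z - ⨍ w, h w ∂arcLength) (ENNReal.ofReal p) arcLength ≤
        Q * eLpNorm h (ENNReal.ofReal p) arcLength := by
  have hp1 : 1 ≤ ENNReal.ofReal p := ENNReal.one_le_ofReal.2 hp
  have hu : arcLength Set.univ ≠ ⊤ := measure_ne_top _ _
  have hinv : 0 ≤ 1 - (ENNReal.ofReal p).toReal⁻¹ := by
    rw [ENNReal.toReal_ofReal (by linarith), sub_nonneg]
    exact inv_le_one_of_one_le₀ hp
  set a : ℝ≥0∞ := ‖(arcLength.real Set.univ)⁻¹‖ₑ with ha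
  set b : ℝ≥0∞ := arcLength Set.univ ^ (1 - (ENNReal.ofReal p).toReal⁻¹) with hb
  set c : ℝ≥0∞ := arcLength Set.univ ^ (ENNReal.ofReal p).toReal⁻¹ with hc
  have hat : a ≠ ⊤ := enorm_ne_top
  have hbt : b ≠ ⊤ := ENNReal.rpow_ne_top_of_nonneg hinv hu
  have hct : c ≠ ⊤ := ENNReal.rpow_ne_top_of_nonneg (by positivity) hu
  refine ⟨1 + a * b * c, by simp [ENNReal.mul_eq_top, hat, hbt, hct], fun h hi => ?_⟩
  set m : ℂ := ⨍ w, h w ∂arcLength with hm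
  have hmn : ‖m‖ₑ ≤ a * b * eLpNorm h (ENNReal.ofReal p) arcLength := by
    rw [hm, average_eq, enorm_smul, mul_assoc]
    gcongr
    refine (enorm_integral_le_lintegral_enorm _).trans ?_
    rw [← eLpNorm_one_eq_lintegral_enorm, mul_comm]
    refine (eLpNorm_le_eLpNorm_mul_rpow_measure_univ hp1 hi.aestronglyMeasurable).trans_eq ?_
    rw [hb]
    simp
  calc _ ≤ eLpNorm h (ENNReal.ofReal p) arcLength +
        eLpNorm (fun _ : Circle => m) (ENNReal.ofReal p) arcLength :=
        eLpNorm_sub_le hi.aestronglyMeasurable aestronglyMeasurable_const hp1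
    _ ≤ eLpNorm h (ENNReal.ofReal p) arcLength + ‖m‖ₑ * c := by
        gcongr
        rw [eLpNorm_const' m (zero_lt_one.trans_le hp1).ne' ENNReal.ofReal_ne_top, hc, one_div]
    _ ≤ eLpNorm h (ENNReal.ofReal p) arcLength +
        a * b * eLpNorm h (ENNReal.ofReal p) arcLength * c := by gcongr
    _ = _ := by ring

/-- The map `z ↦ z ^ k * q (z ^ n)`. -/
noncomputable def twistedMap (k n : ℤ) (q : Circle → Circle) (z : Circle) : Circle :=
  z ^ k * q (z ^ n)

theorem twistedMap_mem_degreeClass {p : ℝ} (hp : 1 < p) (k n : ℤ) {φ : ℝ → ℝ} {K : ℝ}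
    (hK : ∀ x y, |φ x - φ y| ≤ K * |x - y|) {d : ℤ}
    (hφ : φ Real.pi = φ (-Real.pi) + 2 * Real.pi * d) :
    twistedMap k n (circleMapOfPhase φ) ∈ degreeClass (1 / p) p (k + n * d) := by
  have hK0 : 0 ≤ K := by simpa using (abs_nonneg _).trans (hK 1 0)
  have hφc : Continuous φ := by
    have : LipschitzWith K.toNNReal φ := LipschitzWith.of_dist_le_mul fun x y => by
      rw [Real.dist_eq, Real.dist_eq, Real.coe_toNNReal _ hK0]
      exact hK x y
    exact this.continuous
  refine ⟨sobolevNorm_one_div_lt_top hp (K := |(k : ℝ)| + K * (Real.pi / 2) * |(n : ℝ)|)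
    fun z w => ?_, ?_⟩
  · unfold twistedMap
    set q := circleMapOfPhase φ with hq
    have h1 := norm_zpow_sub_zpow_le z w k
    have h2 := norm_circleMapOfPhase_sub_le hK hφ (z ^ n) (w ^ n)
    have h3 := mul_le_mul_of_nonneg_left (norm_zpow_sub_zpow_le z w n)
      (show 0 ≤ K * (Real.pi / 2) by have := Real.pi_pos; positivity)
    have e : ((z ^ k * q (z ^ n) : Circle) : ℂ) - ((w ^ k * q (w ^ n) : Circle) : ℂ) =
        (((z ^ k : Circle) : ℂ) - ((w ^ k : Circle) : ℂ)) * q (z ^ n) +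
          ((w ^ k : Circle) : ℂ) * ((q (z ^ n) : ℂ) - (q (w ^ n) : ℂ)) := by
      rw [Circle.coe_mul, Circle.coe_mul]; ring
    rw [e]
    refine (norm_add_le _ _).trans ?_
    rw [norm_mul, norm_mul, Circle.norm_coe, Circle.norm_coe, mul_one, one_mul]
    linarith
  · obtain ⟨ψ, hψc, hψ, hψe⟩ := exists_quasiperiodic_extension hφc hφ
    have hzp : ∀ (x : ℝ) (m : ℤ), Circle.exp x ^ m = Circle.exp (m * x) := fun x m => by
      rw [← Circle.exp_zsmul, zsmul_eq_mul]
    have hper : Function.Periodic (fun θ => ψ θ - d * θ) (2 * Real.pi) := fun θ => by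
      simp only [hψ]; ring
    -- A turn of `θ` adds `2πk` through the first factor and `n` periods of `ψ`, each worth `2πd`,
    -- through the second.
    refine hasDegree_of_lift (φ := fun θ => k * θ + ψ (n * θ)) (by fun_prop) (fun θ => ?_)
      fun θ => ?_
    · rw [twistedMap, hzp, hzp, hψe, Circle.exp_add]
    · have h := hper.int_mul n (n * θ)
      rw [show (n : ℝ) * θ + n * (2 * Real.pi) = n * (θ + 2 * Real.pi) by ring] at h
      push_cast
      linear_combination h

/-- The two classes of critical order are at distance at most a power of a small parameter. -/
theorem exists_critical_sobolevDist_le {p : ℝ} (hp : 1 < p) {d₁ d₂ : ℤ} (hd : d₁ ≠ d₂) :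
    ∃ R : ℝ≥0∞, R ≠ ⊤ ∧ ∀ c : ℝ, 0 < c → ∃ f ∈ degreeClass (1 / p) p d₁,
      ∃ g ∈ degreeClass (1 / p) p d₂, sobolevDist (1 / p) p f g ≤
        R * ENNReal.ofReal (c ^ p * Real.log Real.pi + Real.pi / 2 * c ^ (p - 1)) ^ (1 / p) := by
  have hp0 : 0 < p := by linarith
  have hσ : 0 < 1 / p := by positivity
  have hσ1 : 1 / p < 1 := by rw [div_lt_one hp0]; exact hp
  have hπ := Real.pi_gt_three
  obtain ⟨C, hC, hCb⟩ := exists_gagliardo_rpow_le_of_log hp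
  obtain ⟨Q₁, hQ₁, hQ₁b⟩ := exists_gagliardo_rpow_zpow_mul_le hσ hσ1 hp.le d₂
  obtain ⟨Q₂, hQ₂, hQ₂b⟩ := exists_eLpNorm_sub_average_le hp.le
  set n : ℤ := d₁ - d₂ with hn
  have hn0 : n ≠ 0 := sub_ne_zero.2 hd
  set Λ : ℝ≥0∞ := ENNReal.ofReal |(n : ℝ)| ^ (1 + 1 / p * p) with hΛ
  have hΛt : Λ ≠ ⊤ := ENNReal.rpow_ne_top_of_nonneg (by positivity) ENNReal.ofReal_ne_top
  set T : ℝ≥0∞ := 2 ^ (1 + 1 / p * p) with hT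
  have hTt : T ≠ ⊤ := ENNReal.rpow_ne_top_of_nonneg (by positivity) ENNReal.ofNat_ne_top
  set U : ℝ≥0∞ := ENNReal.ofReal (C * 2 ^ p) with hU
  have hrt : ∀ a : ℝ≥0∞, a ≠ ⊤ → a ^ (1 / p) ≠ ⊤ := fun a ha =>
    ENNReal.rpow_ne_top_of_nonneg hσ.le ha
  -- The first summand controls the `Lᵖ` norm after removal of the mean, the second the Gagliardo
  -- semi-norm; neither involves `c`.
  refine ⟨Q₂ * (T * U) ^ (1 / p) + (Q₁ * (Λ + T) * U) ^ (1 / p), ?_, fun c hc => ?_⟩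
  · refine ENNReal.add_ne_top.2 ⟨ENNReal.mul_ne_top hQ₂ (hrt _ ?_), hrt _ ?_⟩
    · exact ENNReal.mul_ne_top hTt ENNReal.ofReal_ne_top
    · exact ENNReal.mul_ne_top (ENNReal.mul_ne_top hQ₁ (ENNReal.add_ne_top.2 ⟨hΛt, hTt⟩))
        ENNReal.ofReal_ne_top
  obtain ⟨δ, K, φ₀, φ₁, hδ, hlog, hK₀, hK₁, hφ₀, hφ₁, hbub⟩ := exists_bubble hc
  set q₀ := circleMapOfPhase φ₀ with hq₀
  set q₁ := circleMapOfPhase φ₁ with hq₁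
  have hf := twistedMap_mem_degreeClass hp d₂ n hK₀ hφ₀
  have hg := twistedMap_mem_degreeClass hp d₂ n hK₁ hφ₁
  rw [show d₂ + n * 1 = d₁ by rw [hn]; ring] at hf
  rw [show d₂ + n * 0 = d₂ by ring] at hg
  refine ⟨_, hf, _, hg, ?_⟩
  set f := twistedMap d₂ n q₀ with hfd
  set g := twistedMap d₂ n q₁ with hgd
  set H : Circle → ℂ := fun z => (q₀ z : ℂ) - (q₁ z : ℂ) with hHd
  have hHc : Continuous H := by
    have h0 := continuous_of_norm_sub_le (norm_circleMapOfPhase_sub_le hK₀ hφ₀)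
    have h1 := continuous_of_norm_sub_le (norm_circleMapOfPhase_sub_le hK₁ hφ₁)
    exact h0.sub h1
  have hHe : ∀ x, |x| ≤ Real.pi → H (Circle.exp x) =
      2 * Complex.I * (Real.cos (logProfile c δ |x|) : ℂ) := fun x hx => by
    simp only [hHd]
    rw [hq₀, hq₁, circleMapOfPhase_exp_of_abs_le hφ₀ hx, circleMapOfPhase_exp_of_abs_le hφ₁ hx,
      hbub x hx]
  have hH0 : ∀ x, 1 ≤ |x| → |x| ≤ Real.pi → H (Circle.exp x) = 0 := fun x h1 hx => by
    rw [hHe x hx, logProfile_of_one_le hc.le hδ hlog h1, Real.cos_pi_div_two]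
    simp
  have hHl : ∀ x y : ℝ, |x| ≤ Real.pi → |y| ≤ Real.pi →
      ‖H (Circle.exp x) - H (Circle.exp y)‖ ≤
        (2 * c) * |Real.log ((|y| + δ) / (|x| + δ))| := fun x y hx hy => by
    rw [hHe x hx, hHe y hy, ← mul_sub, ← Complex.ofReal_sub, norm_mul, norm_mul, Complex.norm_I,
      Complex.norm_real, Real.norm_eq_abs, Complex.norm_ofNat, mul_one, mul_assoc]
    refine mul_le_mul_of_nonneg_left ?_ (by norm_num)
    have h1 : |Real.cos (logProfile c δ |x|) - Real.cos (logProfile c δ |y|)| ≤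
        |logProfile c δ |x| - (logProfile c δ |y|)| := Real.abs_cos_sub_cos_le _ _
    refine (h1.trans (abs_logProfile_sub_le_log hc.le _ _)).trans_eq ?_
    have hx0 : 1 + |x| / δ ≠ 0 := by positivity
    have hy0 : 1 + |y| / δ ≠ 0 := by positivity
    rw [abs_sub_comm, ← Real.log_div hy0 hx0]
    congr 3
    field_simp
    ring
  set G : ℝ≥0∞ := gagliardo (1 / p) p H ^ p with hG
  set E : ℝ≥0∞ :=
    ENNReal.ofReal (c ^ p * Real.log Real.pi + Real.pi / 2 * c ^ (p - 1)) with hE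
  have hlogπ : 0 ≤ Real.log Real.pi := Real.log_nonneg (by linarith)
  -- One factor `c` absorbs `log(1 + 1/δ)` into the constant `π/2`; the power `c^(p-1)` that is left
  -- is why `p > 1` is needed.
  have hGE : G ≤ U * E := by
    refine (hCb H (2 * c) δ (by positivity) hδ hHl).trans ?_
    rw [hU, hE, ← ENNReal.ofReal_mul (by positivity), Real.mul_rpow (by norm_num) hc.le]
    refine ENNReal.ofReal_le_ofReal ?_
    have h1 : Real.log (1 + Real.pi / δ) ≤ Real.log Real.pi + Real.log (1 + 1 / δ) := by
      rw [← Real.log_mul (by positivity) (by positivity)]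
      refine Real.log_le_log (by positivity) ?_
      rw [mul_add, mul_one_div]
      linarith
    have h2 : c ^ p = c ^ (p - 1) * c := by
      rw [← Real.rpow_add_one hc.ne', sub_add_cancel]
    have h3 : c ^ p * Real.log (1 + Real.pi / δ) ≤
        c ^ p * Real.log Real.pi + Real.pi / 2 * c ^ (p - 1) := by
      calc _ ≤ c ^ p * (Real.log Real.pi + Real.log (1 + 1 / δ)) := by gcongr
        _ = c ^ p * Real.log Real.pi + c ^ (p - 1) * (c * Real.log (1 + 1 / δ)) := by
            rw [mul_add, h2]; ring
        _ = _ := by rw [hlog]; ring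
    calc _ = C * 2 ^ p * (c ^ p * Real.log (1 + Real.pi / δ)) := by ring
      _ ≤ _ := mul_le_mul_of_nonneg_left h3 (by positivity)
  have hmp := measurePreserving_zpow_arcLength hn0
  set V : Circle → ℂ := fun z => H (z ^ n) with hV
  have hVc : Continuous V := hHc.comp (continuous_zpow n)
  -- The bubble vanishes outside a short arc, so its energy also controls its `Lᵖ` norm, which the
  -- power map preserves.
  have hLp : ∫⁻ z, ‖V z‖ₑ ^ p ∂arcLength ≤ T * G := by
    simp only [hV]
    rw [hmp.lintegral_comp (f := fun z => ‖H z‖ₑ ^ p) (hHc.measurable.enorm.pow_const p)]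
    exact lintegral_rpow_le_gagliardo hσ hp0 hH0
  set h : Circle → ℂ := fun z => ((z ^ d₂ : Circle) : ℂ) * V z with hh
  have hhc : Continuous h := by
    have h0 : Continuous fun z : Circle => z ^ d₂ := continuous_zpow d₂
    have h1 : Continuous fun z : Circle => (z : ℂ) := by fun_prop
    exact (h1.comp h0).mul hVc
  have hhi := integrable_arcLength_of_continuous hhc
  have hfg : ∀ z, (f z : ℂ) - (g z : ℂ) = h z := fun z => by
    simp only [hfd, hgd, hh, hV, hHd, twistedMap, Circle.coe_mul]
    ring
  have hroot : ∀ a b : ℝ≥0∞, a ^ p ≤ b → a ≤ b ^ (1 / p) := fun a b hab => by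
    have := ENNReal.rpow_le_rpow hab hσ.le
    rwa [← ENNReal.rpow_mul, mul_one_div_cancel hp0.ne', ENNReal.rpow_one] at this
  have hgag : gagliardo (1 / p) p h ≤ (Q₁ * (Λ + T) * U) ^ (1 / p) * E ^ (1 / p) := by
    rw [← ENNReal.mul_rpow_of_nonneg _ _ hσ.le]
    refine hroot _ _ ((hQ₁b V hVc.measurable).trans ?_)
    calc _ ≤ Q₁ * (Λ * G + T * G) := by
          gcongr
          exact gagliardo_rpow_comp_zpow_le hσ hp0 hHc.measurable hn0
      _ = Q₁ * (Λ + T) * G := by ring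
      _ ≤ Q₁ * (Λ + T) * (U * E) := by gcongr
      _ = _ := by ring
  have hnorm : eLpNorm h (ENNReal.ofReal p) arcLength ≤ (T * U) ^ (1 / p) * E ^ (1 / p) := by
    rw [← ENNReal.mul_rpow_of_nonneg _ _ hσ.le]
    refine hroot _ _ ?_
    rw [eLpNorm_rpow_eq hp0]
    calc _ = ∫⁻ z, ‖V z‖ₑ ^ p ∂arcLength := by
          refine lintegral_congr fun z => ?_
          simp only [hh]
          rw [← ofReal_norm, norm_mul, Circle.norm_coe, one_mul, ofReal_norm]
      _ ≤ T * G := hLp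
      _ ≤ T * (U * E) := by gcongr
      _ = _ := by ring
  unfold sobolevDist
  simp only [hfg]
  have hsub : Integrable (fun z => h z - ⨍ w, h w ∂arcLength) arcLength :=
    hhi.sub (integrable_const _)
  refine (sobolevNorm_one_div_le hp hsub).trans ?_
  rw [gagliardo_sub_const, add_mul]
  refine add_le_add ((hQ₂b h hhi).trans ?_) hgag
  rw [mul_assoc]
  gcongr

theorem classDist_sobolevDist_critical {p : ℝ} (hp : 1 < p) (d₁ d₂ : ℤ) :
    classDist (sobolevDist (1 / p) p) (1 / p) p d₁ d₂ = 0 := by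
  have hp0 : 0 < p := by linarith
  have hσ : 0 < 1 / p := by positivity
  rw [← nonpos_iff_eq_zero]
  rcases eq_or_ne d₁ d₂ with rfl | hd
  · obtain ⟨C, -, h⟩ := exists_sobolevDist_le hσ hp.le
    obtain ⟨f, hf, g, hg, hfg⟩ := h d₁ d₁
    refine (iInf₂_le_of_le f hf (iInf₂_le g hg)).trans (hfg.trans ?_)
    rw [sub_self, abs_zero, Real.zero_rpow hσ.ne', mul_zero, ENNReal.ofReal_zero]
  · obtain ⟨R, hR, h⟩ := exists_critical_sobolevDist_le hp hd
    have hlim : Tendsto (fun c : ℝ => R * ENNReal.ofReal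
        (c ^ p * Real.log Real.pi + Real.pi / 2 * c ^ (p - 1)) ^ (1 / p)) (𝓝[>] 0) (𝓝 0) := by
      have h1 : Tendsto (fun c : ℝ => c ^ p * Real.log Real.pi + Real.pi / 2 * c ^ (p - 1))
          (𝓝[>] 0) (𝓝 0) := by
        have hc : Continuous fun c : ℝ =>
            c ^ p * Real.log Real.pi + Real.pi / 2 * c ^ (p - 1) :=
          ((Real.continuous_rpow_const hp0.le).mul continuous_const).add
            (continuous_const.mul (Real.continuous_rpow_const (by linarith)))
        have := hc.tendsto 0
        rw [Real.zero_rpow hp0.ne', Real.zero_rpow (by linarith), zero_mul, mul_zero,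
          add_zero] at this
        exact this.mono_left nhdsWithin_le_nhds
      have h2 := (ENNReal.continuous_rpow_const (y := 1 / p)).tendsto _ |>.comp
        (ENNReal.tendsto_ofReal h1)
      have h3 := ENNReal.Tendsto.const_mul (a := R) h2 (Or.inr hR)
      rw [ENNReal.ofReal_zero, ENNReal.zero_rpow_of_pos hσ, mul_zero] at h3
      exact h3
    refine ge_of_tendsto hlim (eventually_nhdsWithin_of_forall fun c hc => ?_)
    obtain ⟨f, hf, g, hg, hfg⟩ := h c hc
    exact (iInf₂_le_of_le f hf (iInf₂_le g hg)).trans hfg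

end CriticalCase

/-! ### Assembly of the two regimes and the two distances. -/

theorem theorem1p2 :
    (∀ p : ℝ, 1 < p → ∀ d₁ d₂ : ℤ,
      classDist (sobolevDist (1 / p) p) (1 / p) p d₁ d₂ = 0 ∧
      classDist (sobolevSemidist (1 / p) p) (1 / p) p d₁ d₂ = 0) ∧
    (∀ s p : ℝ, 0 < s → 1 ≤ p → 1 < s * p →
      ∃ C' C : ℝ, 0 < C' ∧ 0 < C ∧ ∀ d₁ d₂ : ℤ,
        (ENNReal.ofReal (C' * |(d₁ : ℝ) - d₂| ^ s) ≤
            classDist (sobolevDist s p) s p d₁ d₂ ∧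
          classDist (sobolevDist s p) s p d₁ d₂ ≤
            ENNReal.ofReal (C * |(d₁ : ℝ) - d₂| ^ s)) ∧
        (ENNReal.ofReal (C' * |(d₁ : ℝ) - d₂| ^ s) ≤
            classDist (sobolevSemidist s p) s p d₁ d₂ ∧
          classDist (sobolevSemidist s p) s p d₁ d₂ ≤
            ENNReal.ofReal (C * |(d₁ : ℝ) - d₂| ^ s))) := by
  have hle : ∀ s p : ℝ, 0 < s → ∀ d₁ d₂ : ℤ, classDist (sobolevSemidist s p) s p d₁ d₂ ≤
      classDist (sobolevDist s p) s p d₁ d₂ := fun s p hs d₁ d₂ =>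
    iInf₂_mono fun f _ => iInf₂_mono fun g _ => sobolevSemidist_le_sobolevDist hs p f g
  refine ⟨fun p hp d₁ d₂ => ?_, fun s p hs hp hsp => ?_⟩
  · have h := classDist_sobolevDist_critical hp d₁ d₂
    exact ⟨h, le_antisymm ((hle (1 / p) p (by positivity) d₁ d₂).trans h.le) bot_le⟩
  · obtain ⟨C', hC', hlow⟩ := sobolevSemidist_lower_bound hs hp hsp
    obtain ⟨C, hC, hup⟩ := exists_sobolevDist_le hs hp
    refine ⟨C', C, hC', hC, fun d₁ d₂ => ?_⟩
    have h1 : ENNReal.ofReal (C' * |(d₁ : ℝ) - d₂| ^ s) ≤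
        classDist (sobolevSemidist s p) s p d₁ d₂ :=
      le_iInf₂ fun f hf => le_iInf₂ fun g hg => hlow d₁ d₂ f hf g hg
    have h2 : classDist (sobolevDist s p) s p d₁ d₂ ≤
        ENNReal.ofReal (C * |(d₁ : ℝ) - d₂| ^ s) := by
      obtain ⟨f, hf, g, hg, hfg⟩ := hup d₁ d₂
      exact (iInf₂_le_of_le f hf (iInf₂_le g hg)).trans hfg
    exact ⟨⟨h1.trans (hle s p hs d₁ d₂), h2⟩, h1, (hle s p hs d₁ d₂).trans h2⟩
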